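/- Let $n\ge 1$, $\gamma\in(0,2)$, $\alpha=\frac{2}{\gamma+2}$, $R>0$, and write $B_r=\{x\in\mathbb R^n:|x|<r\}$. Let $W(t)=\frac1\gamma t^{-\gamma}$ for $t>0$, $W(t)=0$ for $t\le 0$, and $$J(u,\Omega)=\int_\Omega\Big(\tfrac12|\nabla u|^2+W(u)\Big)\,dx .$$ Let $u\in H^1(B_R)$, $u\ge 0$, be a minimizer of $J$ in $B_R$, that is, $J(u,B_R)\le J(v,B_R)$ for every $v\in H^1(B_R)$ with $v\ge0$ a.e. and $v-u\in H^1_0(B_R)$. Then for every $0<r\le R$ the energy $J(u,B_r)$ is finite and $u$ has a trace in $L^2(\partial B_r)$, and the function $$W_u(r)=r^{-n-2(\alpha-1)}J(u,B_r)-\frac{\alpha}{2}\,r^{-(n-1)-2\alpha}\int_{\partial B_r}u^2\,d\sigma,\qquad 0<r\le R,$$ where $u$ on $\partial B_r$ is understood in the sense of traces, is nondecreasing in $r$. Moreover, $W_u$ is constant on $(0,R]$ if and only if $u$ is homogeneous of degree $\alpha$ in $B_R$, i.e. for every $t\in(0,1]$ one has $u(tx)=t^\alpha u(x)$ for a.e.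 $x\in B_R$. -/

import Mathlib

open MeasureTheory Set Filter Topology
open scoped ENNReal ContDiff

namespace AltPhillips

/-- `ℝⁿ` with its Euclidean norm and Lebesgue measure. -/
abbrev Space (n : ℕ) : Type := EuclideanSpace ℝ (Fin n)

/-- Smooth test functions with compact support in `Ω`. -/
structure IsTestFunction {n : ℕ} (Ω : Set (Space n)) (φ : Space n → ℝ) : Prop where
  smooth : ContDiff ℝ ∞ φ
  compact : HasCompactSupport φ
  support : tsupport φ ⊆ Ω

/-- `u ∈ L²(Ω)` and `G ∈ L²(Ω; ℝⁿ)` is its weak gradient in `Ω`. -/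
structure HasWeakGradient {n : ℕ} (Ω : Set (Space n)) (u : Space n → ℝ)
    (G : Space n → Space n) : Prop where
  memLp : MemLp u 2 (volume.restrict Ω)
  memLp_grad : MemLp G 2 (volume.restrict Ω)
  weak : ∀ φ : Space n → ℝ, IsTestFunction Ω φ → ∀ v : Space n,
    ∫ x in Ω, u x * fderiv ℝ φ x v = -∫ x in Ω, inner ℝ (G x) v * φ x

/-- The Sobolev space `H¹(Ω)`. -/
def MemH1 {n : ℕ} (Ω : Set (Space n)) (u : Space n → ℝ) : Prop :=
  ∃ G : Space n → Space n, HasWeakGradient Ω u G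

open Classical in
/-- The weak gradient of `u ∈ H¹(Ω)`; it is unique up to null sets of the open set `Ω`. -/
noncomputable def weakGradient {n : ℕ} (Ω : Set (Space n)) (u : Space n → ℝ) :
    Space n → Space n :=
  if h : MemH1 Ω u then h.choose else 0

/-- The space `H¹₀(Ω)`, the closure of the test functions in `H¹(Ω)`. -/
def MemH10 {n : ℕ} (Ω : Set (Space n)) (w : Space n → ℝ) : Prop :=
  MemH1 Ω w ∧ ∃ φ : ℕ → Space n → ℝ, (∀ k, IsTestFunction Ω (φ k)) ∧
    Tendsto (fun k => eLpNorm (fun x => φ k x - w x) 2 (volume.restrict Ω)) atTop (𝓝 0) ∧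
    Tendsto (fun k => eLpNorm (fun x => gradient (φ k) x - weakGradient Ω w x) 2
      (volume.restrict Ω)) atTop (𝓝 0)

/-- The negative power potential `W(t) = t^{-γ} / γ` for `t > 0` and `W(t) = 0` for `t ≤ 0`. -/
noncomputable def potential (γ t : ℝ) : ℝ :=
  if 0 < t then (1 / γ) * t ^ (-γ) else 0

/-- The energy `J(u, Ω) = ∫_Ω (|∇u|² / 2 + W(u)) dx`, with values in `[0, ∞]`. -/
noncomputable def energy {n : ℕ} (γ : ℝ) (u : Space n → ℝ) (Ω : Set (Space n)) : ℝ≥0∞ :=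
  ∫⁻ x in Ω, ENNReal.ofReal ((1 / 2) * ‖weakGradient Ω u x‖ ^ 2 + potential γ (u x))

/-- `u` is a nonnegative minimizer of `J` in `Ω`: it lies in `H¹(Ω)` and has the least energy
among all nonnegative functions in `H¹(Ω)` with the same boundary data. -/
structure IsMinimizer {n : ℕ} (γ : ℝ) (u : Space n → ℝ) (Ω : Set (Space n)) : Prop where
  memH1 : MemH1 Ω u
  nonneg : ∀ᵐ x ∂(volume.restrict Ω), 0 ≤ u x
  le_energy : ∀ v : Space n → ℝ, MemH1 Ω v → (∀ᵐ x ∂(volume.restrict Ω), 0 ≤ v x) →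
    MemH10 Ω (fun x => v x - u x) → energy γ u Ω ≤ energy γ v Ω

/-- The surface integral `∫_{∂B_r} f dσ = r^{n-1} ∫_{∂B_1} f(ry) dσ(y)`; the measure
`volume.toSphere` is the surface measure of the unit sphere. -/
noncomputable def sphereIntegral {n : ℕ} (r : ℝ) (f : Space n → ℝ) : ℝ :=
  r ^ ((n : ℝ) - 1) *
    ∫ y : Metric.sphere (0 : Space n) 1, f (r • (y : Space n)) ∂(volume : Measure (Space n)).toSphere

/-- `g` is the trace on `∂B_r` of `u ∈ H¹(B_r)`: the function `g ∈ L²(∂B_r)` with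
`∫_{B_r} (u ∂_v ψ + ∂_v u ψ) dx = ∫_{∂B_r} g ψ (v · ν) dσ` for all smooth `ψ` on `ℝⁿ` and all
directions `v`, where `ν = x / r` is the outer unit normal. This determines `g` up to null sets
of the sphere. -/
structure IsSphereTrace {n : ℕ} (u : Space n → ℝ) (r : ℝ) (g : Space n → ℝ) : Prop where
  memH1 : MemH1 (Metric.ball 0 r) u
  memLp : MemLp (fun y : Metric.sphere (0 : Space n) 1 => g (r • (y : Space n))) 2
    (volume : Measure (Space n)).toSphere
  green : ∀ ψ : Space n → ℝ, ContDiff ℝ ∞ ψ → ∀ v : Space n,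
    ∫ x in Metric.ball 0 r,
        (u x * fderiv ℝ ψ x v + inner ℝ (weakGradient (Metric.ball 0 r) u x) v * ψ x) =
      sphereIntegral r (fun x => g x * ψ x * inner ℝ v (r⁻¹ • x))

open Classical in
/-- The trace of `u` on `∂B_r`. -/
noncomputable def sphereTrace {n : ℕ} (u : Space n → ℝ) (r : ℝ) : Space n → ℝ :=
  if h : ∃ g, IsSphereTrace u r g then h.choose else 0

/-- The homogeneity exponent `α = 2 / (γ + 2)`. -/
noncomputable def homExponent (γ : ℝ) : ℝ := 2 / (γ + 2)

/-- The Weiss energy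
`W_u(r) = r^{-n-2(α-1)} J(u, B_r) - (α/2) r^{-(n-1)-2α} ∫_{∂B_r} u² dσ`. -/
noncomputable def weissEnergy {n : ℕ} (γ : ℝ) (u : Space n → ℝ) (r : ℝ) : ℝ :=
  r ^ (-(n : ℝ) - 2 * (homExponent γ - 1)) * (energy γ u (Metric.ball 0 r)).toReal -
    (homExponent γ / 2) * r ^ (-((n : ℝ) - 1) - 2 * homExponent γ) *
      sphereIntegral r (fun x => sphereTrace u r x ^ 2)

/-- `u`, as an element of a Lebesgue space, is homogeneous of degree `a` in `B_R`. -/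
def IsHomogeneousInBall {n : ℕ} (a : ℝ) (u : Space n → ℝ) (R : ℝ) : Prop :=
  ∀ t ∈ Ioc (0 : ℝ) 1, ∀ᵐ x ∂((volume : Measure (Space n)).restrict (Metric.ball 0 R)),
    u (t • x) = t ^ a * u x

end AltPhillips

namespace AltPhillips

/-! ### Square integrable functions -/

section L2

variable {X : Type*} [MeasurableSpace X] {μ : Measure X}
  {F : Type*} [NormedAddCommGroup F]

/-! Everything follows from one exact formula: for 0 < a < b ≤ R, W_u(b) - W_u(a) is the integral
over B_b \ B_a of |x|^(-n-2α) (α u - x·∇u)². The integrand is nonnegative, so W_u is nondecreasing.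
W_u is constant exactly when Euler's equation x·∇u = α u holds a.e., which is homogeneity of degree
α. This is `IsMinimizer.weissEnergy_sub`.

The formula combines two identities of the same shape, recorded by `RadialIdentity`: a field with
divergence k and radial component g = x·X is tested against radial cutoffs ζ(|x|²). One is div(x u²)
= n u² + 2 u x·∇u, valid for every H¹ function. The other uses minimality. The competitor v is given
by v(Ψ(y)) = exp(α ε ζ(|y|²)) u(y) with Ψ(y) = exp(ε ζ(|y|²)) y. It agrees with u near the boundary,
is nonnegative, and is positive exactly where u ∘ Ψ⁻¹ is. Since γα = 2 - 2α, the gradient and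
potential terms pick up the same exponential factor, and the first variation at ε = 0 can be
computed without ever differentiating the singular potential.

Choosing ζ(|x|²) to be a truncated power |x|^(-M) turns each identity into an increment formula for
r^(-M) ∫_{B_r} k (`RadialIdentity.integral_annulus`). With M = n+2α-2 for the energy and M = n+2α
for u², the energy densities on the annulus cancel and the remaining terms form a square. No
derivative of W_u in r is needed.

Three supporting facts are required. The trace is the L² limit of restrictions of smooth
approximations, and r ∫_{∂B_r} u² = ∫_{B_r} (n u² + 2 u x·∇u) turns the boundary term into a volume
integral (`exists_sphereTrace`). The energy is finite because u + (R² - |x|²)^β is an admissible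
competitor for some 1/2 < β < 1/γ; such β exist because γ < 2 (`IsMinimizer.energy_ne_top`).
Finally, Euler's equation and homogeneity are compared by testing u against dilated test functions,
since u is only a Sobolev function (`HasWeakGradient.isHomogeneousInBall_iff`). -/

theorem tendsto_integral_inner_of_eLpNorm [InnerProductSpace ℝ F]
    {f g : ℕ → X → F} {f₀ g₀ : X → F}
    (hf : ∀ k, MemLp (f k) 2 μ) (hf₀ : MemLp f₀ 2 μ) (hg : ∀ k, MemLp (g k) 2 μ)
    (hg₀ : MemLp g₀ 2 μ)
    (hfl : Tendsto (fun k => eLpNorm (f k - f₀) 2 μ) atTop (𝓝 0))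
    (hgl : Tendsto (fun k => eLpNorm (g k - g₀) 2 μ) atTop (𝓝 0)) :
    Tendsto (fun k => ∫ x, inner ℝ (f k x) (g k x) ∂μ) atTop
      (𝓝 (∫ x, inner ℝ (f₀ x) (g₀ x) ∂μ)) := by
  have h1 := (Lp.tendsto_Lp_iff_tendsto_eLpNorm'' f hf f₀ hf₀).2 hfl
  have h2 := (Lp.tendsto_Lp_iff_tendsto_eLpNorm'' g hg g₀ hg₀).2 hgl
  have key : ∀ {a b : X → F} (ha : MemLp a 2 μ) (hb : MemLp b 2 μ),
      inner ℝ (ha.toLp a) (hb.toLp b) = ∫ x, inner ℝ (a x) (b x) ∂μ := by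
    intro a b ha hb
    rw [L2.inner_def]
    refine integral_congr_ae ?_
    filter_upwards [ha.coeFn_toLp, hb.coeFn_toLp] with x h1 h2
    rw [h1, h2]
  have h3 := h1.inner (𝕜 := ℝ) h2
  simp only [key] at h3
  exact h3

theorem tendsto_integral_mul_of_eLpNorm {f g : ℕ → X → ℝ} {f₀ g₀ : X → ℝ}
    (hf : ∀ k, MemLp (f k) 2 μ) (hf₀ : MemLp f₀ 2 μ) (hg : ∀ k, MemLp (g k) 2 μ)
    (hg₀ : MemLp g₀ 2 μ)
    (hfl : Tendsto (fun k => eLpNorm (f k - f₀) 2 μ) atTop (𝓝 0))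
    (hgl : Tendsto (fun k => eLpNorm (g k - g₀) 2 μ) atTop (𝓝 0)) :
    Tendsto (fun k => ∫ x, f k x * g k x ∂μ) atTop (𝓝 (∫ x, f₀ x * g₀ x ∂μ)) := by
  have := tendsto_integral_inner_of_eLpNorm hg hg₀ hf hf₀ hgl hfl
  simpa [mul_comm] using this

/-- Convergence in `L²` is preserved by pointwise operations with a linear bound. -/
theorem tendsto_eLpNorm_of_le_mul {G : Type*} [NormedAddCommGroup G] {f : ℕ → X → F} {g : ℕ → X → G} {C : ℝ}
    (h : ∀ k, ∀ᵐ x ∂μ, ‖g k x‖ ≤ C * ‖f k x‖)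
    (hf : Tendsto (fun k => eLpNorm (f k) 2 μ) atTop (𝓝 0)) :
    Tendsto (fun k => eLpNorm (g k) 2 μ) atTop (𝓝 0) := by
  have h1 : Tendsto (fun k => ENNReal.ofReal C * eLpNorm (f k) 2 μ) atTop (𝓝 0) := by
    simpa using ENNReal.Tendsto.const_mul hf (Or.inr (by simp))
  exact tendsto_of_tendsto_of_tendsto_of_le_of_le tendsto_const_nhds h1 (fun _ => zero_le)
    (fun k => eLpNorm_le_mul_eLpNorm_of_ae_le_mul (h k) 2)

theorem tendsto_eLpNorm_add {f g : ℕ → X → F} (hfm : ∀ k, AEStronglyMeasurable (f k) μ)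
    (hgm : ∀ k, AEStronglyMeasurable (g k) μ)
    (hf : Tendsto (fun k => eLpNorm (f k) 2 μ) atTop (𝓝 0))
    (hg : Tendsto (fun k => eLpNorm (g k) 2 μ) atTop (𝓝 0)) :
    Tendsto (fun k => eLpNorm (f k + g k) 2 μ) atTop (𝓝 0) := by
  have h1 := hf.add hg
  rw [add_zero] at h1
  exact tendsto_of_tendsto_of_tendsto_of_le_of_le tendsto_const_nhds h1 (fun _ => zero_le)
    (fun k => eLpNorm_add_le (hfm k) (hgm k) (by norm_num))

theorem eLpNorm_two_sq (f : X → F) : eLpNorm f 2 μ ^ 2 = ∫⁻ x, ‖f x‖ₑ ^ 2 ∂μ := by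
  rw [eLpNorm_eq_lintegral_rpow_enorm_toReal (by norm_num) (by norm_num)]
  simp only [ENNReal.toReal_ofNat, ENNReal.rpow_ofNat]
  rw [← ENNReal.rpow_natCast, ← ENNReal.rpow_mul]
  norm_num

theorem tendsto_eLpNorm_two_iff {f : ℕ → X → F} :
    Tendsto (fun k => eLpNorm (f k) 2 μ) atTop (𝓝 0) ↔
      Tendsto (fun k => ∫⁻ x, ‖f k x‖ₑ ^ 2 ∂μ) atTop (𝓝 0) := by
  simp only [← eLpNorm_two_sq]
  constructor
  · intro h
    simpa using ENNReal.Tendsto.pow (n := 2) h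
  · intro h
    have h2 := (ENNReal.continuous_rpow_const (y := (2⁻¹ : ℝ))).tendsto 0 |>.comp h
    have : ∀ a : ℝ≥0∞, (a ^ 2) ^ (2⁻¹ : ℝ) = a := by
      intro a
      rw [← ENNReal.rpow_natCast, ← ENNReal.rpow_mul]; norm_num
    simpa [Function.comp_def, this] using h2

end L2

end AltPhillips

namespace AltPhillips

variable {n : ℕ} {Ω : Set (Space n)} {u u' : Space n → ℝ} {G G' : Space n → Space n}

/-! ### Weak gradients -/

theorem inner_gradient_eq_fderiv (f : Space n → ℝ) (x v : Space n) :
    inner ℝ (gradient f x) v = fderiv ℝ f x v := by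
  simp [gradient]

theorem continuous_gradient {f : Space n → ℝ} (hf : ContDiff ℝ ∞ f) : Continuous (gradient f) :=
  (InnerProductSpace.toDual ℝ (Space n)).symm.continuous.comp
    (hf.continuous_fderiv (by simp))

namespace IsTestFunction

variable {φ : Space n → ℝ}

theorem zero_of_notMem (h : IsTestFunction Ω φ) {x : Space n} (hx : x ∉ Ω) : φ x = 0 :=
  image_eq_zero_of_notMem_tsupport fun h' => hx (h.support h')

theorem fderiv_zero_of_notMem (h : IsTestFunction Ω φ) {x : Space n} (hx : x ∉ Ω) :
    fderiv ℝ φ x = 0 :=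
  image_eq_zero_of_notMem_tsupport fun h' => hx (h.support (tsupport_fderiv_subset ℝ h'))

theorem mono {Ω' : Set (Space n)} (h : IsTestFunction Ω φ) (hΩ : Ω ⊆ Ω') :
    IsTestFunction Ω' φ :=
  ⟨h.smooth, h.compact, h.support.trans hΩ⟩

theorem mul_smooth (h : IsTestFunction Ω φ) {ψ : Space n → ℝ} (hψ : ContDiff ℝ ∞ ψ) :
    IsTestFunction Ω (fun x => φ x * ψ x) :=
  ⟨h.smooth.mul hψ, h.compact.mul_right, (tsupport_mul_subset_left).trans h.support⟩

theorem memLp (h : IsTestFunction Ω φ) {μ : Measure (Space n)} [IsFiniteMeasureOnCompacts μ] :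
    MemLp φ 2 μ :=
  h.smooth.continuous.memLp_of_hasCompactSupport h.compact

theorem continuous_fderiv_apply (h : IsTestFunction Ω φ) (v : Space n) :
    Continuous fun x => fderiv ℝ φ x v :=
  (h.smooth.continuous_fderiv (by simp)).clm_apply continuous_const

theorem memLp_fderiv (h : IsTestFunction Ω φ) (v : Space n) {μ : Measure (Space n)}
    [IsFiniteMeasureOnCompacts μ] : MemLp (fun x => fderiv ℝ φ x v) 2 μ :=
  (h.continuous_fderiv_apply v).memLp_of_hasCompactSupport (h.compact.fderiv_apply ℝ v)

end IsTestFunction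

namespace HasWeakGradient

theorem congr (h : HasWeakGradient Ω u G) (hu : u =ᵐ[volume.restrict Ω] u')
    (hG : G =ᵐ[volume.restrict Ω] G') : HasWeakGradient Ω u' G' := by
  refine ⟨h.memLp.ae_eq hu, h.memLp_grad.ae_eq hG, fun φ hφ v => ?_⟩
  have h1 : ∫ x in Ω, u' x * fderiv ℝ φ x v = ∫ x in Ω, u x * fderiv ℝ φ x v :=
    integral_congr_ae (by filter_upwards [hu] with x hx; rw [hx])
  have h2 : ∫ x in Ω, inner ℝ (G' x) v * φ x = ∫ x in Ω, inner ℝ (G x) v * φ x :=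
    integral_congr_ae (by filter_upwards [hG] with x hx; rw [hx])
  rw [h1, h2, h.weak φ hφ v]

theorem mono (h : HasWeakGradient Ω u G) {Ω' : Set (Space n)} (hΩ' : Ω' ⊆ Ω)
    (hm : MeasurableSet Ω) : HasWeakGradient Ω' u G := by
  refine ⟨h.memLp.mono_measure (Measure.restrict_mono_set _ hΩ'),
    h.memLp_grad.mono_measure (Measure.restrict_mono_set _ hΩ'), fun φ hφ v => ?_⟩
  have h1 : ∫ x in Ω, u x * fderiv ℝ φ x v = ∫ x in Ω', u x * fderiv ℝ φ x v :=
    setIntegral_eq_of_subset_of_forall_sdiff_eq_zero hm hΩ'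
      fun x hx => by simp [hφ.fderiv_zero_of_notMem hx.2]
  have h2 : ∫ x in Ω, inner ℝ (G x) v * φ x = ∫ x in Ω', inner ℝ (G x) v * φ x :=
    setIntegral_eq_of_subset_of_forall_sdiff_eq_zero hm hΩ'
      fun x hx => by simp [hφ.zero_of_notMem hx.2]
  rw [← h1, ← h2, h.weak φ (hφ.mono hΩ') v]

theorem integrable_mul_fderiv (h : HasWeakGradient Ω u G) {φ : Space n → ℝ}
    (hφ : IsTestFunction Ω φ) (v : Space n) :
    IntegrableOn (fun x => u x * fderiv ℝ φ x v) Ω :=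
  h.memLp.integrable_mul (hφ.memLp_fderiv v)

theorem integrable_inner_mul (h : HasWeakGradient Ω u G) {φ : Space n → ℝ}
    (hφ : IsTestFunction Ω φ) (v : Space n) :
    IntegrableOn (fun x => inner ℝ (G x) v * φ x) Ω :=
  (h.memLp_grad.inner_const v).integrable_mul hφ.memLp

theorem sub (h : HasWeakGradient Ω u G) (h' : HasWeakGradient Ω u' G') :
    HasWeakGradient Ω (fun x => u x - u' x) (fun x => G x - G' x) := by
  refine ⟨h.memLp.sub h'.memLp, h.memLp_grad.sub h'.memLp_grad, fun φ hφ v => ?_⟩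
  simp only [sub_mul, inner_sub_left]
  rw [integral_sub (h.integrable_mul_fderiv hφ v) (h'.integrable_mul_fderiv hφ v),
    integral_sub (h.integrable_inner_mul hφ v) (h'.integrable_inner_mul hφ v),
    h.weak φ hφ v, h'.weak φ hφ v]
  ring

theorem add (h : HasWeakGradient Ω u G) (h' : HasWeakGradient Ω u' G') :
    HasWeakGradient Ω (fun x => u x + u' x) (fun x => G x + G' x) := by
  refine ⟨h.memLp.add h'.memLp, h.memLp_grad.add h'.memLp_grad, fun φ hφ v => ?_⟩
  simp only [add_mul, inner_add_left]
  rw [integral_add (h.integrable_mul_fderiv hφ v) (h'.integrable_mul_fderiv hφ v),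
    integral_add (h.integrable_inner_mul hφ v) (h'.integrable_inner_mul hφ v),
    h.weak φ hφ v, h'.weak φ hφ v]
  ring

theorem ae_unique (hΩ : IsOpen Ω) (h : HasWeakGradient Ω u G) (h' : HasWeakGradient Ω u G') :
    G =ᵐ[volume.restrict Ω] G' := by
  have hd := h.sub h'
  have hloc : LocallyIntegrableOn (fun x => G x - G' x) Ω := by
    have : LocallyIntegrable (fun x => G x - G' x) (volume.restrict Ω) :=
      hd.memLp_grad.locallyIntegrable (by norm_num)
    exact (locallyIntegrableOn_of_locallyIntegrable_restrict this)
  have := hΩ.ae_eq_zero_of_integral_contDiff_smul_eq_zero (μ := volume) hloc ?_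
  · rw [EventuallyEq, ae_restrict_iff' hΩ.measurableSet]
    filter_upwards [this] with x hx hxΩ
    exact sub_eq_zero.1 (hx hxΩ)
  · intro φ hφ1 hφ2 hφ3
    have hφ : IsTestFunction Ω φ := ⟨hφ1, hφ2, hφ3⟩
    have h0 : ∫ x, φ x • (G x - G' x) = ∫ x in Ω, φ x • (G x - G' x) := by
      refine (setIntegral_eq_integral_of_forall_compl_eq_zero fun x hx => ?_).symm
      simp [hφ.zero_of_notMem hx]
    rw [h0]
    have hint : IntegrableOn (fun x => φ x • (G x - G' x)) Ω :=
      memLp_one_iff_integrable.1 (hd.memLp_grad.smul hφ.memLp)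
    refine ext_inner_left ℝ fun v => ?_
    rw [← integral_inner hint]
    have := hd.weak φ hφ v
    simp only [sub_self, zero_mul, integral_zero] at this
    simp only [inner_zero_right, inner_smul_right, mul_comm (φ _)]
    simp only [real_inner_comm v] at this ⊢
    linarith

theorem memH1 (h : HasWeakGradient Ω u G) : MemH1 Ω u := ⟨G, h⟩

end HasWeakGradient

theorem MemH1.hasWeakGradient (h : MemH1 Ω u) : HasWeakGradient Ω u (weakGradient Ω u) := by
  rw [weakGradient, dif_pos h]
  exact h.choose_spec

/-- Makes the choice in `weakGradient` harmless: in energies and Green formulas it may be replaced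
by any weak gradient at hand, for instance one inherited from a larger ball. -/
theorem HasWeakGradient.weakGradient_ae_eq (h : HasWeakGradient Ω u G) (hΩ : IsOpen Ω) :
    weakGradient Ω u =ᵐ[volume.restrict Ω] G :=
  HasWeakGradient.ae_unique hΩ h.memH1.hasWeakGradient h

theorem hasWeakGradient_of_contDiff {f : Space n → ℝ} (hf : ContDiff ℝ ∞ f)
    (hΩ : MeasurableSet Ω) (hb : Bornology.IsBounded Ω) : HasWeakGradient Ω f (gradient f) := by
  have hmem : ∀ {F : Type} [NormedAddCommGroup F] (g : Space n → F), Continuous g →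
      MemLp g 2 (volume.restrict Ω) := by
    intro F _ g hg
    have hK : IsCompact (closure Ω) := hb.isCompact_closure
    obtain ⟨C, hC⟩ := hK.exists_bound_of_continuousOn hg.continuousOn
    have : IsFiniteMeasure (volume.restrict Ω) := ⟨by
      simpa using hb.measure_lt_top⟩
    refine MemLp.of_bound ?_ C ?_
    · exact (hg.aestronglyMeasurable)
    · filter_upwards [ae_restrict_mem hΩ] with x hx using hC x (subset_closure hx)
  refine ⟨hmem f hf.continuous, hmem _ (continuous_gradient hf), fun φ hφ v => ?_⟩
  simp only [inner_gradient_eq_fderiv]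
  rw [setIntegral_eq_integral_of_forall_compl_eq_zero
      fun x hx => by simp [hφ.fderiv_zero_of_notMem hx],
    setIntegral_eq_integral_of_forall_compl_eq_zero
      fun x hx => by simp [hφ.zero_of_notMem hx]]
  have hc : Continuous fun x => fderiv ℝ f x v :=
    (hf.continuous_fderiv (by simp)).clm_apply continuous_const
  refine integral_mul_fderiv_eq_neg_fderiv_mul_of_integrable ?_ ?_ ?_
    (fun x _ => hf.differentiable (by simp) x) (fun x _ => hφ.smooth.differentiable (by simp) x)
  · exact (hc.mul hφ.smooth.continuous).integrable_of_hasCompactSupport hφ.compact.mul_left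
  · exact (hf.continuous.mul (hφ.continuous_fderiv_apply v)).integrable_of_hasCompactSupport
      (hφ.compact.fderiv_apply ℝ v).mul_left
  · exact (hf.continuous.mul hφ.smooth.continuous).integrable_of_hasCompactSupport
      hφ.compact.mul_left

/-- The weak gradient is a closed operator: both sides of its definition are L² pairings with a
fixed test function, so they pass to the limit. This supplies the gradients of the competitors built
below. -/
theorem hasWeakGradient_of_tendsto {f : ℕ → Space n → ℝ} {g : ℕ → Space n → Space n}
    (h : ∀ k, HasWeakGradient Ω (f k) (g k)) (hu : MemLp u 2 (volume.restrict Ω))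
    (hG : MemLp G 2 (volume.restrict Ω))
    (hf : Tendsto (fun k => eLpNorm (f k - u) 2 (volume.restrict Ω)) atTop (𝓝 0))
    (hg : Tendsto (fun k => eLpNorm (g k - G) 2 (volume.restrict Ω)) atTop (𝓝 0)) :
    HasWeakGradient Ω u G := by
  refine ⟨hu, hG, fun φ hφ v => ?_⟩
  have hconst : ∀ {F : Type} [NormedAddCommGroup F] (ψ : Space n → F),
      Tendsto (fun _ : ℕ => eLpNorm (ψ - ψ) 2 (volume.restrict Ω)) atTop (𝓝 0) := by
    intro F _ ψ; simp
  have h1 := tendsto_integral_mul_of_eLpNorm (fun k => (h k).memLp) hu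
    (fun _ => hφ.memLp_fderiv v) (hφ.memLp_fderiv v) hf (hconst _)
  have h2 : Tendsto (fun k => ∫ x in Ω, inner ℝ (g k x) v * φ x) atTop
      (𝓝 (∫ x in Ω, inner ℝ (G x) v * φ x)) := by
    refine tendsto_integral_mul_of_eLpNorm (fun k => (h k).memLp_grad.inner_const v)
      (hG.inner_const v) (fun _ => hφ.memLp) hφ.memLp ?_ (hconst _)
    refine tendsto_eLpNorm_of_le_mul (C := ‖v‖) (fun k => .of_forall fun x => ?_) hg
    simp only [Pi.sub_apply, ← inner_sub_left]
    exact (norm_inner_le_norm _ _).trans_eq (mul_comm _ _)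
  have h3 : ∀ k, ∫ x in Ω, f k x * fderiv ℝ φ x v = -∫ x in Ω, inner ℝ (g k x) v * φ x :=
    fun k => (h k).weak φ hφ v
  simp only [h3] at h1
  exact tendsto_nhds_unique h1 h2.neg

/-- The weak form of `div (x u) = n u + x · ∇u`. -/
theorem HasWeakGradient.weak_radial (h : HasWeakGradient Ω u G) {φ : Space n → ℝ}
    (hφ : IsTestFunction Ω φ) :
    ∫ x in Ω, u x * (n * φ x + fderiv ℝ φ x x) = -∫ x in Ω, inner ℝ (G x) x * φ x := by
  set b := EuclideanSpace.basisFun (Fin n) ℝ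
  have hsm : ∀ i, ContDiff ℝ ∞ fun x : Space n => (inner ℝ (b i) x : ℝ) :=
    fun i => contDiff_const.inner ℝ contDiff_id
  have ht : ∀ i, IsTestFunction Ω fun x => φ x * inner ℝ (b i) x := fun i =>
    hφ.mul_smooth (hsm i)
  have hd : ∀ i x, fderiv ℝ (fun x => φ x * inner ℝ (b i) x) x (b i)
      = φ x + fderiv ℝ φ x (inner ℝ (b i) x • b i) := by
    intro i x
    rw [fderiv_fun_mul (hφ.smooth.differentiable (by simp) x)
      ((hsm i).differentiable (by simp) x)]
    have : fderiv ℝ (fun x : Space n => (inner ℝ (b i) x : ℝ)) x = innerSL ℝ (b i) :=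
      (innerSL ℝ (b i)).fderiv
    rw [this]
    simp
  have h1 : ∀ x, u x * (n * φ x + fderiv ℝ φ x x)
      = ∑ i, u x * fderiv ℝ (fun x => φ x * inner ℝ (b i) x) x (b i) := by
    intro x
    simp only [hd, ← Finset.mul_sum, Finset.sum_add_distrib, ← map_sum, b.sum_repr']
    simp
  have h2 : ∀ x, inner ℝ (G x) x * φ x
      = ∑ i, inner ℝ (G x) (b i) * (φ x * inner ℝ (b i) x) := by
    intro x
    rw [← b.sum_inner_mul_inner, Finset.sum_mul]
    exact Finset.sum_congr rfl fun i _ => by ring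
  simp only [h1, h2]
  rw [integral_finsetSum _ fun i _ => h.integrable_mul_fderiv (ht i) (b i),
    integral_finsetSum _ fun i _ => h.integrable_inner_mul (ht i) (b i), ← Finset.sum_neg_distrib]
  exact Finset.sum_congr rfl fun i _ => h.weak _ (ht i) (b i)

end AltPhillips

namespace AltPhillips

variable {n : ℕ}

/-! ### Approximation by smooth functions -/

section Mollify

variable {F : Type*} [NormedAddCommGroup F]

theorem eLpNorm_comp_smul_sub {f : Space n → F} (hf : StronglyMeasurable f) {t : ℝ} (ht : t ≠ 0)
    (z : Space n) :
    eLpNorm (fun x => f (t • x - z)) 2 volume =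
      (ENNReal.ofReal |(t ^ n)⁻¹|) ^ (2⁻¹ : ℝ) * eLpNorm f 2 volume := by
  have h1 : eLpNorm (fun x => f (x - z)) 2 volume = eLpNorm f 2 volume :=
    eLpNorm_comp_measurePreserving hf.aestronglyMeasurable (measurePreserving_sub_right volume z)
  have hm : StronglyMeasurable fun x => f (x - z) :=
    hf.comp_measurable (measurable_id.sub_const z)
  have h2 := eLpNorm_map_measure (μ := (volume : Measure (Space n))) (p := 2)
    (f := fun x : Space n => t • x) hm.aestronglyMeasurable (by fun_prop)
  rw [Measure.map_addHaar_smul _ ht, eLpNorm_smul_measure_of_ne_top (by norm_num), h1] at h2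
  simp only [finrank_euclideanSpace, Fintype.card_fin] at h2
  rw [← Function.comp_def (fun x => f (x - z)) (fun x => t • x), ← h2]
  simp

/-- Continuity of dilations and translations in L², jointly in both parameters because the
approximation on a ball shrinks and mollifies simultaneously. Dominated convergence handles
compactly supported continuous functions, and density handles the rest. -/
theorem tendsto_eLpNorm_comp_smul_sub [NormedSpace ℝ F] {f : Space n → F} (hf : MemLp f 2 volume)
    (hfm : StronglyMeasurable f) :
    Tendsto (fun p : ℝ × Space n => eLpNorm (fun x => f (p.1 • x - p.2) - f x) 2 volume)
      (𝓝 (1, 0)) (𝓝 0) := by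
  -- continuous compactly supported functions
  have hcont : ∀ g : Space n → F, HasCompactSupport g → Continuous g →
      Tendsto (fun p : ℝ × Space n => eLpNorm (fun x => g (p.1 • x - p.2) - g x) 2 volume)
        (𝓝 (1, 0)) (𝓝 0) := by
    intro g hg hgc
    obtain ⟨C, hC⟩ := hg.exists_bound_of_continuous hgc
    obtain ⟨ρ, hρ⟩ := hg.isBounded.subset_closedBall (0 : Space n)
    have hz : ∀ x, ρ < ‖x‖ → g x = 0 := fun x hx =>
      image_eq_zero_of_notMem_tsupport fun h => by
        have := hρ h
        simp at this; linarith
    have key : Tendsto (fun p : ℝ × Space n => ∫⁻ x, ‖g (p.1 • x - p.2) - g x‖ₑ ^ 2)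
        (𝓝 (1, 0)) (𝓝 0) := by
      have h0 : ∫⁻ x : Space n, ‖g ((1 : ℝ) • x - 0) - g x‖ₑ ^ 2 = 0 := by simp
      rw [← h0]
      -- If t > 1/2 and |z| < 1, then |x| > 2(|ρ|+1) forces |t x - z| > |ρ|, so both terms vanish
      -- outside this one ball.
      refine tendsto_lintegral_filter_of_dominated_convergence
        ((Metric.closedBall 0 (2 * (|ρ| + 1))).indicator fun _ => ENNReal.ofReal (C + C) ^ 2)
        ?_ ?_ ?_ ?_
      · refine .of_forall fun p => ?_
        have : Continuous fun x : Space n => g (p.1 • x - p.2) - g x := by fun_prop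
        exact this.enorm.measurable.pow_const 2
      · have h1 : ∀ᶠ p : ℝ × Space n in 𝓝 (1, 0), 1 / 2 < p.1 ∧ ‖p.2‖ < 1 :=
          ((continuous_fst.tendsto _).eventually (lt_mem_nhds (by norm_num))).and
            ((continuous_snd.norm.tendsto _).eventually (gt_mem_nhds (by simp)))
        filter_upwards [h1] with p hp
        refine .of_forall fun x => ?_
        by_cases hx : x ∈ Metric.closedBall (0 : Space n) (2 * (|ρ| + 1))
        · rw [indicator_of_mem hx]
          gcongr
          rw [← ofReal_norm]
          exact ENNReal.ofReal_le_ofReal ((norm_sub_le _ _).trans (add_le_add (hC _) (hC _)))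
        · have hx' : 2 * (|ρ| + 1) < ‖x‖ := by simpa using hx
          have e1 : g x = 0 := hz x (by linarith [le_abs_self ρ, abs_nonneg ρ])
          have e2 : g (p.1 • x - p.2) = 0 := by
            apply hz
            have e3 : ‖p.1 • x‖ - ‖p.2‖ ≤ ‖p.1 • x - p.2‖ := norm_sub_norm_le _ _
            rw [norm_smul, Real.norm_eq_abs, abs_of_pos (by linarith)] at e3
            nlinarith [le_abs_self ρ, abs_nonneg ρ, norm_nonneg x]
          simp [e1, e2]
      · rw [lintegral_indicator Metric.isClosed_closedBall.measurableSet, lintegral_const]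
        simp only [Measure.restrict_apply_univ]
        exact ENNReal.mul_ne_top (by simp) (measure_closedBall_lt_top).ne
      · refine .of_forall fun x => ?_
        have : Continuous fun p : ℝ × Space n => ‖g (p.1 • x - p.2) - g x‖ₑ ^ 2 := by fun_prop
        exact this.tendsto (1, 0)
    have h2 := (ENNReal.continuous_rpow_const (y := (2⁻¹ : ℝ))).tendsto 0 |>.comp key
    have h3 : ∀ a : ℝ≥0∞, (a ^ 2) ^ (2⁻¹ : ℝ) = a := by
      intro a
      rw [← ENNReal.rpow_natCast, ← ENNReal.rpow_mul]; norm_num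
    simpa [Function.comp_def, ← eLpNorm_two_sq, h3] using h2
  rw [ENNReal.tendsto_nhds_zero]
  intro ε hε
  -- The coefficient 2 bounds the root of the Jacobian of x ↦ t x for t near 1.
  obtain ⟨ε', hε', hε'ε⟩ : ∃ ε' : ℝ≥0∞, ε' ≠ 0 ∧ 2 * ε' + (ε' + ε') ≤ ε := by
    refine ⟨ε / 4, by simpa using hε.ne', ?_⟩
    have : 2 * (ε / 4) + (ε / 4 + ε / 4) = 4 * (ε / 4) := by ring
    rw [this, ENNReal.mul_div_cancel (by norm_num) (by norm_num)]
  obtain ⟨g, hg1, hg2, hg3, hg4⟩ := hf.exists_hasCompactSupport_eLpNorm_sub_le (by norm_num) hε'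
  have h1 := (ENNReal.tendsto_nhds_zero.1 (hcont g hg1 hg3)) ε' (pos_iff_ne_zero.2 hε')
  have h2 : ∀ᶠ p : ℝ × Space n in 𝓝 (1, 0),
      (ENNReal.ofReal |(p.1 ^ n)⁻¹|) ^ (2⁻¹ : ℝ) < 2 := by
    have hc : ContinuousAt (fun p : ℝ × Space n => (ENNReal.ofReal |(p.1 ^ n)⁻¹|) ^ (2⁻¹ : ℝ))
        (1, 0) := by
      refine (ENNReal.continuous_rpow_const.continuousAt).comp
        (ENNReal.continuous_ofReal.continuousAt.comp ?_)
      exact ((continuousAt_fst.pow n).inv₀ (by simp)).abs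
    refine hc.eventually (gt_mem_nhds ?_)
    simp
  have h3 : ∀ᶠ p : ℝ × Space n in 𝓝 (1, 0), p.1 ≠ 0 :=
    continuousAt_fst.eventually_ne (by simp)
  filter_upwards [h1, h2, h3] with p hp1 hp2 hp3
  have hgm : StronglyMeasurable g := hg3.stronglyMeasurable
  have hsplit : (fun x => f (p.1 • x - p.2) - f x) =
      (fun x => (f - g) (p.1 • x - p.2)) + ((fun x => g (p.1 • x - p.2) - g x) + (g - f)) := by
    ext x; simp
  have hmT : Measurable fun x : Space n => p.1 • x - p.2 := by fun_prop
  rw [hsplit]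
  refine (eLpNorm_add_le ?_ ?_ (by norm_num)).trans (le_trans (add_le_add ?_
    ((eLpNorm_add_le ?_ ?_ (by norm_num)).trans (add_le_add hp1 ?_))) hε'ε)
  · exact ((hfm.sub hgm).comp_measurable hmT).aestronglyMeasurable
  · exact (((hgm.comp_measurable hmT).sub hgm).add (hgm.sub hfm)).aestronglyMeasurable
  · rw [eLpNorm_comp_smul_sub (hfm.sub hgm) hp3]
    gcongr
  · exact ((hgm.comp_measurable hmT).sub hgm).aestronglyMeasurable
  · exact (hgm.sub hfm).aestronglyMeasurable
  · rw [eLpNorm_sub_comm]; exact hg2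

open ContinuousLinearMap Convolution in
-- The difference is the mean of f(t x - z) - f(x) over z with respect to the probability measure of
-- density φ. Jensen's inequality and Tonelli's theorem bound its L² norm by the worst single shift.
theorem eLpNorm_convolution_sub_le [NormedSpace ℝ F] [CompleteSpace F]
    (φ : ContDiffBump (0 : Space n)) {f : Space n → F}
    (hf : MemLp f 2 volume) (hfm : StronglyMeasurable f) (t : ℝ) {ε : ℝ≥0∞}
    (h : ∀ z ∈ Metric.ball (0 : Space n) φ.rOut,
      eLpNorm (fun x => f (t • x - z) - f x) 2 volume ≤ ε) :
    eLpNorm (fun x => (φ.normed volume ⋆[lsmul ℝ ℝ] f) (t • x) - f x) 2 volume ≤ ε := by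
  set ψ := φ.normed (volume : Measure (Space n))
  have hψ0 : ∀ z, 0 ≤ ψ z := fun z => φ.nonneg_normed z
  have hψm : Measurable ψ := φ.continuous_normed.measurable
  set ν : Measure (Space n) := volume.withDensity fun z => ENNReal.ofReal (ψ z)
  have hν : IsProbabilityMeasure ν := ⟨by
    rw [withDensity_apply _ MeasurableSet.univ, Measure.restrict_univ,
      ← ofReal_integral_eq_lintegral_ofReal φ.integrable_normed (.of_forall hψ0),
      φ.integral_normed, ENNReal.ofReal_one]⟩
  have hconv : ∀ x, (ψ ⋆[lsmul ℝ ℝ] f) (t • x) - f x = ∫ z, (f (t • x - z) - f x) ∂ν := by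
    intro x
    have hloc : LocallyIntegrable (fun z => f (t • x - z)) volume := by
      have : MemLp (fun z => f (t • x - z)) 2 volume :=
        hf.comp_measurePreserving (Measure.measurePreserving_sub_left volume (t • x))
      exact this.locallyIntegrable (by norm_num)
    have hi : Integrable (fun z => ψ z • f (t • x - z)) volume :=
      hloc.integrable_smul_left_of_hasCompactSupport φ.continuous_normed φ.hasCompactSupport_normed
    have hi2 : Integrable (fun z => ψ z • f x) volume := φ.integrable_normed.smul_const _
    have e : ∀ g : Space n → F, ∫ z, g z ∂ν = ∫ z, ψ z • g z := by
      intro g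
      rw [integral_withDensity_eq_integral_toReal_smul (by fun_prop) (.of_forall fun _ => by simp)]
      simp [ENNReal.toReal_ofReal (hψ0 _)]
    rw [e]
    simp only [smul_sub]
    rw [integral_sub hi hi2, integral_smul_const, φ.integral_normed, one_smul]
    rfl
  have hsq : eLpNorm (fun x => (ψ ⋆[lsmul ℝ ℝ] f) (t • x) - f x) 2 volume ^ 2 ≤ ε ^ 2 := by
    rw [eLpNorm_two_sq]
    simp only [hconv]
    have hjm : StronglyMeasurable fun q : Space n × Space n => f (t • q.1 - q.2) - f q.1 := by
      refine (hfm.comp_measurable ?_).sub (hfm.comp_measurable measurable_fst)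
      fun_prop
    have hJ : ∀ x, ‖∫ z, (f (t • x - z) - f x) ∂ν‖ₑ ^ 2 ≤ ∫⁻ z, ‖f (t • x - z) - f x‖ₑ ^ 2 ∂ν := by
      intro x
      rw [← eLpNorm_two_sq]
      gcongr
      refine (enorm_integral_le_lintegral_enorm _).trans ?_
      rw [← eLpNorm_one_eq_lintegral_enorm]
      refine eLpNorm_le_eLpNorm_of_exponent_le (by norm_num) ?_
      exact (hjm.comp_measurable measurable_prodMk_left).aestronglyMeasurable
    calc ∫⁻ x, ‖∫ z, (f (t • x - z) - f x) ∂ν‖ₑ ^ 2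
        ≤ ∫⁻ x, ∫⁻ z, ‖f (t • x - z) - f x‖ₑ ^ 2 ∂ν := lintegral_mono hJ
      _ = ∫⁻ z, (∫⁻ x, ‖f (t • x - z) - f x‖ₑ ^ 2) ∂ν := by
          rw [lintegral_lintegral_swap]
          exact (hjm.enorm.pow_const 2).aemeasurable
      _ ≤ ∫⁻ z, ε ^ 2 ∂ν := by
          refine lintegral_mono_ae ?_
          have hνb : ∀ᵐ z ∂ν, z ∈ Metric.ball (0 : Space n) φ.rOut := by
            rw [ae_withDensity_iff (by fun_prop)]
            refine .of_forall fun z hz => ?_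
            rw [← φ.support_normed_eq (μ := volume)]
            intro h0
            apply hz
            change ENNReal.ofReal (φ.normed volume z) = 0
            rw [h0, ENNReal.ofReal_zero]
          filter_upwards [hνb] with z hz
          rw [← eLpNorm_two_sq]
          gcongr
          exact h z hz
      _ = ε ^ 2 := by simp
  exact (ENNReal.pow_le_pow_left_iff (by norm_num)).1 hsq

end Mollify

end AltPhillips

/-! ### Mollification of weakly differentiable functions on a ball. -/

namespace AltPhillips

variable {n : ℕ} {u : Space n → ℝ} {G : Space n → Space n}

open ContinuousLinearMap Convolution in
-- Differentiating under the convolution puts the derivative on the bump z ↦ φ(y - z). The margin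
-- ‖y‖ + rOut < R makes this an admissible test function in the ball, so the weak formulation moves
-- the derivative onto u. Near the boundary the identity can fail, because u is extended by zero.
theorem HasWeakGradient.gradient_convolution {R : ℝ}
    (h : HasWeakGradient (Metric.ball 0 R) u G) (hu : MemLp u 2 volume) (hG : MemLp G 2 volume)
    (hu0 : ∀ x ∉ Metric.ball (0 : Space n) R, u x = 0)
    (hG0 : ∀ x ∉ Metric.ball (0 : Space n) R, G x = 0)
    (φ : ContDiffBump (0 : Space n)) {y : Space n} (hy : ‖y‖ + φ.rOut < R) :
    gradient (φ.normed volume ⋆[lsmul ℝ ℝ] u) y = (φ.normed volume ⋆[lsmul ℝ ℝ] G) y := by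
  set ψ := φ.normed (volume : Measure (Space n))
  have hψ : ContDiff ℝ ∞ ψ := φ.contDiff_normed
  have hψc : HasCompactSupport ψ := φ.hasCompactSupport_normed
  have hul : LocallyIntegrable u volume := hu.locallyIntegrable (by norm_num)
  have hGl : LocallyIntegrable G volume := hG.locallyIntegrable (by norm_num)
  have htest : IsTestFunction (Metric.ball 0 R) fun z => ψ (y - z) := by
    have hsub : tsupport (fun z => ψ (y - z)) ⊆ Metric.closedBall y φ.rOut := by
      refine closure_minimal (fun z hz => ?_) Metric.isClosed_closedBall
      have : y - z ∈ tsupport ψ := subset_tsupport _ hz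
      rw [φ.tsupport_normed_eq] at this
      simpa [dist_eq_norm, norm_sub_rev] using this
    refine ⟨hψ.comp (contDiff_const.sub contDiff_id),
      (isCompact_closedBall y φ.rOut).of_isClosed_subset (isClosed_tsupport _) hsub,
      hsub.trans fun z hz => ?_⟩
    simp only [Metric.mem_closedBall, dist_eq_norm, mem_ball_zero_iff] at hz ⊢
    have : ‖z‖ ≤ ‖z - y‖ + ‖y‖ := by simpa using norm_add_le (z - y) y
    linarith
  have hdt : ∀ z v, fderiv ℝ (fun z => ψ (y - z)) z v = -fderiv ℝ ψ (y - z) v := by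
    intro z v
    have h1 : HasFDerivAt ψ (fderiv ℝ ψ (y - z)) (y - z) :=
      (hψ.differentiable (by simp) _).hasFDerivAt
    have h2 : HasFDerivAt (fun z : Space n => y - z) (-ContinuousLinearMap.id ℝ (Space n)) z :=
      (hasFDerivAt_id z).const_sub y
    have h3 : HasFDerivAt (fun z => ψ (y - z)) _ z := h1.comp z h2
    rw [h3.fderiv]
    simp
  refine ext_inner_right ℝ fun v => ?_
  rw [inner_gradient_eq_fderiv]
  have hd := hψc.hasFDerivAt_convolution_right (lsmul ℝ ℝ).flip hul (hψ.of_le (by simp)) y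
  rw [convolution_flip] at hd
  rw [hd.fderiv, convolution_precompR_apply _ hul (hψc.fderiv ℝ)
    (hψ.continuous_fderiv (by simp)), convolution_def, convolution_lsmul_swap]
  simp only [flip_apply, lsmul_apply, smul_eq_mul]
  have hi : Integrable (fun z => ψ (y - z) • G z) volume :=
    hGl.integrable_smul_left_of_hasCompactSupport htest.smooth.continuous htest.compact
  rw [real_inner_comm, ← integral_inner hi]
  have hw := h.weak _ htest v
  rw [setIntegral_eq_integral_of_forall_compl_eq_zero
      fun x hx => by rw [hu0 x hx, zero_mul],
    setIntegral_eq_integral_of_forall_compl_eq_zero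
      fun x hx => by rw [hG0 x hx, inner_zero_left, zero_mul]] at hw
  simp only [hdt, mul_neg, integral_neg, neg_inj] at hw
  simp only [mul_comm _ (u _), hw, inner_smul_right, real_inner_comm v, mul_comm (ψ _)]

set_option maxHeartbeats 1000000 in
open ContinuousLinearMap Convolution in
/-- Functions in `H¹` of a ball are limits of functions that are smooth on the whole space. -/
theorem HasWeakGradient.exists_smooth_approx {R : ℝ} (hR : 0 < R)
    (h : HasWeakGradient (Metric.ball 0 R) u G) :
    ∃ f : ℕ → Space n → ℝ, (∀ k, ContDiff ℝ ∞ (f k)) ∧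
      Tendsto (fun k => eLpNorm (f k - u) 2 (volume.restrict (Metric.ball 0 R))) atTop (𝓝 0) ∧
      Tendsto (fun k => eLpNorm (gradient (f k) - G) 2 (volume.restrict (Metric.ball 0 R)))
        atTop (𝓝 0) := by
  set B := Metric.ball (0 : Space n) R
  have hB : MeasurableSet B := measurableSet_ball
  -- measurable representatives that vanish outside of the ball
  have key : ∀ {F : Type} [NormedAddCommGroup F] {f : Space n → F},
      MemLp f 2 (volume.restrict B) → ∃ g : Space n → F, MemLp g 2 volume ∧
        StronglyMeasurable g ∧ f =ᵐ[volume.restrict B] g ∧ ∀ x ∉ B, g x = 0 := by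
    intro F _ f hf
    refine ⟨B.indicator (hf.1.mk f), ?_, hf.1.stronglyMeasurable_mk.indicator hB, ?_,
      fun x hx => indicator_of_notMem hx _⟩
    · rw [memLp_indicator_iff_restrict hB]
      exact hf.ae_eq hf.1.ae_eq_mk
    · filter_upwards [hf.1.ae_eq_mk, ae_restrict_mem hB] with x hx hxB
      rw [indicator_of_mem hxB, hx]
  obtain ⟨u', hu', hu'm, huu', hu'0⟩ := key h.memLp
  obtain ⟨G', hG', hG'm, hGG', hG'0⟩ := key h.memLp_grad
  have h' := h.congr huu' hGG'
  -- The denominator k + 2 gives δ < 1 already at k = 0, so the dilation factor 1 - δ is positive.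
  let δ : ℕ → ℝ := fun k => 1 / ((k : ℝ) + 1 + 1)
  have hδ0 : ∀ k, 0 < δ k := fun k => by positivity
  have hδ1 : ∀ k, δ k < 1 := fun k => by
    simp only [δ]
    rw [div_lt_one (by positivity)]
    have : (0 : ℝ) ≤ k := by positivity
    linarith
  have hδ : Tendsto δ atTop (𝓝 0) :=
    (tendsto_one_div_add_atTop_nhds_zero_nat (𝕜 := ℝ)).comp (tendsto_add_atTop_nat 1) |>.congr
      fun k => by simp [δ]
  -- For |x| < R the point (1 - δ)x has distance more than Rδ from the boundary, which exceeds the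
  -- mollification radius Rδ/2. Shrinking first thus makes the approximations valid up to the
  -- boundary.
  let φ : ℕ → ContDiffBump (0 : Space n) := fun k =>
    ⟨R * δ k / 4, R * δ k / 2, by have := hδ0 k; positivity,
      by have := mul_pos hR (hδ0 k); linarith⟩
  let t : ℕ → ℝ := fun k => 1 - δ k
  have ht : Tendsto t atTop (𝓝 1) := by simpa [t] using tendsto_const_nhds.sub hδ
  have htpos : ∀ k, 0 < t k := fun k => sub_pos.2 (hδ1 k)
  have conv : ∀ {F : Type} [NormedAddCommGroup F] [NormedSpace ℝ F] [CompleteSpace F]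
      {f : Space n → F}, MemLp f 2 volume → StronglyMeasurable f →
      Tendsto (fun k => eLpNorm (fun x =>
        ((φ k).normed volume ⋆[lsmul ℝ ℝ] f) (t k • x) - f x) 2 volume) atTop (𝓝 0) := by
    intro F _ _ _ f hf hfm
    rw [ENNReal.tendsto_nhds_zero]
    intro ε hε
    have h1 := (ENNReal.tendsto_nhds_zero.1 (tendsto_eLpNorm_comp_smul_sub hf hfm)) ε hε
    rw [Metric.eventually_nhds_iff] at h1
    obtain ⟨η, hη, hηs⟩ := h1
    have e1 := ht.eventually (Metric.ball_mem_nhds 1 hη)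
    have e2 : ∀ᶠ k in atTop, R * δ k / 2 < η := by
      have : Tendsto (fun k => R * δ k / 2) atTop (𝓝 0) := by
        simpa using (hδ.const_mul R).div_const 2
      exact this.eventually (gt_mem_nhds hη)
    filter_upwards [e1, e2] with k h1 h2
    refine eLpNorm_convolution_sub_le (φ k) hf hfm (t k) fun z hz => ?_
    refine hηs (y := (t k, z)) ?_
    rw [Prod.dist_eq]
    refine max_lt h1 (lt_trans ?_ h2)
    simpa using hz
  have hmono : ∀ {F : Type} [NormedAddCommGroup F] (f : Space n → F),
      eLpNorm f 2 (volume.restrict B) ≤ eLpNorm f 2 volume := fun f =>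
    eLpNorm_mono_measure _ Measure.restrict_le_self
  have hsm : ∀ k, ContDiff ℝ ∞ ((φ k).normed volume ⋆[lsmul ℝ ℝ] u') := fun k =>
    (φ k).hasCompactSupport_normed.contDiff_convolution_left _ (φ k).contDiff_normed
      (hu'.locallyIntegrable (by norm_num))
  have hGc : ∀ k, Continuous ((φ k).normed volume ⋆[lsmul ℝ ℝ] G') := fun k =>
    (φ k).hasCompactSupport_normed.continuous_convolution_left _ (φ k).continuous_normed
      (hG'.locallyIntegrable (by norm_num))
  obtain ⟨a, b, hsm, hGc, hab, ha, hb⟩ : ∃ (a : ℕ → Space n → ℝ) (b : ℕ → Space n → Space n),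
      (∀ k, ContDiff ℝ ∞ (a k)) ∧ (∀ k, Continuous (b k)) ∧
      (∀ k y, ‖y‖ + R * δ k / 2 < R → gradient (a k) y = b k y) ∧
      Tendsto (fun k => eLpNorm (fun x => a k (t k • x) - u' x) 2 volume) atTop (𝓝 0) ∧
      Tendsto (fun k => eLpNorm (fun x => b k (t k • x) - G' x) 2 volume) atTop (𝓝 0) :=
    ⟨_, _, hsm, hGc, fun k y hy => h'.gradient_convolution hu' hG' hu'0 hG'0 (φ k) hy,
      conv hu' hu'm, conv hG' hG'm⟩
  refine ⟨fun k x => a k (t k • x), fun k => (hsm k).comp (contDiff_const_smul _), ?_, ?_⟩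
  · refine tendsto_of_tendsto_of_tendsto_of_le_of_le tendsto_const_nhds ha
      (fun _ => zero_le) (fun k => ?_)
    refine le_trans (le_of_eq (eLpNorm_congr_ae ?_)) (hmono _)
    filter_upwards [huu'] with x hx
    simp [hx]
  · have hgrad : ∀ k, ∀ x ∈ B, gradient (fun x => a k (t k • x)) x = t k • b k (t k • x) := by
      intro k x hx
      have hx' : ‖x‖ < R := by simpa [B] using hx
      rw [← hab]
      · refine ext_inner_right ℝ fun v => ?_
        rw [inner_gradient_eq_fderiv, inner_smul_left, inner_gradient_eq_fderiv]
        have h1 : HasFDerivAt (a k) (fderiv ℝ (a k) (t k • x)) (t k • x) :=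
          ((hsm k).differentiable (by simp) _).hasFDerivAt
        have h2 : HasFDerivAt (fun x : Space n => t k • x)
            (t k • ContinuousLinearMap.id ℝ (Space n)) x := (hasFDerivAt_id x).const_smul (t k)
        have h3 : HasFDerivAt (fun x => a k (t k • x)) _ x := h1.comp x h2
        rw [h3.fderiv]
        simp
      · rw [norm_smul, Real.norm_eq_abs, abs_of_pos (htpos k)]
        have h1 := mul_pos (htpos k) (sub_pos.2 hx')
        have h2 := mul_pos hR (hδ0 k)
        simp only [t] at h1 ⊢
        nlinarith
    -- The chain rule produces a factor t, so the gradient error splits as t (b(t x) - G) + (t - 1)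
    -- G.
    have e1 : Tendsto (fun k => eLpNorm (fun x => t k • (b k (t k • x) - G' x)) 2
        (volume.restrict B)) atTop (𝓝 0) := by
      refine tendsto_eLpNorm_of_le_mul (C := 1) (fun k => .of_forall fun x => ?_)
        (tendsto_of_tendsto_of_tendsto_of_le_of_le tendsto_const_nhds hb
        (fun _ => zero_le) (fun k => hmono _))
      rw [norm_smul, Real.norm_eq_abs, abs_of_pos (htpos k)]
      gcongr
      linarith [hδ0 k, show t k = 1 - δ k from rfl]
    have e2 : Tendsto (fun k => eLpNorm (fun x => (t k - 1) • G' x) 2 (volume.restrict B))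
        atTop (𝓝 0) := by
      have e3 : ∀ k, eLpNorm (fun x => (t k - 1) • G' x) 2 (volume.restrict B)
          = ‖t k - 1‖ₑ * eLpNorm G' 2 (volume.restrict B) := fun k =>
        eLpNorm_const_smul (t k - 1) G' 2 _
      simp only [e3]
      have e4 : Tendsto (fun k => ‖t k - 1‖ₑ) atTop (𝓝 0) := by
        have := (ht.sub_const 1).enorm
        simpa using this
      simpa using ENNReal.Tendsto.mul_const e4 (Or.inr (hG'.restrict B).eLpNorm_ne_top)
    refine (tendsto_eLpNorm_add (fun k => ?_) (fun k => ?_) e1 e2).congr fun k => ?_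
    · have : Continuous fun x => b k (t k • x) := (hGc k).comp (continuous_const_smul _)
      exact ((this.stronglyMeasurable.sub hG'm).const_smul (t k)).aestronglyMeasurable
    · exact (hG'm.const_smul (t k - 1)).aestronglyMeasurable
    · refine eLpNorm_congr_ae ?_
      filter_upwards [hGG', ae_restrict_mem hB] with x hx hxB
      simp only [Pi.add_apply, Pi.sub_apply, hgrad k x hxB, hx, smul_sub, sub_smul, one_smul]
      abel

end AltPhillips

namespace AltPhillips

variable {n : ℕ}

/-! ### Radial test functions -/

/-- Smooth cutoffs of the interval `(A, B)`. -/
noncomputable def intervalCutoff (A B : ℝ) (k : ℕ) (t : ℝ) : ℝ :=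
  Real.smoothTransition ((k + 1) * (t - A) - 1) * Real.smoothTransition ((k + 1) * (B - t) - 1)

section Cutoff

variable {A B t : ℝ} {k : ℕ}

theorem contDiff_intervalCutoff : ContDiff ℝ ∞ (intervalCutoff A B k) := by
  unfold intervalCutoff
  refine (Real.smoothTransition.contDiff.comp ?_).mul (Real.smoothTransition.contDiff.comp ?_) <;>
    fun_prop

theorem intervalCutoff_nonneg : 0 ≤ intervalCutoff A B k t :=
  mul_nonneg (Real.smoothTransition.nonneg _) (Real.smoothTransition.nonneg _)

theorem intervalCutoff_le_one : intervalCutoff A B k t ≤ 1 :=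
  mul_le_one₀ (Real.smoothTransition.le_one _) (Real.smoothTransition.nonneg _)
    (Real.smoothTransition.le_one _)

/-- The shift by -1 in the cutoff makes it vanish a full 1/(k+1) inside the endpoint. Multiplying by
a function that is singular at the endpoint therefore leaves a smooth product. -/
theorem intervalCutoff_eq_zero_left (h : t ≤ A + 1 / (k + 1)) : intervalCutoff A B k t = 0 := by
  have hk : (0 : ℝ) < k + 1 := by positivity
  rw [intervalCutoff, Real.smoothTransition.zero_of_nonpos, zero_mul]
  have : (k + 1) * (t - A) ≤ (k + 1) * (1 / ((k : ℝ) + 1)) := by gcongr; linarith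
  rw [mul_one_div_cancel hk.ne'] at this
  linarith

theorem intervalCutoff_eq_zero_right (h : B - 1 / (k + 1) ≤ t) : intervalCutoff A B k t = 0 := by
  have hk : (0 : ℝ) < k + 1 := by positivity
  rw [intervalCutoff, Real.smoothTransition.zero_of_nonpos (x := (k + 1) * (B - t) - 1), mul_zero]
  have : (k + 1) * (B - t) ≤ (k + 1) * (1 / ((k : ℝ) + 1)) := by gcongr; linarith
  rw [mul_one_div_cancel hk.ne'] at this
  linarith

theorem intervalCutoff_eq_zero (h : t ∉ Ioo A B) : intervalCutoff A B k t = 0 := by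
  have hk : (0 : ℝ) < 1 / ((k : ℝ) + 1) := by positivity
  rcases le_or_gt t A with h1 | h1
  · exact intervalCutoff_eq_zero_left (by linarith)
  · exact intervalCutoff_eq_zero_right (by linarith [not_lt.1 fun h2 => h ⟨h1, h2⟩])

theorem tendsto_intervalCutoff (ht : t ∈ Ioo A B) :
    Tendsto (fun k => intervalCutoff A B k t) atTop (𝓝 1) := by
  have key : ∀ s : ℝ, 0 < s → ∀ᶠ k : ℕ in atTop, 2 ≤ ((k : ℝ) + 1) * s := by
    intro s hs
    have : Tendsto (fun k : ℕ => ((k : ℝ) + 1) * s) atTop atTop :=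
      (tendsto_atTop_add_const_right _ _ tendsto_natCast_atTop_atTop).atTop_mul_const hs
    exact this.eventually_ge_atTop 2
  refine tendsto_const_nhds.congr' ?_
  filter_upwards [key _ (sub_pos.2 ht.1), key _ (sub_pos.2 ht.2)] with k h1 h2
  rw [intervalCutoff, Real.smoothTransition.one_of_one_le (by linarith),
    Real.smoothTransition.one_of_one_le (by linarith), one_mul]

theorem contDiff_intervalCutoff_mul {χ : ℝ → ℝ} (hχ : ContDiffOn ℝ ∞ χ (Ioo A B)) :
    ContDiff ℝ ∞ fun t => intervalCutoff A B k t * χ t := by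
  have hk : (0 : ℝ) < 1 / ((k : ℝ) + 1) := by positivity
  rw [contDiff_iff_contDiffAt]
  intro t
  by_cases ht : t ∈ Ioo A B
  · exact contDiff_intervalCutoff.contDiffAt.mul (hχ.contDiffAt (isOpen_Ioo.mem_nhds ht))
  · refine (contDiffAt_const (c := (0 : ℝ))).congr_of_eventuallyEq ?_
    rcases le_or_gt t A with h1 | h1
    · filter_upwards [gt_mem_nhds (show t < A + 1 / (k + 1) by linarith)] with s hs
      rw [intervalCutoff_eq_zero_left hs.le, zero_mul]
    · have h2 : B ≤ t := not_lt.1 fun h2 => ht ⟨h1, h2⟩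
      filter_upwards [lt_mem_nhds (show B - 1 / (k + 1) < t by linarith)] with s hs
      rw [intervalCutoff_eq_zero_right hs.le, zero_mul]

end Cutoff

/-- A primitive that vanishes beyond an interval, possibly with an integrable singularity of its
derivative at the endpoints, is a limit of smooth functions that vanish beyond the interval. -/
theorem exists_smooth_primitive_approx {A B : ℝ} {χ : ℝ → ℝ} (hχ : ContDiffOn ℝ ∞ χ (Ioo A B))
    (hi : IntegrableOn χ (Ioo A B)) :
    ∃ ζ : ℕ → ℝ → ℝ, (∀ k, ContDiff ℝ ∞ (ζ k)) ∧ (∀ k, ∃ b < B, ∀ t, b ≤ t → ζ k t = 0) ∧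
      (∀ k t, |ζ k t| ≤ ∫ s in Ioo A B, |χ s|) ∧
      (∀ k t, |deriv (ζ k) t| ≤ |(Ioo A B).indicator χ t|) ∧
      (∀ t, Tendsto (fun k => ζ k t) atTop (𝓝 (-∫ s in Ioo A B ∩ Ioi t, χ s))) ∧
      ∀ t, Tendsto (fun k => deriv (ζ k) t) atTop (𝓝 ((Ioo A B).indicator χ t)) := by
  have hia : IntegrableOn (fun s => |χ s|) (Ioo A B) := hi.abs
  let g : ℕ → ℝ → ℝ := fun k t => intervalCutoff A B k t * χ t
  have hg : ∀ k, ContDiff ℝ ∞ (g k) := fun k => contDiff_intervalCutoff_mul hχ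
  have hgb : ∀ k t, |g k t| ≤ |χ t| := by
    intro k t
    rw [abs_mul, abs_of_nonneg intervalCutoff_nonneg]
    exact mul_le_of_le_one_left (abs_nonneg _) intervalCutoff_le_one
  have hg0 : ∀ k t, t ∉ Ioo A B → g k t = 0 := fun k t ht => by
    simp only [g, intervalCutoff_eq_zero ht, zero_mul]
  -- Integrating from B makes ζ vanish from B - 1/(k+1) on, as a radial cutoff must. Below A it is
  -- merely constant, which is harmless in a ball.
  let ζ : ℕ → ℝ → ℝ := fun k t => ∫ s in B..t, g k s
  have hd : ∀ k t, HasDerivAt (ζ k) (g k t) t := fun k t =>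
    intervalIntegral.integral_hasDerivAt_right ((hg k).continuous.intervalIntegrable _ _)
      ((hg k).continuous.stronglyMeasurableAtFilter _ _) (hg k).continuous.continuousAt
  have hder : ∀ k, deriv (ζ k) = g k := fun k => funext fun t => (hd k t).deriv
  have hζ : ∀ k t, ζ k t = -∫ s in Ioo A B ∩ Ioi t, g k s := by
    intro k t
    rcases le_or_gt B t with ht | ht
    · have h1 : Ioo A B ∩ Ioi t = ∅ := by
        ext s; simp only [mem_inter_iff, mem_Ioo, mem_Ioi, mem_empty_iff_false, iff_false]
        rintro ⟨⟨_, h⟩, h'⟩; linarith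
      rw [h1, Measure.restrict_empty, integral_zero_measure, neg_zero]
      change ∫ s in B..t, g k s = 0
      rw [intervalIntegral.integral_of_le ht]
      refine setIntegral_eq_zero_of_forall_eq_zero fun s hs => hg0 k s fun h => ?_
      exact absurd hs.1 (not_lt.2 h.2.le)
    · change ∫ s in B..t, g k s = _
      rw [intervalIntegral.integral_of_ge ht.le, neg_inj]
      refine setIntegral_eq_of_subset_of_forall_sdiff_eq_zero measurableSet_Ioc ?_ ?_
      · rintro s ⟨⟨_, h⟩, h'⟩
        exact ⟨h', h.le⟩
      · rintro s ⟨h1, h2⟩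
        exact hg0 k s fun h => h2 ⟨h, h1.1⟩
  refine ⟨ζ, fun k => ?_, fun k => ⟨B - 1 / (k + 1), by
      have : (0 : ℝ) < 1 / ((k : ℝ) + 1) := by positivity
      linarith, fun t ht => ?_⟩, fun k t => ?_, fun k t => ?_, fun t => ?_, fun t => ?_⟩
  · rw [contDiff_infty_iff_deriv]
    exact ⟨fun t => (hd k t).differentiableAt, by rw [hder]; exact hg k⟩
  · change ∫ s in B..t, g k s = 0
    refine intervalIntegral.integral_zero_ae (.of_forall fun s hs => ?_)
    have h1 : B - 1 / (k + 1) ≤ s := by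
      have : (0 : ℝ) < 1 / ((k : ℝ) + 1) := by positivity
      rcases le_total B t with h | h
      · rw [uIoc_of_le h] at hs; linarith [hs.1]
      · rw [uIoc_of_ge h] at hs; linarith [hs.1]
    simp only [g, intervalCutoff_eq_zero_right h1, zero_mul]
  · rw [hζ, abs_neg]
    calc |∫ s in Ioo A B ∩ Ioi t, g k s| ≤ ∫ s in Ioo A B ∩ Ioi t, |χ s| := by
          exact norm_integral_le_of_norm_le (f := g k) (hia.mono_set inter_subset_left)
            (.of_forall fun s => hgb k s)
      _ ≤ ∫ s in Ioo A B, |χ s| :=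
          setIntegral_mono_set hi.abs (.of_forall fun s => abs_nonneg _)
            (LE.le.eventuallyLE inter_subset_left)
  · rw [hder]
    by_cases ht : t ∈ Ioo A B
    · rw [indicator_of_mem ht]; exact hgb k t
    · rw [hg0 k t ht, abs_zero]; exact abs_nonneg _
  · simp only [hζ]
    refine Tendsto.neg (tendsto_integral_of_dominated_convergence (fun s => |χ s|)
      (fun k => (hg k).continuous.aestronglyMeasurable) (hia.mono_set inter_subset_left)
      (fun k => .of_forall fun s => hgb k s) ?_)
    filter_upwards [ae_restrict_mem (measurableSet_Ioo.inter measurableSet_Ioi)] with s hs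
    simpa using (tendsto_intervalCutoff hs.1).mul_const (χ s)
  · simp only [hder]
    by_cases ht : t ∈ Ioo A B
    · rw [indicator_of_mem ht]
      simpa using (tendsto_intervalCutoff ht).mul_const (χ t)
    · simp only [hg0 _ t ht, indicator_of_notMem ht, tendsto_const_nhds]

/-- `div (ζ(|x|²) X) = ζ(|x|²) k + 2 ζ'(|x|²) g` integrates to zero over the ball of radius `R`, for
a field `X` with divergence `k` and `g = x · X`. -/
def RadialIdentity (R : ℝ) (k g : Space n → ℝ) : Prop :=
  ∀ ζ : ℝ → ℝ, ContDiff ℝ ∞ ζ → (∃ b < R ^ 2, ∀ t, b ≤ t → ζ t = 0) →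
    ∫ x in Metric.ball 0 R, (ζ (‖x‖ ^ 2) * k x + 2 * deriv ζ (‖x‖ ^ 2) * g x) = 0

/-- Extends the identity from smooth profiles to Lipschitz ones with derivative χ on (A, B) and zero
elsewhere, so that profiles with corners at the radii of interest are allowed. The bound on χ
dominates the g term. -/
theorem RadialIdentity.integral_primitive {R : ℝ} {k g : Space n → ℝ} (h : RadialIdentity R k g)
    (hk : IntegrableOn k (Metric.ball 0 R)) (hg : IntegrableOn g (Metric.ball 0 R))
    {A B C : ℝ} (hB : B ≤ R ^ 2) {χ : ℝ → ℝ} (hχ : ContDiffOn ℝ ∞ χ (Ioo A B))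
    (hC : ∀ t ∈ Ioo A B, |χ t| ≤ C) :
    ∫ x in Metric.ball 0 R, ((-∫ s in Ioo A B ∩ Ioi (‖x‖ ^ 2), χ s) * k x +
      2 * (Ioo A B).indicator χ (‖x‖ ^ 2) * g x) = 0 := by
  have hi : IntegrableOn χ (Ioo A B) := by
    refine Integrable.of_bound (hχ.continuousOn.aestronglyMeasurable measurableSet_Ioo) C ?_
    filter_upwards [ae_restrict_mem measurableSet_Ioo] with t ht using hC t ht
  obtain ⟨ζ, h1, h2, h3, h4, h5, h6⟩ := exists_smooth_primitive_approx hχ hi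
  have h0 : ∀ j, ∫ x in Metric.ball (0 : Space n) R,
      (ζ j (‖x‖ ^ 2) * k x + 2 * deriv (ζ j) (‖x‖ ^ 2) * g x) = 0 := fun j => by
    obtain ⟨b, hb, hb'⟩ := h2 j
    exact h (ζ j) (h1 j) ⟨b, hb.trans_le hB, hb'⟩
  have hT : Tendsto (fun j => ∫ x in Metric.ball (0 : Space n) R,
      (ζ j (‖x‖ ^ 2) * k x + 2 * deriv (ζ j) (‖x‖ ^ 2) * g x)) atTop
      (𝓝 (∫ x in Metric.ball (0 : Space n) R, ((-∫ s in Ioo A B ∩ Ioi (‖x‖ ^ 2), χ s) * k x +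
        2 * (Ioo A B).indicator χ (‖x‖ ^ 2) * g x))) := by
    refine tendsto_integral_of_dominated_convergence
      (fun x => (∫ s in Ioo A B, |χ s|) * |k x| + 2 * |C| * |g x|) ?_ ?_ ?_ ?_
    · intro j
      have c1 : Continuous fun x : Space n => ζ j (‖x‖ ^ 2) := by
        have := (h1 j).continuous; fun_prop
      have c2 : Continuous fun x : Space n => 2 * deriv (ζ j) (‖x‖ ^ 2) := by
        have := (h1 j).continuous_deriv (by simp); fun_prop
      exact (c1.aestronglyMeasurable.mul hk.1).add (c2.aestronglyMeasurable.mul hg.1)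
    · exact (hk.abs.const_mul _).add (hg.abs.const_mul _)
    · refine fun j => .of_forall fun x => ?_
      have e1 : |deriv (ζ j) (‖x‖ ^ 2)| ≤ |C| := by
        refine (h4 j _).trans ?_
        by_cases ht : ‖x‖ ^ 2 ∈ Ioo A B
        · rw [indicator_of_mem ht]; exact (hC _ ht).trans (le_abs_self C)
        · rw [indicator_of_notMem ht, abs_zero]; exact abs_nonneg _
      refine (norm_add_le _ _).trans ?_
      simp only [Real.norm_eq_abs, abs_mul, abs_two]
      gcongr
      exact h3 j _
    · refine .of_forall fun x => ?_
      exact ((h5 _).mul_const _).add (((h6 _).const_mul _).mul_const _)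
  simp only [h0] at hT
  exact tendsto_nhds_unique hT tendsto_const_nhds

/-- `∫_{B_r} div X = r⁻¹ ∫_{∂B_r} x · X`, integrated in `r`. -/
theorem RadialIdentity.integral_parabola {R : ℝ} {k g : Space n → ℝ} (h : RadialIdentity R k g)
    (hk : IntegrableOn k (Metric.ball 0 R)) (hg : IntegrableOn g (Metric.ball 0 R))
    {b : ℝ} (hb : 0 < b) (hbR : b ≤ R) :
    ∫ x in Metric.ball 0 b, ((b ^ 2 - ‖x‖ ^ 2) * k x - 2 * g x) = 0 := by
  -- The profile is b² - |x|². Any negative A would do: |x|² then always lies to its right,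
  -- including at the origin.
  have h1 := h.integral_primitive hk hg (A := -1) (B := b ^ 2) (C := 1) (by gcongr)
    (χ := fun _ => -1) contDiffOn_const (by simp)
  rw [← h1]
  rw [setIntegral_eq_of_subset_of_forall_sdiff_eq_zero measurableSet_ball
    (Metric.ball_subset_ball hbR)]
  rotate_left
  · rintro x ⟨-, hx⟩
    have hx' : b ≤ ‖x‖ := by simpa using hx
    have hx2 : b ^ 2 ≤ ‖x‖ ^ 2 := by gcongr
    have e1 : Ioo (-1) (b ^ 2) ∩ Ioi (‖x‖ ^ 2) = ∅ := by
      ext s; simp only [mem_inter_iff, mem_Ioo, mem_Ioi, mem_empty_iff_false, iff_false]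
      rintro ⟨⟨_, h⟩, h'⟩; linarith
    rw [e1, indicator_of_notMem (fun h => by linarith [h.2])]
    simp
  · refine setIntegral_congr_fun measurableSet_ball fun x hx => ?_
    have hx' : ‖x‖ < b := by simpa using hx
    have hx2 : ‖x‖ ^ 2 < b ^ 2 := by gcongr
    have hx0 : 0 ≤ ‖x‖ ^ 2 := by positivity
    have e1 : Ioo (-1) (b ^ 2) ∩ Ioi (‖x‖ ^ 2) = Ioo (‖x‖ ^ 2) (b ^ 2) := by
      ext s; simp only [mem_inter_iff, mem_Ioo, mem_Ioi]
      constructor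
      · rintro ⟨⟨_, h⟩, h'⟩; exact ⟨h', h⟩
      · rintro ⟨h, h'⟩; exact ⟨⟨by linarith, h'⟩, h⟩
    simp only [e1]
    rw [indicator_of_mem (show ‖x‖ ^ 2 ∈ Ioo (-1) (b ^ 2) from ⟨by linarith, hx2⟩)]
    simp [hx2.le]
    ring

/-- Formally this integrates the derivative of r^(-M) ∫_{B_r} k, using ∫_{B_r} k = r⁻¹ ∫_{∂B_r} g.
The proof tests with the profile equal to |x|^(-M) - b^(-M) on the annulus, constant inside B_a and
zero outside B_b. -/
theorem RadialIdentity.integral_annulus {R : ℝ} {k g : Space n → ℝ} (h : RadialIdentity R k g)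
    (hk : IntegrableOn k (Metric.ball 0 R)) (hg : IntegrableOn g (Metric.ball 0 R))
    {a b : ℝ} (ha : 0 < a) (hab : a < b) (hbR : b ≤ R) (M : ℝ) :
    b ^ (-M) * ∫ x in Metric.ball 0 b, k x =
      a ^ (-M) * (∫ x in Metric.ball 0 a, k x) + ∫ x in Metric.ball 0 b \ Metric.ball 0 a,
        (‖x‖ ^ (-M) * k x - M * ‖x‖ ^ (-M - 2) * g x) := by
  have hb : 0 < b := ha.trans hab
  have ha2 : 0 < a ^ 2 := by positivity
  have hab2 : a ^ 2 < b ^ 2 := by gcongr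
  -- The derivative of t^(-M/2), since profiles are functions of t = |x|².
  set χ : ℝ → ℝ := fun t => -(M / 2) * t ^ (-M / 2 - 1)
  have hpos : ∀ t ∈ Icc (a ^ 2) (b ^ 2), 0 < t := fun t ht => ha2.trans_le ht.1
  have hχ : ContDiffOn ℝ ∞ χ (Ioi 0) := fun t ht =>
    (contDiffAt_const.mul (Real.contDiffAt_rpow_const_of_ne (ne_of_gt ht))).contDiffWithinAt
  obtain ⟨C, hC⟩ := isCompact_Icc.exists_bound_of_continuousOn
    (hχ.continuousOn.mono hpos : ContinuousOn χ (Icc (a ^ 2) (b ^ 2)))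
  have hsq : ∀ {r : ℝ}, 0 ≤ r → ∀ q : ℝ, (r ^ 2) ^ q = r ^ (2 * q) := by
    intro r hr q
    rw [← Real.rpow_natCast, ← Real.rpow_mul hr]; norm_num
  have hprim : ∀ c ∈ Icc (a ^ 2) (b ^ 2),
      ∫ s in Ioo c (b ^ 2), χ s = (b ^ 2) ^ (-M / 2) - c ^ (-M / 2) := by
    intro c hc
    rw [← integral_Ioc_eq_integral_Ioo, ← intervalIntegral.integral_of_le hc.2]
    have hsub : uIcc c (b ^ 2) ⊆ Icc (a ^ 2) (b ^ 2) := by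
      rw [uIcc_of_le hc.2]; exact Icc_subset_Icc_left hc.1
    refine intervalIntegral.integral_eq_sub_of_hasDerivAt (f := fun t => t ^ (-M / 2))
      (fun t ht => ?_) ?_
    · exact (Real.hasDerivAt_rpow_const (p := -M / 2)
        (Or.inl (hpos t (hsub ht)).ne')).congr_deriv (by simp only [χ]; ring)
    · exact ((hχ.continuousOn.mono hpos).mono hsub).intervalIntegrable
  have h1 := h.integral_primitive hk hg (A := a ^ 2) (B := b ^ 2) (C := C) (by gcongr)
    (hχ.mono fun t ht => hpos t ⟨ht.1.le, ht.2.le⟩) (fun t ht => hC t ⟨ht.1.le, ht.2.le⟩)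
  have hBa : Metric.ball (0 : Space n) a ⊆ Metric.ball 0 b := Metric.ball_subset_ball hab.le
  have hBb : Metric.ball (0 : Space n) b ⊆ Metric.ball 0 R := Metric.ball_subset_ball hbR
  rw [setIntegral_eq_of_subset_of_forall_sdiff_eq_zero measurableSet_ball hBb] at h1
  rotate_left
  · rintro x ⟨-, hx⟩
    have hx' : b ≤ ‖x‖ := by simpa using hx
    have hx2 : b ^ 2 ≤ ‖x‖ ^ 2 := by gcongr
    have e1 : Ioo (a ^ 2) (b ^ 2) ∩ Ioi (‖x‖ ^ 2) = ∅ := by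
      ext s; simp only [mem_inter_iff, mem_Ioo, mem_Ioi, mem_empty_iff_false, iff_false]
      rintro ⟨⟨_, h⟩, h'⟩; linarith
    rw [e1, indicator_of_notMem (fun h => by linarith [h.2])]
    simp
  have hka := hk.mono_set (hBa.trans hBb)
  have hkb := hk.mono_set hBb
  have hkann := hkb.mono_set (sdiff_subset (t := Metric.ball 0 a))
  have hgann := (hg.mono_set hBb).mono_set (sdiff_subset (t := Metric.ball 0 a))
  have hannm : MeasurableSet (Metric.ball (0 : Space n) b \ Metric.ball 0 a) :=
    measurableSet_ball.diff measurableSet_ball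
  have hpow : ∀ q : ℝ, ∀ {f : Space n → ℝ},
      IntegrableOn f (Metric.ball (0 : Space n) b \ Metric.ball 0 a) →
      IntegrableOn (fun x => ‖x‖ ^ q * f x) (Metric.ball (0 : Space n) b \ Metric.ball 0 a) := by
    intro q f hf
    have hc : ContinuousOn (fun r : ℝ => r ^ q) (Icc a b) := fun r hr =>
      (Real.continuousAt_rpow_const r q (Or.inl (ha.trans_le hr.1).ne')).continuousWithinAt
    obtain ⟨D, hD⟩ := isCompact_Icc.exists_bound_of_continuousOn hc
    refine Integrable.bdd_mul (c := D) hf ?_ ?_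
    · exact (measurable_norm.pow_const q).aestronglyMeasurable
    · filter_upwards [ae_restrict_mem hannm] with x hx
      exact hD _ ⟨by simpa using hx.2, le_of_lt (by simpa using hx.1)⟩
  have hsum : ∀ {f : Space n → ℝ}, IntegrableOn f (Metric.ball 0 b) →
      ∫ x in Metric.ball 0 b, f x = (∫ x in Metric.ball 0 a, f x) +
        ∫ x in Metric.ball 0 b \ Metric.ball 0 a, f x := fun hf => by
    rw [setIntegral_sdiff measurableSet_ball hf hBa]; ring
  set F : Space n → ℝ := fun x => (-∫ s in Ioo (a ^ 2) (b ^ 2) ∩ Ioi (‖x‖ ^ 2), χ s) * k x +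
    2 * (Ioo (a ^ 2) (b ^ 2)).indicator χ (‖x‖ ^ 2) * g x
  have hF1 : EqOn F (fun x => (a ^ (-M) - b ^ (-M)) * k x) (Metric.ball 0 a) := by
    intro x hx
    have hx' : ‖x‖ < a := by simpa using hx
    have hx2 : ‖x‖ ^ 2 < a ^ 2 := by gcongr
    have e1 : Ioo (a ^ 2) (b ^ 2) ∩ Ioi (‖x‖ ^ 2) = Ioo (a ^ 2) (b ^ 2) :=
      inter_eq_left.2 fun s hs => hx2.trans hs.1
    simp only [F]
    rw [e1, hprim _ ⟨le_rfl, hab2.le⟩, indicator_of_notMem (fun h => by linarith [h.1]),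
      hsq hb.le, hsq ha.le, mul_div_cancel₀ _ two_ne_zero]
    ring
  have hF2 : F =ᵐ[volume.restrict (Metric.ball 0 b \ Metric.ball 0 a)] fun x =>
      (‖x‖ ^ (-M) * k x - M * (‖x‖ ^ (-M - 2) * g x)) - b ^ (-M) * k x := by
    -- The half-open annulus contains the sphere |x| = a, where the indicator of the open interval
    -- vanishes. That sphere is a null set.
    have hsph : ∀ᵐ x ∂(volume.restrict (Metric.ball (0 : Space n) b \ Metric.ball 0 a)),
        x ∉ Metric.sphere (0 : Space n) a :=
      ae_restrict_of_ae (measure_eq_zero_iff_ae_notMem.1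
        (Measure.addHaar_sphere_of_ne_zero volume _ ha.ne'))
    filter_upwards [hsph, ae_restrict_mem hannm] with x hx hxm
    have hx1 : a < ‖x‖ := lt_of_le_of_ne (by simpa using hxm.2) (fun h => hx (by simp [← h]))
    have hx' : ‖x‖ < b := by simpa using hxm.1
    have hx2 : a ^ 2 < ‖x‖ ^ 2 := by gcongr
    have hx3 : ‖x‖ ^ 2 < b ^ 2 := by gcongr
    have e1 : Ioo (a ^ 2) (b ^ 2) ∩ Ioi (‖x‖ ^ 2) = Ioo (‖x‖ ^ 2) (b ^ 2) := by
      ext s; simp only [mem_inter_iff, mem_Ioo, mem_Ioi]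
      constructor
      · rintro ⟨⟨_, h⟩, h'⟩; exact ⟨h', h⟩
      · rintro ⟨h, h'⟩; exact ⟨⟨by linarith, h'⟩, h⟩
    simp only [F]
    rw [e1, hprim _ ⟨hx2.le, hx3.le⟩, indicator_of_mem (show ‖x‖ ^ 2 ∈ Ioo (a ^ 2) (b ^ 2) from ⟨hx2, hx3⟩),
      hsq hb.le, hsq (norm_nonneg x), mul_div_cancel₀ _ two_ne_zero]
    simp only [χ]
    rw [hsq (norm_nonneg x), show 2 * (-M / 2 - 1) = -M - 2 by ring]
    ring
  have hint1 : IntegrableOn (fun x => ‖x‖ ^ (-M) * k x - M * (‖x‖ ^ (-M - 2) * g x))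
      (Metric.ball (0 : Space n) b \ Metric.ball 0 a) :=
    (hpow _ hkann).sub ((hpow _ hgann).const_mul M)
  have hint2 : IntegrableOn (fun x => b ^ (-M) * k x)
      (Metric.ball (0 : Space n) b \ Metric.ball 0 a) := hkann.const_mul _
  have hFb : IntegrableOn F (Metric.ball 0 b) := by
    rw [← union_sdiff_cancel hBa]
    refine IntegrableOn.union ?_ ?_
    · exact IntegrableOn.congr_fun (hka.const_mul _) hF1.symm measurableSet_ball
    · exact Integrable.congr (hint1.sub hint2) hF2.symm
  rw [hsum hFb, setIntegral_congr_fun measurableSet_ball hF1, integral_congr_ae hF2,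
    integral_sub hint1 hint2, integral_const_mul, integral_const_mul] at h1
  rw [hsum hkb]
  simp only [mul_assoc]
  linarith

end AltPhillips

namespace AltPhillips

variable {n : ℕ}

/-! ### The divergence theorem in balls -/

theorem hasFDerivAt_comp_norm_sq {ζ : ℝ → ℝ} (hζ : ContDiff ℝ ∞ ζ) (x : Space n) :
    HasFDerivAt (fun x : Space n => ζ (‖x‖ ^ 2)) ((2 * deriv ζ (‖x‖ ^ 2)) • innerSL ℝ x) x := by
  have h1 : HasDerivAt ζ (deriv ζ (‖x‖ ^ 2)) (‖x‖ ^ 2) :=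
    (hζ.differentiable (by simp) _).hasDerivAt
  have h2 : HasFDerivAt (fun x : Space n => ‖x‖ ^ 2) ((2 : ℝ) • innerSL ℝ x) x := by
    simpa [two_smul] using (hasStrictFDerivAt_norm_sq x).hasFDerivAt
  have h3 : HasFDerivAt (fun x : Space n => ζ (‖x‖ ^ 2)) _ x := h1.comp_hasFDerivAt x h2
  rw [smul_smul, mul_comm] at h3
  exact h3

theorem contDiff_comp_norm_sq {ζ : ℝ → ℝ} (hζ : ContDiff ℝ ∞ ζ) :
    ContDiff ℝ ∞ fun x : Space n => ζ (‖x‖ ^ 2) :=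
  hζ.comp (contDiff_norm_sq ℝ)

theorem isTestFunction_comp_norm_sq {R : ℝ} (hR : 0 < R) {ζ : ℝ → ℝ} (hζ : ContDiff ℝ ∞ ζ)
    (h : ∃ b < R ^ 2, ∀ t, b ≤ t → ζ t = 0) :
    IsTestFunction (Metric.ball 0 R) fun x : Space n => ζ (‖x‖ ^ 2) := by
  obtain ⟨b, hb, h0⟩ := h
  have hcl : IsClosed {x : Space n | ‖x‖ ^ 2 ≤ b} :=
    isClosed_le (by fun_prop) continuous_const
  have hsub : tsupport (fun x : Space n => ζ (‖x‖ ^ 2)) ⊆ {x | ‖x‖ ^ 2 ≤ b} := by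
    refine closure_minimal (fun x hx => ?_) hcl
    by_contra hx'
    exact hx (h0 _ (not_le.1 hx').le)
  have hball : {x : Space n | ‖x‖ ^ 2 ≤ b} ⊆ Metric.ball 0 R := by
    intro x hx
    have : ‖x‖ ^ 2 < R ^ 2 := lt_of_le_of_lt hx hb
    simpa using lt_of_pow_lt_pow_left₀ 2 hR.le this
  refine ⟨contDiff_comp_norm_sq hζ, ?_, hsub.trans hball⟩
  exact (isCompact_closedBall (0 : Space n) R).of_isClosed_subset (isClosed_tsupport _)
    ((hsub.trans hball).trans Metric.ball_subset_closedBall)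

/-- The instance of the field X = h v, whose divergence is ∂_v h and whose radial component is h
v·x. -/
theorem radialIdentity_fderiv {R : ℝ} (hR : 0 < R) {h : Space n → ℝ} (hh : ContDiff ℝ ∞ h)
    (v : Space n) :
    RadialIdentity R (fun x => fderiv ℝ h x v) (fun x => h x * inner ℝ v x) := by
  intro ζ hζ hb
  have ht := isTestFunction_comp_norm_sq (n := n) hR hζ hb
  have hw := hasWeakGradient_of_contDiff hh (measurableSet_ball (x := (0 : Space n)) (ε := R))
    Metric.isBounded_ball
  have h1 := hw.weak _ ht v
  have i1 := hw.integrable_inner_mul ht v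
  have i2 := hw.integrable_mul_fderiv ht v
  have h2 : ∫ x in Metric.ball (0 : Space n) R, (inner ℝ (gradient h x) v * ζ (‖x‖ ^ 2) +
      h x * fderiv ℝ (fun x : Space n => ζ (‖x‖ ^ 2)) x v) = 0 := by
    rw [integral_add i1 i2, h1]; ring
  rw [← h2]
  congr 1
  ext x
  rw [(hasFDerivAt_comp_norm_sq hζ x).fderiv, inner_gradient_eq_fderiv]
  simp [real_inner_comm v x]
  ring

/-- Integration in polar coordinates. -/
theorem integral_polar (hn : 1 ≤ n) {f : Space n → ℝ} (hf : Integrable f volume) :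
    ∫ x, f x = ∫ ρ in Ioi (0 : ℝ), ρ ^ (n - 1) *
      ∫ y : Metric.sphere (0 : Space n) 1, f (ρ • (y : Space n))
        ∂(volume : Measure (Space n)).toSphere := by
  have : Nonempty (Fin n) := ⟨⟨0, hn⟩⟩
  set σ := (volume : Measure (Space n)).toSphere
  have hmp := (volume : Measure (Space n)).measurePreserving_homeomorphUnitSphereProd
  have hemb := (homeomorphUnitSphereProd (Space n)).measurableEmbedding
  rw [finrank_euclideanSpace, Fintype.card_fin] at hmp
  let g : Metric.sphere (0 : Space n) 1 × Ioi (0 : ℝ) → ℝ := fun p => f (p.2.1 • (p.1 : Space n))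
  have hg : ∀ x : ({0}ᶜ : Set (Space n)), g (homeomorphUnitSphereProd (Space n) x) = f x := by
    intro x
    simp only [g]
    congr 1
    have hx : ‖(x : Space n)‖ ≠ 0 := norm_ne_zero_iff.2 x.2
    simp [smul_smul, hx]
  have e1 : ∫ x, f x = ∫ p, g p ∂(σ.prod (Measure.volumeIoiPow (n - 1))) := by
    rw [← hmp.integral_comp hemb]
    simp only [hg]
    rw [integral_subtype_comap (measurableSet_singleton _).compl f, restrict_compl_singleton]
  have hgi : Integrable g (σ.prod (Measure.volumeIoiPow (n - 1))) := by
    rw [← hmp.integrable_comp_emb hemb]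
    have : g ∘ homeomorphUnitSphereProd (Space n) = f ∘ Subtype.val := funext hg
    rw [this, ← integrableOn_iff_comap_subtypeVal (measurableSet_singleton _).compl]
    exact hf.integrableOn
  rw [e1, integral_prod_symm _ hgi]
  simp only [Measure.volumeIoiPow, ENNReal.ofReal]
  rw [integral_withDensity_eq_integral_smul (by fun_prop),
    integral_subtype_comap measurableSet_Ioi fun ρ : ℝ => Real.toNNReal (ρ ^ (n - 1)) •
      ∫ y : Metric.sphere (0 : Space n) 1, f (ρ • (y : Space n)) ∂σ]
  refine setIntegral_congr_fun measurableSet_Ioi fun ρ hρ => ?_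
  simp only [NNReal.smul_def, Real.coe_toNNReal _ (pow_nonneg (le_of_lt hρ) _), smul_eq_mul]

theorem continuous_integral_sphere {f : Space n → ℝ} (hf : Continuous f) :
    Continuous fun ρ : ℝ => ∫ y : Metric.sphere (0 : Space n) 1, f (ρ • (y : Space n))
      ∂(volume : Measure (Space n)).toSphere := by
  have hc : Continuous (Function.uncurry fun (ρ : ℝ) (y : Metric.sphere (0 : Space n) 1) =>
      f (ρ • (y : Space n))) := by
    have : Continuous fun p : ℝ × Metric.sphere (0 : Space n) 1 => f (p.1 • (p.2 : Space n)) := by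
      fun_prop
    exact this
  have := continuous_parametric_integral_of_continuous
    (μ := (volume : Measure (Space n)).toSphere) hc (isCompact_univ)
  simpa using this

theorem integrableOn_ball_of_continuous {f : Space n → ℝ} (hf : Continuous f) (b : ℝ) :
    IntegrableOn f (Metric.ball 0 b) :=
  (hf.continuousOn.integrableOn_compact (isCompact_closedBall (0 : Space n) b)).mono_set
    Metric.ball_subset_closedBall

/-- In polar coordinates the integral over B_b is a one-dimensional integral of a continuous
function, to which the fundamental theorem of calculus applies. -/
theorem hasDerivAt_integral_ball (hn : 1 ≤ n) {f : Space n → ℝ} (hf : Continuous f) {r : ℝ}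
    (hr : 0 < r) :
    HasDerivAt (fun b => ∫ x in Metric.ball (0 : Space n) b, f x) (sphereIntegral r f) r := by
  set s : ℝ → ℝ := fun ρ => ρ ^ (n - 1) *
    ∫ y : Metric.sphere (0 : Space n) 1, f (ρ • (y : Space n)) ∂(volume : Measure (Space n)).toSphere
    with hs
  have hsc : Continuous s := (continuous_pow _).mul (continuous_integral_sphere hf)
  have e1 : ∀ b, 0 < b → ∫ x in Metric.ball (0 : Space n) b, f x = ∫ ρ in (0)..b, s ρ := by
    intro b hb
    rw [← integral_indicator measurableSet_ball, integral_polar hn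
      ((integrableOn_ball_of_continuous hf b).integrable_indicator measurableSet_ball),
      intervalIntegral.integral_of_le hb.le, integral_Ioc_eq_integral_Ioo]
    rw [setIntegral_eq_of_subset_of_forall_sdiff_eq_zero measurableSet_Ioi
      (show Ioo 0 b ⊆ Ioi (0 : ℝ) from Ioo_subset_Ioi_self)]
    · refine setIntegral_congr_fun measurableSet_Ioo fun ρ hρ => ?_
      simp only [hs]
      congr 1
      refine integral_congr_ae (.of_forall fun y => ?_)
      refine indicator_of_mem ?_ _
      simp [norm_smul, abs_of_pos hρ.1, hρ.2]
    · rintro ρ ⟨h1, h2⟩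
      have h1 : 0 < ρ := h1
      have h3 : b ≤ ρ := not_lt.1 fun h => h2 ⟨h1, h⟩
      rw [integral_eq_zero_of_ae, mul_zero]
      refine .of_forall fun y => indicator_of_notMem ?_ _
      simp [norm_smul, abs_of_pos h1, h3]
  have e2 : s r = sphereIntegral r f := by
    simp only [hs, sphereIntegral]
    rw [← Nat.cast_pred hn, Real.rpow_natCast]
  rw [← e2]
  refine (intervalIntegral.integral_hasDerivAt_right (hsc.intervalIntegrable 0 r)
    (hsc.stronglyMeasurableAtFilter _ _) hsc.continuousAt).congr_of_eventuallyEq ?_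
  filter_upwards [lt_mem_nhds hr] with b hb using e1 b hb

/-- The divergence theorem, found by differentiating in b the identity b² ∫_{B_b} k = ∫_{B_b} (|x|²
k + 2g). On the sphere |x| = r the surface terms in k cancel, leaving 2r ∫_{B_r} k = 2 ∫_{∂B_r} g.
-/
theorem integral_ball_fderiv (hn : 1 ≤ n) {h : Space n → ℝ} (hh : ContDiff ℝ ∞ h) {r : ℝ}
    (hr : 0 < r) (v : Space n) :
    ∫ x in Metric.ball 0 r, fderiv ℝ h x v =
      sphereIntegral r (fun x => h x * inner ℝ v (r⁻¹ • x)) := by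
  set k : Space n → ℝ := fun x => fderiv ℝ h x v
  set g : Space n → ℝ := fun x => h x * inner ℝ v x
  have hk : Continuous k := (hh.continuous_fderiv (by simp)).clm_apply continuous_const
  have hg : Continuous g := hh.continuous.mul (by fun_prop)
  have hq : Continuous fun x => ‖x‖ ^ 2 * k x + 2 * g x := by fun_prop
  have h0 : ∀ b, 0 < b → b ^ 2 * (∫ x in Metric.ball (0 : Space n) b, k x) -
      ∫ x in Metric.ball (0 : Space n) b, (‖x‖ ^ 2 * k x + 2 * g x) = 0 := by
    intro b hb
    rw [← (radialIdentity_fderiv hb hh v).integral_parabola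
      (integrableOn_ball_of_continuous hk b) (integrableOn_ball_of_continuous hg b) hb le_rfl,
      ← integral_const_mul, ← integral_sub ((integrableOn_ball_of_continuous hk b).const_mul _)
      (integrableOn_ball_of_continuous hq b)]
    congr 1; ext x; ring
  have hd := (((hasDerivAt_id r).pow 2).mul (hasDerivAt_integral_ball hn hk hr)).sub
    (hasDerivAt_integral_ball hn hq hr)
  have hd0 := hd.unique ((hasDerivAt_const r (0 : ℝ)).congr_of_eventuallyEq (by
    filter_upwards [lt_mem_nhds hr] with b hb
    simpa using h0 b hb))
  have hσ : ∀ f : Space n → ℝ, Continuous f → Integrable (fun y : Metric.sphere (0 : Space n) 1 =>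
      f (r • (y : Space n))) (volume : Measure (Space n)).toSphere := by
    intro f hf
    have : Continuous fun y : Metric.sphere (0 : Space n) 1 => f (r • (y : Space n)) := by fun_prop
    exact this.integrable_of_hasCompactSupport (HasCompactSupport.of_compactSpace _)
  have hy : ∀ y : Metric.sphere (0 : Space n) 1, ‖r • (y : Space n)‖ = r := by
    intro y; rw [norm_smul]; simp [abs_of_pos hr]
  simp only [sphereIntegral, hy] at hd0 ⊢
  rw [integral_add ((hσ k hk).const_mul _) ((hσ g hg).const_mul _), integral_const_mul,
    integral_const_mul] at hd0
  have hgr : ∫ y : Metric.sphere (0 : Space n) 1, g (r • (y : Space n))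
        ∂(volume : Measure (Space n)).toSphere = r * ∫ y : Metric.sphere (0 : Space n) 1,
      h (r • (y : Space n)) * inner ℝ v (r⁻¹ • r • (y : Space n))
        ∂(volume : Measure (Space n)).toSphere := by
    rw [← integral_const_mul]
    congr 1; ext y
    simp only [g, inner_smul_right]
    field_simp
  rw [hgr] at hd0
  have : 2 * r * ((∫ x in Metric.ball (0 : Space n) r, k x) - r ^ ((n : ℝ) - 1) *
      ∫ y : Metric.sphere (0 : Space n) 1, h (r • (y : Space n)) *
        inner ℝ v (r⁻¹ • r • (y : Space n)) ∂(volume : Measure (Space n)).toSphere) = 0 := by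
    simp at hd0
    linarith
  rcases mul_eq_zero.1 this with h1 | h1
  · linarith
  · linarith

end AltPhillips

namespace AltPhillips

variable {n : ℕ}

/-! ### Traces on spheres -/

theorem integrable_mul_of_memLp {X : Type*} [MeasurableSpace X] {μ : Measure X} {f g : X → ℝ}
    (hf : MemLp f 2 μ) (hg : MemLp g 2 μ) : Integrable (fun x => f x * g x) μ :=
  hf.integrable_mul hg

/-- The surface measure of the unit sphere. -/
noncomputable abbrev sphereMeasure (n : ℕ) : Measure (Metric.sphere (0 : Space n) 1) :=
  (volume : Measure (Space n)).toSphere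

theorem memLp_sphere_of_continuous {f : Space n → ℝ} (hf : Continuous f) (r : ℝ) (p : ℝ≥0∞) :
    MemLp (fun y : Metric.sphere (0 : Space n) 1 => f (r • (y : Space n))) p (sphereMeasure n) := by
  have : Continuous fun y : Metric.sphere (0 : Space n) 1 => f (r • (y : Space n)) := by fun_prop
  exact this.memLp_of_hasCompactSupport (HasCompactSupport.of_compactSpace _)

/-- The Gauss-Green formula for fields in the direction of `x`. -/
theorem integral_ball_radial_of_green {r : ℝ} (hr : 0 < r) {u : Space n → ℝ}
    {G : Space n → Space n} (hu : MemLp u 2 (volume.restrict (Metric.ball 0 r)))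
    (hG : MemLp G 2 (volume.restrict (Metric.ball 0 r))) {g : Space n → ℝ}
    (hg : MemLp (fun y : Metric.sphere (0 : Space n) 1 => g (r • (y : Space n))) 2
      (sphereMeasure n))
    (h : ∀ ψ : Space n → ℝ, ContDiff ℝ ∞ ψ → ∀ v : Space n,
      ∫ x in Metric.ball 0 r, (u x * fderiv ℝ ψ x v + inner ℝ (G x) v * ψ x) =
        sphereIntegral r (fun x => g x * ψ x * inner ℝ v (r⁻¹ • x)))
    {ψ : Space n → ℝ} (hψ : ContDiff ℝ ∞ ψ) :
    ∫ x in Metric.ball 0 r, (u x * (n * ψ x + fderiv ℝ ψ x x) + inner ℝ (G x) x * ψ x) =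
      r * sphereIntegral r (fun x => g x * ψ x) := by
  set b := EuclideanSpace.basisFun (Fin n) ℝ
  have hfin : IsFiniteMeasure (volume.restrict (Metric.ball (0 : Space n) r)) :=
    ⟨by simpa using measure_ball_lt_top⟩
  have hsm : ∀ i, ContDiff ℝ ∞ fun x : Space n => (inner ℝ (b i) x : ℝ) :=
    fun i => contDiff_const.inner ℝ contDiff_id
  -- Green's formula is applied to ψ x_i in direction e_i and summed. On the sphere Σ x_i ν_i = r,
  -- which removes the normal from the boundary term.
  have hd : ∀ i x, fderiv ℝ (fun x => ψ x * inner ℝ (b i) x) x (b i)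
      = ψ x + fderiv ℝ ψ x (inner ℝ (b i) x • b i) := by
    intro i x
    rw [fderiv_fun_mul (hψ.differentiable (by simp) x) ((hsm i).differentiable (by simp) x)]
    have : fderiv ℝ (fun x : Space n => (inner ℝ (b i) x : ℝ)) x = innerSL ℝ (b i) :=
      (innerSL ℝ (b i)).fderiv
    rw [this]
    simp
  have h1 : ∀ x, u x * (n * ψ x + fderiv ℝ ψ x x) + inner ℝ (G x) x * ψ x
      = ∑ i, (u x * fderiv ℝ (fun x => ψ x * inner ℝ (b i) x) x (b i) +
        inner ℝ (G x) (b i) * (ψ x * inner ℝ (b i) x)) := by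
    intro x
    rw [Finset.sum_add_distrib]
    congr 1
    · simp only [hd, ← Finset.mul_sum, Finset.sum_add_distrib, ← map_sum, b.sum_repr']
      simp
    · rw [← b.sum_inner_mul_inner, Finset.sum_mul]
      exact Finset.sum_congr rfl fun i _ => by ring
  have hmem : ∀ {f : Space n → ℝ}, Continuous f → MemLp f 2 (volume.restrict (Metric.ball 0 r)) := by
    intro f hf
    obtain ⟨C, hC⟩ := (isCompact_closedBall (0 : Space n) r).exists_bound_of_continuousOn
      hf.continuousOn
    refine MemLp.of_bound hf.aestronglyMeasurable C ?_
    filter_upwards [ae_restrict_mem measurableSet_ball] with x hx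
    exact hC x (Metric.ball_subset_closedBall hx)
  simp only [h1]
  rw [integral_finsetSum]
  rotate_left
  · intro i _
    refine (hu.integrable_mul (hmem ?_)).add ((hG.inner_const (b i)).integrable_mul
      (hmem (hψ.continuous.mul (hsm i).continuous)))
    exact ((hψ.mul (hsm i)).continuous_fderiv (by simp)).clm_apply continuous_const
  rw [Finset.sum_congr rfl fun i _ => h _ (hψ.mul (hsm i)) (b i)]
  simp only [sphereIntegral]
  rw [← Finset.mul_sum, ← integral_finsetSum]
  · rw [mul_left_comm r]
    congr 1
    rw [← integral_const_mul]
    refine integral_congr_ae (.of_forall fun y => ?_)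
    have hy : ‖(y : Space n)‖ = 1 := by simp
    have h2 : ∑ i, (inner ℝ (b i) (y : Space n) : ℝ) * inner ℝ (b i) (y : Space n) = 1 := by
      have := b.sum_inner_mul_inner (y : Space n) y
      simp only [real_inner_comm (b _) (y : Space n), real_inner_self_eq_norm_sq, hy,
        one_pow] at this
      simpa using this
    calc _ = r * (g (r • (y : Space n)) * ψ (r • (y : Space n))) *
          ∑ i, (inner ℝ (b i) (y : Space n) : ℝ) * inner ℝ (b i) (y : Space n) := by
          rw [Finset.mul_sum]
          refine Finset.sum_congr rfl fun i _ => ?_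
          rw [inv_smul_smul₀ hr.ne', inner_smul_right]
          ring
      _ = _ := by rw [h2, mul_one]
  · intro i _
    have e1 := memLp_sphere_of_continuous (hψ.continuous.mul (hsm i).continuous) r 2
    have e2 := memLp_sphere_of_continuous (f := fun x : Space n => inner ℝ (b i) (r⁻¹ • x))
      (by fun_prop) r ∞
    exact memLp_one_iff_integrable.1 (e2.mul (memLp_one_iff_integrable.2 (hg.integrable_mul e1)))

/-- The radial form of Green's formula determines ∫_{∂B_r} g ψ for every smooth ψ. Pushing the
surface measure forward to the ambient space allows the fundamental lemma of the calculus of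
variations there. Hence the choice in `sphereTrace` does not matter. -/
theorem IsSphereTrace.ae_unique {r : ℝ} (hr : 0 < r) {u g g' : Space n → ℝ}
    (h : IsSphereTrace u r g) (h' : IsSphereTrace u r g') :
    ∀ᵐ y : Metric.sphere (0 : Space n) 1 ∂sphereMeasure n, g (r • (y : Space n)) = g' (r • (y : Space n)) := by
  have hw := h.memH1.hasWeakGradient
  set T : Metric.sphere (0 : Space n) 1 → Space n := fun y => r • (y : Space n)
  have hT : MeasurableEmbedding T := by
    have : Topology.IsClosedEmbedding T := by
      refine Continuous.isClosedEmbedding (by fun_prop) fun y z hyz => ?_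
      exact Subtype.ext (smul_right_injective _ hr.ne' hyz)
    exact this.measurableEmbedding
  have hint : Integrable (fun x => g x - g' x) ((sphereMeasure n).map T) := by
    rw [hT.integrable_map_iff]
    exact (h.memLp.sub h'.memLp).integrable (by norm_num)
  have := ae_eq_zero_of_integral_contDiff_smul_eq_zero hint.locallyIntegrable fun ψ hψ _ => ?_
  · rw [hT.ae_map_iff] at this
    filter_upwards [this] with y hy using sub_eq_zero.1 hy
  · have e1 := integral_ball_radial_of_green hr hw.memLp hw.memLp_grad h.memLp h.green hψ
    have e2 := integral_ball_radial_of_green hr hw.memLp hw.memLp_grad h'.memLp h'.green hψ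
    have hr' : r ^ ((n : ℝ) - 1) ≠ 0 := (Real.rpow_pos_of_pos hr _).ne'
    have e3 := mul_left_cancel₀ hr' (mul_left_cancel₀ hr.ne' (e1.symm.trans e2))
    have hψm := memLp_sphere_of_continuous hψ.continuous r 2
    rw [hT.integral_map]
    simp only [smul_eq_mul, mul_comm (ψ _), sub_mul]
    exact (integral_sub (h.memLp.integrable_mul hψm) (h'.memLp.integrable_mul hψm)).trans
      (sub_eq_zero.2 e3)

theorem norm_toLp_sq {X : Type*} [MeasurableSpace X] {μ : Measure X} {F : Type*}
    [NormedAddCommGroup F] [InnerProductSpace ℝ F] {f : X → F} (hf : MemLp f 2 μ) :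
    ‖hf.toLp f‖ ^ 2 = ∫ x, ‖f x‖ ^ 2 ∂μ := by
  rw [← real_inner_self_eq_norm_sq, L2.inner_def]
  refine integral_congr_ae ?_
  filter_upwards [hf.coeFn_toLp] with x hx
  rw [hx, real_inner_self_eq_norm_sq]

/-- For smooth f, r ∫_{∂B_r} f² = ∫_{B_r} (n f² + 2 f x·∇f), which is at most (n + r) times the
squared H¹ norm. Restrictions of smooth approximations are therefore Cauchy in L² of the sphere.
Their limit is the trace, and both Green's formula and the formula for the square pass to the limit.
-/
theorem exists_sphereTrace (hn : 1 ≤ n) {r : ℝ} (hr : 0 < r) {u : Space n → ℝ}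
    {G : Space n → Space n} (h : HasWeakGradient (Metric.ball 0 r) u G) :
    ∃ g, IsSphereTrace u r g ∧ r * sphereIntegral r (fun x => g x ^ 2) =
      ∫ x in Metric.ball 0 r, (n * u x ^ 2 + 2 * (u x * inner ℝ (G x) x)) := by
  obtain ⟨f, hf, hfu, hfG⟩ := h.exists_smooth_approx hr
  set μ := volume.restrict (Metric.ball (0 : Space n) r)
  have hr' : 0 < r ^ ((n : ℝ) - 1) := Real.rpow_pos_of_pos hr _
  have hfin : IsFiniteMeasure μ := ⟨by simpa [μ] using measure_ball_lt_top⟩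
  have hmem : ∀ {F : Type} [NormedAddCommGroup F] {f : Space n → F}, Continuous f →
      ∀ p, MemLp f p μ := by
    intro F _ f hf p
    obtain ⟨C, hC⟩ := (isCompact_closedBall (0 : Space n) r).exists_bound_of_continuousOn
      hf.continuousOn
    refine MemLp.of_bound hf.aestronglyMeasurable C ?_
    filter_upwards [ae_restrict_mem measurableSet_ball] with x hx
    exact hC x (Metric.ball_subset_closedBall hx)
  have hfm : ∀ k, MemLp (f k) 2 μ := fun k => hmem (hf k).continuous 2
  have hgm : ∀ k, MemLp (gradient (f k)) 2 μ := fun k => hmem (continuous_gradient (hf k)) 2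
  -- the two Green formulas for smooth functions
  have hgreen : ∀ f : Space n → ℝ, ContDiff ℝ ∞ f → ∀ ψ : Space n → ℝ, ContDiff ℝ ∞ ψ →
      ∀ v : Space n,
      ∫ x in Metric.ball 0 r, (f x * fderiv ℝ ψ x v + inner ℝ (gradient f x) v * ψ x) =
        sphereIntegral r (fun x => f x * ψ x * inner ℝ v (r⁻¹ • x)) := by
    intro f hf ψ hψ v
    rw [← integral_ball_fderiv hn (hf.mul hψ) hr v]
    congr 1; ext x
    rw [fderiv_fun_mul (hf.differentiable (by simp) x) (hψ.differentiable (by simp) x),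
      inner_gradient_eq_fderiv]
    simp [mul_comm]
  have hsq : ∀ f : Space n → ℝ, ContDiff ℝ ∞ f → r * sphereIntegral r (fun x => f x ^ 2) =
      ∫ x, (n * f x ^ 2 + 2 * (f x * inner ℝ (gradient f x) x)) ∂μ := by
    intro f hf
    have := integral_ball_radial_of_green hr (hmem hf.continuous 2)
      (hmem (continuous_gradient hf) 2) (memLp_sphere_of_continuous hf.continuous r 2)
      (hgreen f hf) hf
    simp only [pow_two] at this ⊢
    rw [← this]
    refine integral_congr_ae (.of_forall fun x => ?_)
    simp only [inner_gradient_eq_fderiv]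
    ring
  -- the restrictions to the sphere form a Cauchy sequence
  let a : ℕ → Metric.sphere (0 : Space n) 1 → ℝ := fun k y => f k (r • (y : Space n))
  have ha : ∀ k, MemLp (a k) 2 (sphereMeasure n) := fun k =>
    memLp_sphere_of_continuous (hf k).continuous r 2
  have hbound : ∀ f : Space n → ℝ, ContDiff ℝ ∞ f →
      ∫ y : Metric.sphere (0 : Space n) 1, f (r • (y : Space n)) ^ 2 ∂sphereMeasure n ≤
        (r * r ^ ((n : ℝ) - 1))⁻¹ * (n + r) * ((∫ x, f x ^ 2 ∂μ) + ∫ x, ‖gradient f x‖ ^ 2 ∂μ) := by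
    intro f hf
    have i1 : Integrable (fun x => f x ^ 2) μ := (hmem hf.continuous 2).integrable_sq
    have i2 : Integrable (fun x => ‖gradient f x‖ ^ 2) μ :=
      (hmem (continuous_gradient hf) 2).norm.integrable_sq
    have h1 := hsq f hf
    rw [sphereIntegral, ← mul_assoc] at h1
    rw [mul_assoc, le_inv_mul_iff₀ (by positivity), h1, ← integral_add i1 i2, ← integral_const_mul]
    refine integral_mono_ae ?_ ((i1.add i2).const_mul _) ?_
    · refine (i1.const_mul _).add (Integrable.const_mul ?_ _)
      exact memLp_one_iff_integrable.1 (hmem (hf.continuous.mul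
        ((continuous_gradient hf).inner continuous_id)) 1)
    · filter_upwards [ae_restrict_mem measurableSet_ball] with x hx
      have hx' : ‖x‖ ≤ r := le_of_lt (by simpa using hx)
      have h3 : inner ℝ (gradient f x) x ≤ ‖gradient f x‖ * r :=
        (real_inner_le_norm _ _).trans (by gcongr)
      have h3' : -(‖gradient f x‖ * r) ≤ inner ℝ (gradient f x) x := by
        have := abs_real_inner_le_norm (gradient f x) x
        have h4 : ‖gradient f x‖ * ‖x‖ ≤ ‖gradient f x‖ * r := by gcongr
        linarith [neg_abs_le (inner ℝ (gradient f x) x)]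
      have h5 : f x * inner ℝ (gradient f x) x ≤ |f x| * (‖gradient f x‖ * r) := by
        refine (le_abs_self _).trans ?_
        rw [abs_mul]
        gcongr
        exact abs_le.2 ⟨h3', h3⟩
      have h6 : 2 * (|f x| * ‖gradient f x‖) ≤ f x ^ 2 + ‖gradient f x‖ ^ 2 := by
        have := two_mul_le_add_sq (|f x|) (‖gradient f x‖)
        rw [sq_abs] at this; linarith
      have h7 : (0 : ℝ) ≤ n * ‖gradient f x‖ ^ 2 := by positivity
      nlinarith [mul_le_mul_of_nonneg_left h6 hr.le]
  have hcauchy : CauchySeq fun k => (ha k).toLp (a k) := by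
    have c1 : CauchySeq fun k => (hfm k).toLp (f k) :=
      ((Lp.tendsto_Lp_iff_tendsto_eLpNorm'' f hfm u h.memLp).2 hfu).cauchySeq
    have c2 : CauchySeq fun k => (hgm k).toLp (gradient (f k)) :=
      ((Lp.tendsto_Lp_iff_tendsto_eLpNorm'' _ hgm G h.memLp_grad).2 hfG).cauchySeq
    set C := (r * r ^ ((n : ℝ) - 1))⁻¹ * (n + r)
    have hC : 0 ≤ C := by positivity
    rw [Metric.cauchySeq_iff] at c1 c2 ⊢
    intro ε hε
    obtain ⟨δ, hδ, hδε⟩ : ∃ δ > 0, C * (δ ^ 2 + δ ^ 2) < ε ^ 2 := by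
      refine ⟨ε / (2 * (C + 1)), by positivity, ?_⟩
      have : C * ((ε / (2 * (C + 1))) ^ 2 + (ε / (2 * (C + 1))) ^ 2)
        = ε ^ 2 * (C / (2 * (C + 1) ^ 2)) := by field_simp; ring
      rw [this]
      refine mul_lt_of_lt_one_right (by positivity) ?_
      rw [div_lt_one (by positivity)]
      nlinarith
    obtain ⟨N1, hN1⟩ := c1 δ hδ
    obtain ⟨N2, hN2⟩ := c2 δ hδ
    refine ⟨max N1 N2, fun m hm k hk => ?_⟩
    have d1 := hN1 m (le_trans (le_max_left _ _) hm) k (le_trans (le_max_left _ _) hk)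
    have d2 := hN2 m (le_trans (le_max_right _ _) hm) k (le_trans (le_max_right _ _) hk)
    rw [dist_eq_norm, ← MemLp.toLp_sub] at d1 d2 ⊢
    have d1' := (sq_lt_sq₀ (norm_nonneg _) hδ.le).2 d1
    have d2' := (sq_lt_sq₀ (norm_nonneg _) hδ.le).2 d2
    refine (sq_lt_sq₀ (norm_nonneg _) hε.le).1 (lt_of_le_of_lt ?_ hδε)
    rw [norm_toLp_sq] at d1' d2' ⊢
    have hgrad : gradient (fun x => f m x - f k x) = gradient (f m) - gradient (f k) := by
      funext x
      refine ext_inner_right ℝ fun v => ?_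
      rw [Pi.sub_apply, inner_sub_left]
      simp only [inner_gradient_eq_fderiv]
      rw [fderiv_fun_sub ((hf m).differentiable (by simp) x) ((hf k).differentiable (by simp) x)]
      simp
    have hb := hbound _ ((hf m).sub (hf k))
    rw [hgrad] at hb
    simp only [Pi.sub_apply, Real.norm_eq_abs, sq_abs] at d1' d2' ⊢ hb
    exact hb.trans (mul_le_mul_of_nonneg_left (add_le_add d1'.le d2'.le) hC)
  obtain ⟨A, hA⟩ := cauchySeq_tendsto_of_complete hcauchy
  have hinj : Function.Injective fun y : Metric.sphere (0 : Space n) 1 => r • (y : Space n) :=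
    fun y z hyz => Subtype.ext (smul_right_injective _ hr.ne' hyz)
  -- The limit lives on the unit sphere; it is carried to radius r, and the value 0 elsewhere plays
  -- no role.
  let g : Space n → ℝ := Function.extend (fun y : Metric.sphere (0 : Space n) 1 => r • (y : Space n)) A 0
  have hgA : ∀ y : Metric.sphere (0 : Space n) 1, g (r • (y : Space n)) = A y := fun y =>
    hinj.extend_apply _ _ y
  have hAm : MemLp A 2 (sphereMeasure n) := Lp.memLp A
  have hal : Tendsto (fun k => eLpNorm (a k - ⇑A) 2 (sphereMeasure n)) atTop (𝓝 0) := by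
    rw [← Lp.tendsto_Lp_iff_tendsto_eLpNorm'' a ha A hAm]
    simpa using hA
  have hconst : ∀ {X : Type} [MeasurableSpace X] {ν : Measure X} {F : Type} [NormedAddCommGroup F]
      (ψ : X → F), Tendsto (fun _ : ℕ => eLpNorm (ψ - ψ) 2 ν) atTop (𝓝 0) := by
    intro X _ ν F _ ψ; simp
  refine ⟨g, ⟨h.memH1, ?_, ?_⟩, ?_⟩
  · simpa only [hgA] using hAm
  · intro ψ hψ v
    have e0 : ∫ x in Metric.ball 0 r, (u x * fderiv ℝ ψ x v +
        inner ℝ (weakGradient (Metric.ball 0 r) u x) v * ψ x) =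
        ∫ x, (u x * fderiv ℝ ψ x v + inner ℝ (G x) v * ψ x) ∂μ := by
      refine integral_congr_ae ?_
      filter_upwards [h.weakGradient_ae_eq Metric.isOpen_ball] with x hx
      rw [hx]
    have m1 : MemLp (fun x => fderiv ℝ ψ x v) 2 μ :=
      hmem ((hψ.continuous_fderiv (by simp)).clm_apply continuous_const) 2
    have m2 : MemLp ψ 2 μ := hmem hψ.continuous 2
    have t1 := tendsto_integral_mul_of_eLpNorm hfm h.memLp (fun _ => m1) m1 hfu (hconst _)
    have t2 := tendsto_integral_mul_of_eLpNorm (fun k => (hgm k).inner_const v)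
      (h.memLp_grad.inner_const v) (fun _ => m2) m2
      (tendsto_eLpNorm_of_le_mul (C := ‖v‖) (fun k => .of_forall fun x => by
        simp only [Pi.sub_apply, ← inner_sub_left]
        exact (norm_inner_le_norm _ _).trans_eq (mul_comm _ _)) hfG) (hconst _)
    have m3 := memLp_sphere_of_continuous (f := fun x => ψ x * inner ℝ v (r⁻¹ • x))
      (hψ.continuous.mul (by fun_prop)) r 2
    have t3 := (tendsto_integral_mul_of_eLpNorm ha hAm (fun _ => m3) m3 hal (hconst _)).const_mul
      (r ^ ((n : ℝ) - 1))
    rw [e0, integral_add (integrable_mul_of_memLp h.memLp m1)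
      (integrable_mul_of_memLp (h.memLp_grad.inner_const v) m2)]
    have e1 : ∀ k, (∫ x, f k x * fderiv ℝ ψ x v ∂μ) + ∫ x, inner ℝ (gradient (f k) x) v * ψ x ∂μ
        = r ^ ((n : ℝ) - 1) * ∫ y : Metric.sphere (0 : Space n) 1, a k y *
          (ψ (r • (y : Space n)) * inner ℝ v (r⁻¹ • r • (y : Space n))) ∂sphereMeasure n := by
      intro k
      rw [← integral_add (integrable_mul_of_memLp (hfm k) m1)
        (integrable_mul_of_memLp ((hgm k).inner_const v) m2), hgreen (f k) (hf k) ψ hψ v, sphereIntegral]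
      simp only [a, mul_assoc]
    have t4 := t1.add t2
    simp only [e1] at t4
    rw [tendsto_nhds_unique t4 t3, sphereIntegral]
    simp only [hgA, mul_assoc]
  · have mx : ∀ {F : Space n → Space n}, MemLp F 2 μ → MemLp (fun x => inner ℝ (F x) x) 2 μ := by
      intro F hF
      refine MemLp.of_le_mul (c := r) hF (hF.1.inner aestronglyMeasurable_id) ?_
      filter_upwards [ae_restrict_mem measurableSet_ball] with x hx
      have hx' : ‖x‖ ≤ r := le_of_lt (by simpa using hx)
      refine (norm_inner_le_norm _ _).trans ?_
      rw [mul_comm]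
      gcongr
    have t1 := tendsto_integral_mul_of_eLpNorm ha hAm ha hAm hal hal
    have t2 := tendsto_integral_mul_of_eLpNorm hfm h.memLp hfm h.memLp hfu hfu
    have t3 := tendsto_integral_mul_of_eLpNorm hfm h.memLp (fun k => mx (hgm k)) (mx h.memLp_grad)
      hfu (tendsto_eLpNorm_of_le_mul (C := r) (fun k => by
        filter_upwards [ae_restrict_mem measurableSet_ball] with x hx
        have hx' : ‖x‖ ≤ r := le_of_lt (by simpa using hx)
        simp only [Pi.sub_apply, ← inner_sub_left]
        refine (norm_inner_le_norm _ _).trans ?_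
        rw [mul_comm]
        gcongr) hfG)
    have e1 : ∀ {w : Space n → ℝ} {F : Space n → Space n}, MemLp w 2 μ → MemLp F 2 μ →
        ∫ x, (n * w x ^ 2 + 2 * (w x * inner ℝ (F x) x)) ∂μ =
          n * (∫ x, w x * w x ∂μ) + 2 * ∫ x, w x * inner ℝ (F x) x ∂μ := by
      intro w F hw hF
      rw [← integral_const_mul, ← integral_const_mul, ← integral_add
        ((integrable_mul_of_memLp hw hw).const_mul _)
        ((integrable_mul_of_memLp hw (mx hF)).const_mul _)]
      simp only [pow_two]
    have t4 := (t2.const_mul (n : ℝ)).add (t3.const_mul 2)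
    have e2 : ∀ k, n * (∫ x, f k x * f k x ∂μ) + 2 * (∫ x, f k x * inner ℝ (gradient (f k) x) x ∂μ)
        = r * (r ^ ((n : ℝ) - 1) * ∫ y, a k y * a k y ∂sphereMeasure n) := by
      intro k
      rw [← e1 (hfm k) (hgm k), ← hsq _ (hf k), sphereIntegral]
      simp only [a, pow_two]
    simp only [e2] at t4
    rw [e1 h.memLp h.memLp_grad, ← tendsto_nhds_unique ((t1.const_mul _).const_mul r) t4,
      sphereIntegral]
    simp only [hgA, pow_two]

/-- Replaces the boundary term of the Weiss energy by a volume integral of the divergence of x u²,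
so that traces play no part in the computation of increments. -/
theorem mul_sphereIntegral_sphereTrace_sq (hn : 1 ≤ n) {r : ℝ} (hr : 0 < r) {u : Space n → ℝ}
    {G : Space n → Space n} (h : HasWeakGradient (Metric.ball 0 r) u G) :
    r * sphereIntegral r (fun x => sphereTrace u r x ^ 2) =
      ∫ x in Metric.ball 0 r, (n * u x ^ 2 + 2 * (u x * inner ℝ (G x) x)) := by
  obtain ⟨g, hg, hgs⟩ := exists_sphereTrace hn hr h
  have h1 : ∃ g, IsSphereTrace u r g := ⟨g, hg⟩
  have h2 : IsSphereTrace u r (sphereTrace u r) := by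
    rw [sphereTrace, dif_pos h1]
    exact h1.choose_spec
  rw [← hgs, sphereIntegral, sphereIntegral]
  congr 2
  refine integral_congr_ae ?_
  filter_upwards [h2.ae_unique hr hg] with y hy
  rw [hy]

end AltPhillips

namespace AltPhillips

variable {n : ℕ}

/-! ### The energy and a competitor of finite energy -/

theorem tendsto_eLpNorm_of_dominated {X F : Type*} [MeasurableSpace X] {μ : Measure X}
    [NormedAddCommGroup F] {f : ℕ → X → F} {f₀ : X → F} {b : X → ℝ}
    (hf : ∀ k, AEStronglyMeasurable (f k) μ) (hf₀ : AEStronglyMeasurable f₀ μ) (hb : MemLp b 2 μ)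
    (hle : ∀ k, ∀ᵐ x ∂μ, ‖f k x - f₀ x‖ ≤ b x)
    (hlim : ∀ᵐ x ∂μ, Tendsto (fun k => f k x) atTop (𝓝 (f₀ x))) :
    Tendsto (fun k => eLpNorm (f k - f₀) 2 μ) atTop (𝓝 0) := by
  rw [tendsto_eLpNorm_two_iff, ← lintegral_zero (μ := μ)]
  refine tendsto_lintegral_of_dominated_convergence' (fun x => ‖b x‖ₑ ^ 2)
    (fun k => ((hf k).sub hf₀).enorm.pow_const 2) (fun k => ?_) ?_ ?_
  · filter_upwards [hle k] with x hx
    gcongr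
    rw [Pi.sub_apply, ← ofReal_norm, ← ofReal_norm]
    exact ENNReal.ofReal_le_ofReal (hx.trans (le_abs_self _))
  · rw [← eLpNorm_two_sq]
    exact ENNReal.pow_ne_top hb.eLpNorm_ne_top
  · filter_upwards [hlim] with x hx
    have h1 := (hx.sub_const (f₀ x)).enorm
    simp only [sub_self, enorm_zero] at h1
    simpa using ENNReal.Tendsto.pow (n := 2) h1

theorem measurable_potential (γ : ℝ) : Measurable (potential γ) := by
  unfold potential
  exact Measurable.ite measurableSet_Ioi ((measurable_id.pow_const _).const_mul _) measurable_const

theorem potential_nonneg {γ : ℝ} (hγ : 0 ≤ γ) (t : ℝ) : 0 ≤ potential γ t := by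
  unfold potential
  split_ifs with h
  · positivity
  · exact le_rfl

theorem potential_mul {γ : ℝ} {s : ℝ} (hs : 0 < s) (t : ℝ) :
    potential γ (s * t) = s ^ (-γ) * potential γ t := by
  unfold potential
  by_cases h : 0 < t
  · rw [if_pos h, if_pos (mul_pos hs h), Real.mul_rpow hs.le h.le]; ring
  · rw [if_neg h, if_neg fun h' => h (pos_of_mul_pos_right h' hs.le), mul_zero]

/-- Positivity of s is essential: the potential drops to 0 on t ≤ 0, so it is not monotone on the
whole line. This is why the competitor below must be bounded below by a positive function. -/
theorem potential_le_of_le {γ : ℝ} (hγ : 0 < γ) {s t : ℝ} (hs : 0 < s) (hst : s ≤ t) :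
    potential γ t ≤ potential γ s := by
  rw [potential, potential, if_pos hs, if_pos (hs.trans_le hst)]
  have := Real.rpow_le_rpow_of_nonpos hs hst (neg_nonpos.2 hγ.le)
  gcongr

theorem HasWeakGradient.energy_eq {Ω : Set (Space n)} (hΩ : IsOpen Ω) {u : Space n → ℝ}
    {G : Space n → Space n} (h : HasWeakGradient Ω u G) (γ : ℝ) :
    energy γ u Ω = ∫⁻ x in Ω, ENNReal.ofReal ((1 / 2) * ‖G x‖ ^ 2 + potential γ (u x)) := by
  refine lintegral_congr_ae ?_
  filter_upwards [h.weakGradient_ae_eq hΩ] with x hx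
  rw [hx]

theorem memH10_of_tendsto {Ω : Set (Space n)} (hΩ : IsOpen Ω) {w : Space n → ℝ}
    {G : Space n → Space n} (hw : HasWeakGradient Ω w G) {φ : ℕ → Space n → ℝ}
    (hφ : ∀ k, IsTestFunction Ω (φ k))
    (h1 : Tendsto (fun k => eLpNorm (φ k - w) 2 (volume.restrict Ω)) atTop (𝓝 0))
    (h2 : Tendsto (fun k => eLpNorm (gradient (φ k) - G) 2 (volume.restrict Ω)) atTop (𝓝 0)) :
    MemH10 Ω w := by
  refine ⟨hw.memH1, φ, hφ, h1, h2.congr fun k => eLpNorm_congr_ae ?_⟩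
  filter_upwards [hw.weakGradient_ae_eq hΩ] with x hx
  rw [Pi.sub_apply, hx]

/-- In polar coordinates R² - ρ² = (R + ρ)(R - ρ), and only the second factor degenerates, at one
endpoint. -/
theorem integrableOn_sub_norm_sq_rpow (hn : 1 ≤ n) {R : ℝ} (hR : 0 < R) {q : ℝ} (hq : -1 < q) :
    IntegrableOn (fun x : Space n => (R ^ 2 - ‖x‖ ^ 2) ^ q) (Metric.ball 0 R) := by
  have : Nonempty (Fin n) := ⟨⟨0, hn⟩⟩
  rw [integrableOn_fun_norm_addHaar volume (f := fun ρ => (R ^ 2 - ρ ^ 2) ^ q)]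
  have h1 : IntegrableOn (fun ρ : ℝ => (R - ρ) ^ q) (Ioo 0 R) := by
    have := (intervalIntegral.intervalIntegrable_rpow' hq (a := R) (b := 0)).comp_sub_left R
    simp only [sub_self, sub_zero] at this
    exact ((intervalIntegrable_iff_integrableOn_Ioc_of_le hR.le).1 this).mono_set Ioo_subset_Ioc_self
  have hc : ContinuousOn (fun ρ : ℝ => ρ ^ (n - 1) * (R + ρ) ^ q) (Icc 0 R) := by
    intro ρ hρ
    refine ContinuousAt.continuousWithinAt (ContinuousAt.mul (by fun_prop) ?_)
    exact ContinuousAt.rpow_const (by fun_prop) (Or.inl (by linarith [hρ.1]))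
  obtain ⟨C, hC⟩ := isCompact_Icc.exists_bound_of_continuousOn hc
  have h2 : IntegrableOn (fun ρ : ℝ => (ρ ^ (n - 1) * (R + ρ) ^ q) * (R - ρ) ^ q) (Ioo 0 R) := by
    refine Integrable.bdd_mul (c := C) h1 ?_ ?_
    · exact (hc.mono Ioo_subset_Icc_self).aestronglyMeasurable measurableSet_Ioo
    · filter_upwards [ae_restrict_mem measurableSet_Ioo] with ρ hρ
      exact hC ρ ⟨hρ.1.le, hρ.2.le⟩
  refine h2.congr_fun (fun ρ hρ => ?_) measurableSet_Ioo
  simp only [finrank_euclideanSpace, Fintype.card_fin, smul_eq_mul]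
  rw [show R ^ 2 - ρ ^ 2 = (R + ρ) * (R - ρ) by ring,
    Real.mul_rpow (by linarith [hρ.1]) (by linarith [hρ.2])]
  ring

set_option maxHeartbeats 1000000 in
/-- The function `(R² - |x|²)^β` lies in `H¹₀(B_R)` for `β > 1/2`. -/
theorem sub_norm_sq_rpow_mem (hn : 1 ≤ n) {R : ℝ} (hR : 0 < R) {β : ℝ} (hβ : 1 / 2 < β) :
    MemH10 (Metric.ball 0 R) fun x : Space n => (R ^ 2 - ‖x‖ ^ 2) ^ β := by
  set B := Metric.ball (0 : Space n) R
  have hβ0 : 0 < β := by linarith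
  set χ : ℝ → ℝ := fun t => -(β * (R ^ 2 - t) ^ (β - 1))
  have hχ : ContDiffOn ℝ ∞ χ (Ioo (-1) (R ^ 2)) := by
    intro t ht
    refine ContDiffAt.contDiffWithinAt (ContDiffAt.neg (contDiffAt_const.mul ?_))
    exact ContDiffAt.rpow_const_of_ne (by fun_prop) (sub_pos.2 ht.2).ne'
  have hii : ∀ t ≤ R ^ 2, IntervalIntegrable (fun s : ℝ => (R ^ 2 - s) ^ (β - 1)) volume t (R ^ 2) := by
    intro t ht
    have := (intervalIntegral.intervalIntegrable_rpow' (show -1 < β - 1 by linarith)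
      (a := R ^ 2 - t) (b := 0)).comp_sub_left (R ^ 2)
    simpa using this
  have hi : IntegrableOn χ (Ioo (-1) (R ^ 2)) := by
    have hle : (-1 : ℝ) ≤ R ^ 2 := by nlinarith
    exact ((((intervalIntegrable_iff_integrableOn_Ioc_of_le hle).1 (hii _ hle)).mono_set
      Ioo_subset_Ioc_self).const_mul β).neg
  have hZ : ∀ x ∈ B, -∫ s in Ioo (-1) (R ^ 2) ∩ Ioi (‖x‖ ^ 2), χ s = (R ^ 2 - ‖x‖ ^ 2) ^ β := by
    intro x hx
    have hx' : ‖x‖ < R := by simpa [B] using hx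
    have hx2 : ‖x‖ ^ 2 < R ^ 2 := by gcongr
    have hx0 : 0 ≤ ‖x‖ ^ 2 := by positivity
    have e1 : Ioo (-1) (R ^ 2) ∩ Ioi (‖x‖ ^ 2) = Ioo (‖x‖ ^ 2) (R ^ 2) := by
      ext s; simp only [mem_inter_iff, mem_Ioo, mem_Ioi]
      constructor
      · rintro ⟨⟨_, h⟩, h'⟩; exact ⟨h', h⟩
      · rintro ⟨h, h'⟩; exact ⟨⟨by linarith, h'⟩, h⟩
    rw [e1, ← integral_Ioc_eq_integral_Ioo, ← intervalIntegral.integral_of_le hx2.le]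
    simp only [χ]
    rw [intervalIntegral.integral_neg, neg_neg, intervalIntegral.integral_const_mul,
      intervalIntegral.integral_comp_sub_left (fun s => s ^ (β - 1)), sub_self,
      integral_rpow (Or.inl (by linarith))]
    rw [sub_add_cancel, Real.zero_rpow hβ0.ne']
    field_simp
    ring
  obtain ⟨ζ, z1, z2, z3, z4, z5, z6⟩ := exists_smooth_primitive_approx hχ hi
  have hfin : IsFiniteMeasure (volume.restrict B) := ⟨by simpa [B] using measure_ball_lt_top⟩
  have hmem : ∀ x ∈ B, ‖x‖ ^ 2 ∈ Ioo (-1) (R ^ 2) := by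
    intro x hx
    have hx' : ‖x‖ < R := by simpa [B] using hx
    exact ⟨by linarith [sq_nonneg ‖x‖], by gcongr⟩
  set w : Space n → ℝ := fun x => (R ^ 2 - ‖x‖ ^ 2) ^ β
  set G : Space n → Space n := fun x => (2 * χ (‖x‖ ^ 2)) • x
  have hwm : Measurable w := by fun_prop
  have hGm : Measurable G := by fun_prop
  -- This is where β > 1/2 enters: the squared gradient is of order (R² - |x|²)^(2(β-1)), with
  -- exponent above -1.
  have hb1 : MemLp (fun x : Space n => (R ^ 2 - ‖x‖ ^ 2) ^ (β - 1)) 2 (volume.restrict B) := by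
    rw [memLp_two_iff_integrable_sq (Measurable.aestronglyMeasurable (by fun_prop))]
    refine (integrableOn_sub_norm_sq_rpow hn hR (show -1 < (β - 1) * 2 by linarith)).congr_fun
      (fun x hx => ?_) measurableSet_ball
    simp only
    rw [Real.rpow_mul (sub_pos.2 (hmem x hx).2).le]; norm_num
  have hχx : ∀ x ∈ B, |χ (‖x‖ ^ 2)| = β * (R ^ 2 - ‖x‖ ^ 2) ^ (β - 1) := by
    intro x hx
    have := Real.rpow_nonneg (sub_pos.2 (hmem x hx).2).le (β - 1)
    simp only [χ]
    rw [abs_neg, abs_of_nonneg (by positivity)]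
  have hGb : ∀ x ∈ B, ‖G x‖ ≤ 2 * β * R * (R ^ 2 - ‖x‖ ^ 2) ^ (β - 1) := by
    intro x hx
    have hx' : ‖x‖ ≤ R := le_of_lt (by simpa [B] using hx)
    have := Real.rpow_nonneg (sub_pos.2 (hmem x hx).2).le (β - 1)
    simp only [G]
    rw [norm_smul, Real.norm_eq_abs, abs_mul, hχx x hx, abs_two]
    calc 2 * (β * (R ^ 2 - ‖x‖ ^ 2) ^ (β - 1)) * ‖x‖
        ≤ 2 * (β * (R ^ 2 - ‖x‖ ^ 2) ^ (β - 1)) * R := by gcongr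
      _ = _ := by ring
  have hgrad : ∀ k x, gradient (fun x : Space n => ζ k (‖x‖ ^ 2)) x
      = (2 * deriv (ζ k) (‖x‖ ^ 2)) • x := by
    intro k x
    refine ext_inner_right ℝ fun v => ?_
    rw [inner_gradient_eq_fderiv, (hasFDerivAt_comp_norm_sq (z1 k) x).fderiv]
    simp [inner_smul_left]
  have ht : ∀ k, IsTestFunction B fun x : Space n => ζ k (‖x‖ ^ 2) := fun k =>
    isTestFunction_comp_norm_sq hR (z1 k) (z2 k)
  have hwL : MemLp w 2 (volume.restrict B) := by
    refine MemLp.of_bound hwm.aestronglyMeasurable ((R ^ 2) ^ β) ?_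
    filter_upwards [ae_restrict_mem measurableSet_ball] with x hx
    have h0 : 0 ≤ R ^ 2 - ‖x‖ ^ 2 := (sub_pos.2 (hmem x hx).2).le
    rw [Real.norm_eq_abs, abs_of_nonneg (Real.rpow_nonneg h0 _)]
    exact Real.rpow_le_rpow h0 (by linarith [sq_nonneg ‖x‖]) hβ0.le
  have hGL : MemLp G 2 (volume.restrict B) := by
    refine MemLp.of_le_mul (c := 2 * β * R) hb1 hGm.aestronglyMeasurable ?_
    filter_upwards [ae_restrict_mem measurableSet_ball] with x hx
    exact (hGb x hx).trans (by gcongr; exact le_abs_self _)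
  have l1 : Tendsto (fun k => eLpNorm ((fun x => ζ k (‖x‖ ^ 2)) - w) 2 (volume.restrict B)) atTop
      (𝓝 0) := by
    have hbd : ∀ C : ℝ, MemLp (fun x => C + ‖w x‖) 2 (volume.restrict B) := fun C =>
      MemLp.add (memLp_const C) hwL.norm
    refine tendsto_eLpNorm_of_dominated (b := fun x => (∫ s in Ioo (-1) (R ^ 2), |χ s|) + ‖w x‖)
      (fun k => (ht k).smooth.continuous.aestronglyMeasurable) hwm.aestronglyMeasurable
      (hbd _) (fun k => .of_forall fun x => ?_) ?_
    · exact (norm_sub_le _ _).trans (add_le_add (z3 k _) le_rfl)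
    · filter_upwards [ae_restrict_mem measurableSet_ball] with x hx
      have := z5 (‖x‖ ^ 2)
      rwa [hZ x hx] at this
  have l2 : Tendsto (fun k => eLpNorm (gradient (fun x : Space n => ζ k (‖x‖ ^ 2)) - G) 2
      (volume.restrict B)) atTop (𝓝 0) := by
    refine tendsto_eLpNorm_of_dominated (b := fun x => ‖G x‖ + ‖G x‖)
      (fun k => (continuous_gradient (ht k).smooth).aestronglyMeasurable) hGm.aestronglyMeasurable
      (hGL.norm.add hGL.norm) (fun k => ?_) ?_
    · filter_upwards with x
      refine (norm_sub_le _ _).trans (add_le_add ?_ le_rfl)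
      rw [hgrad]
      simp only [G]
      rw [norm_smul, norm_smul, norm_mul, norm_mul]
      gcongr
      refine (z4 k _).trans ?_
      exact norm_indicator_le_norm_self χ (‖x‖ ^ 2)
    · filter_upwards [ae_restrict_mem measurableSet_ball] with x hx
      simp only [hgrad]
      have := z6 (‖x‖ ^ 2)
      rw [indicator_of_mem (hmem x hx)] at this
      exact (this.const_mul 2).smul_const x
  have hW : HasWeakGradient B w G := hasWeakGradient_of_tendsto
    (fun k => hasWeakGradient_of_contDiff (ht k).smooth measurableSet_ball Metric.isBounded_ball)
    hwL hGL l1 l2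
  exact memH10_of_tendsto Metric.isOpen_ball hW ht l1 l2

/-- Compare with u + w, w = (R² - |x|²)^β. Square integrability of ∇w needs β > 1/2, while the
potential of u + w is at most w^(-γ)/γ, integrable when βγ < 1. The two conditions are compatible
because γ < 2. -/
theorem IsMinimizer.energy_ne_top (hn : 1 ≤ n) {γ : ℝ} (hγ : γ ∈ Ioo (0 : ℝ) 2) {R : ℝ}
    (hR : 0 < R) {u : Space n → ℝ} (hu : IsMinimizer γ u (Metric.ball 0 R)) :
    energy γ u (Metric.ball 0 R) ≠ ⊤ := by
  obtain ⟨β, hβ1, hβ2⟩ : ∃ β, 1 / 2 < β ∧ β < 1 / γ :=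
    exists_between (one_div_lt_one_div_of_lt hγ.1 hγ.2)
  set B := Metric.ball (0 : Space n) R
  set w : Space n → ℝ := fun x => (R ^ 2 - ‖x‖ ^ 2) ^ β
  have hw : MemH10 B w := sub_norm_sq_rpow_mem hn hR hβ1
  have hv := hu.memH1.hasWeakGradient.add hw.1.hasWeakGradient
  set v : Space n → ℝ := fun x => u x + w x
  have hpos : ∀ x ∈ B, 0 < R ^ 2 - ‖x‖ ^ 2 := by
    intro x hx
    have hx' : ‖x‖ < R := by simpa [B] using hx
    exact sub_pos.2 (by gcongr)
  have hw0 : ∀ x ∈ B, 0 < w x := fun x hx => Real.rpow_pos_of_pos (hpos x hx) _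
  have hle := hu.le_energy v hv.memH1 (by
    filter_upwards [hu.nonneg, ae_restrict_mem measurableSet_ball] with x h1 h2
    exact add_nonneg h1 (hw0 x h2).le) (by simpa [v] using hw)
  refine ne_top_of_le_ne_top ?_ hle
  rw [hv.energy_eq Metric.isOpen_ball]
  have i1 : IntegrableOn (fun x => (1 / 2) * ‖weakGradient B u x + weakGradient B w x‖ ^ 2) B :=
    (hv.memLp_grad.norm.integrable_sq).const_mul _
  have i2 : IntegrableOn (fun x : Space n => (1 / γ) * (R ^ 2 - ‖x‖ ^ 2) ^ (-(β * γ))) B := by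
    refine (integrableOn_sub_norm_sq_rpow hn hR ?_).const_mul _
    have := (lt_div_iff₀ hγ.1).1 hβ2
    linarith
  refine ne_of_lt (lt_of_le_of_lt (lintegral_mono_ae ?_) (i1.add i2).lintegral_lt_top)
  filter_upwards [hu.nonneg, ae_restrict_mem measurableSet_ball] with x h1 h2
  refine ENNReal.ofReal_le_ofReal (add_le_add le_rfl ?_)
  refine (potential_le_of_le hγ.1 (hw0 x h2) (le_add_of_nonneg_left h1)).trans ?_
  rw [potential, if_pos (hw0 x h2), ← Real.rpow_mul (hpos x h2).le, mul_neg]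

end AltPhillips

namespace AltPhillips

variable {n : ℕ}

/-! ### Radial diffeomorphisms -/

/-- The map `y ↦ exp(ζ(|y|²)) y`. -/
noncomputable def radialMap (n : ℕ) (ζ : ℝ → ℝ) (y : Space n) : Space n :=
  Real.exp (ζ (‖y‖ ^ 2)) • y

/-- Profiles `ζ` supported below `R²` for which `y ↦ exp(ζ(|y|²)) y` is a diffeomorphism. -/
structure IsRadialProfile (R : ℝ) (ζ : ℝ → ℝ) : Prop where
  smooth : ContDiff ℝ ∞ ζ
  support : ∃ b < R ^ 2, ∀ t, b ≤ t → ζ t = 0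
  small : ∀ t, 0 ≤ t → 0 < 1 + 2 * deriv ζ t * t

/-- The inverse of `radialMap`. -/
noncomputable def radialInv (n : ℕ) (ζ : ℝ → ℝ) : Space n → Space n :=
  Function.invFun (radialMap n ζ)

/-- The derivative of `radialMap`. -/
noncomputable def radialDeriv (ζ : ℝ → ℝ) (y : Space n) : Space n →L[ℝ] Space n :=
  Real.exp (ζ (‖y‖ ^ 2)) • (ContinuousLinearMap.id ℝ (Space n) +
    (2 * deriv ζ (‖y‖ ^ 2)) • (innerSL ℝ y).smulRight y)

namespace IsRadialProfile

variable {R : ℝ} {ζ : ℝ → ℝ}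

theorem hasDerivAt_profile (h : IsRadialProfile R ζ) (ρ : ℝ) :
    HasDerivAt (fun ρ : ℝ => Real.exp (ζ (ρ ^ 2)) * ρ)
      (Real.exp (ζ (ρ ^ 2)) * (1 + 2 * deriv ζ (ρ ^ 2) * ρ ^ 2)) ρ := by
  have h1 : HasDerivAt ζ (deriv ζ (ρ ^ 2)) (ρ ^ 2) :=
    (h.smooth.differentiable (by simp) _).hasDerivAt
  have h0 : HasDerivAt (fun ρ : ℝ => ρ ^ 2) (2 * ρ) ρ := by simpa using hasDerivAt_pow 2 ρ
  have h2 : HasDerivAt (fun ρ : ℝ => ζ (ρ ^ 2)) (deriv ζ (ρ ^ 2) * (2 * ρ)) ρ :=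
    HasDerivAt.comp (h₂ := ζ) (h := fun ρ => ρ ^ 2) ρ h1 h0
  refine (h2.exp.mul (hasDerivAt_id ρ)).congr_deriv ?_
  simp
  ring

theorem strictMono_profile (h : IsRadialProfile R ζ) :
    StrictMono fun ρ : ℝ => Real.exp (ζ (ρ ^ 2)) * ρ :=
  strictMono_of_hasDerivAt_pos h.hasDerivAt_profile fun ρ =>
    mul_pos (Real.exp_pos _) (h.small _ (sq_nonneg ρ))

theorem surjective_profile (h : IsRadialProfile R ζ) :
    Function.Surjective fun ρ : ℝ => Real.exp (ζ (ρ ^ 2)) * ρ := by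
  obtain ⟨b, -, hb⟩ := h.support
  -- The maximum with 1 ensures ρ² ≥ |ρ| ≥ b. The profile is thus the identity near ±∞, hence onto.
  have key : ∀ ρ : ℝ, max 1 b ≤ |ρ| → Real.exp (ζ (ρ ^ 2)) * ρ = ρ := by
    intro ρ hρ
    have h1 : 1 ≤ |ρ| := (le_max_left _ _).trans hρ
    have h2 : b ≤ |ρ| := (le_max_right _ _).trans hρ
    rw [hb _ (by rw [← sq_abs]; nlinarith), Real.exp_zero, one_mul]
  have hc : Continuous fun ρ : ℝ => Real.exp (ζ (ρ ^ 2)) * ρ := by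
    have := h.smooth.continuous; fun_prop
  refine hc.surjective ?_ ?_
  · refine tendsto_id.congr' ?_
    filter_upwards [eventually_ge_atTop (max 1 b)] with ρ hρ
    exact (key ρ (hρ.trans (le_abs_self ρ))).symm
  · refine tendsto_id.congr' ?_
    filter_upwards [eventually_le_atBot (-max 1 b)] with ρ hρ
    exact (key ρ (by linarith [neg_le_abs ρ])).symm

theorem norm_radialMap (ζ : ℝ → ℝ) (y : Space n) :
    ‖radialMap n ζ y‖ = Real.exp (ζ (‖y‖ ^ 2)) * ‖y‖ := by
  rw [radialMap, norm_smul, Real.norm_eq_abs, abs_of_pos (Real.exp_pos _)]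

theorem injective (h : IsRadialProfile R ζ) : Function.Injective (radialMap n ζ) := by
  intro y z hyz
  have h1 : ‖y‖ = ‖z‖ := by
    apply h.strictMono_profile.injective
    simp only [← norm_radialMap, hyz]
  rw [radialMap, radialMap, h1] at hyz
  exact smul_right_injective _ (Real.exp_pos _).ne' hyz

theorem surjective (h : IsRadialProfile R ζ) : Function.Surjective (radialMap n ζ) := by
  intro x
  by_cases hx : x = 0
  · exact ⟨0, by simp [radialMap, hx]⟩
  obtain ⟨ρ, hρ⟩ := h.surjective_profile ‖x‖
  have hx' : 0 < ‖x‖ := norm_pos_iff.2 hx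
  have hρ0 : 0 < ρ := by
    have : Real.exp (ζ (ρ ^ 2)) * ρ = ‖x‖ := hρ
    exact pos_of_mul_pos_right (this ▸ hx') (Real.exp_pos _).le
  have hn : ‖(ρ / ‖x‖) • x‖ = ρ := by
    rw [norm_smul, Real.norm_eq_abs, abs_of_pos (by positivity)]
    field_simp
  refine ⟨(ρ / ‖x‖) • x, ?_⟩
  rw [radialMap, hn, smul_smul, ← mul_div_assoc]
  simp only at hρ
  rw [hρ, div_self hx'.ne', one_smul]

theorem inv_map (h : IsRadialProfile R ζ) (y : Space n) : radialInv n ζ (radialMap n ζ y) = y :=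
  Function.leftInverse_invFun h.injective y

theorem map_inv (h : IsRadialProfile R ζ) (x : Space n) : radialMap n ζ (radialInv n ζ x) = x :=
  Function.rightInverse_invFun h.surjective x

theorem map_eq_self {b : ℝ} (hb : ∀ t, b ≤ t → ζ t = 0) {y : Space n} (hy : b ≤ ‖y‖ ^ 2) :
    radialMap n ζ y = y := by
  rw [radialMap, hb _ hy, Real.exp_zero, one_smul]

theorem inv_eq_self (h : IsRadialProfile R ζ) {b : ℝ} (hb : ∀ t, b ≤ t → ζ t = 0) {x : Space n}
    (hx : b ≤ ‖x‖ ^ 2) : radialInv n ζ x = x := by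
  conv_lhs => rw [← map_eq_self hb hx]
  exact h.inv_map x

theorem map_mem_ball (h : IsRadialProfile R ζ) {y : Space n} :
    radialMap n ζ y ∈ Metric.ball 0 R ↔ y ∈ Metric.ball 0 R := by
  obtain ⟨b, hb, h0⟩ := h.support
  have hRR : Real.exp (ζ (R ^ 2)) * R = R := by rw [h0 _ hb.le, Real.exp_zero, one_mul]
  rw [mem_ball_zero_iff, mem_ball_zero_iff, norm_radialMap]
  conv_lhs => rw [← hRR]
  exact h.strictMono_profile.lt_iff_lt (a := ‖y‖) (b := R)

theorem image_ball (h : IsRadialProfile R ζ) :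
    radialMap n ζ '' Metric.ball 0 R = Metric.ball 0 R := by
  ext x
  constructor
  · rintro ⟨y, hy, rfl⟩
    exact (h.map_mem_ball).2 hy
  · intro hx
    refine ⟨radialInv n ζ x, ?_, h.map_inv x⟩
    rw [← h.map_mem_ball, h.map_inv]
    exact hx

theorem contDiff_map (h : IsRadialProfile R ζ) : ContDiff ℝ ∞ (radialMap n ζ) :=
  (contDiff_comp_norm_sq h.smooth).exp.smul contDiff_id

theorem hasFDerivAt (h : IsRadialProfile R ζ) (y : Space n) :
    HasFDerivAt (radialMap n ζ) (radialDeriv ζ y) y := by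
  have h1 := ((hasFDerivAt_comp_norm_sq h.smooth y).exp).smul (hasFDerivAt_id y)
  refine h1.congr_fderiv ?_
  ext v
  simp [radialDeriv, smul_smul, mul_comm]

/-- Up to a scalar the derivative is the identity plus the rank-one map v ↦ c (y·v) y, whose
determinant is 1 + c|y|². -/
theorem det_radialDeriv (ζ : ℝ → ℝ) (y : Space n) : (radialDeriv ζ y).det =
    Real.exp (n * ζ (‖y‖ ^ 2)) * (1 + 2 * deriv ζ (‖y‖ ^ 2) * ‖y‖ ^ 2) := by
  have h1 : ((radialDeriv ζ y : Space n →L[ℝ] Space n) : Space n →ₗ[ℝ] Space n) =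
      Real.exp (ζ (‖y‖ ^ 2)) • LinearMap.transvection
        ((2 * deriv ζ (‖y‖ ^ 2)) • (innerSL ℝ y : Space n →ₗ[ℝ] ℝ)) y := by
    ext v
    simp [radialDeriv, LinearMap.transvection, smul_smul]
    left; ring
  rw [ContinuousLinearMap.det, h1, LinearMap.det_smul, LinearMap.transvection.det]
  simp [← Real.exp_nat_mul]

theorem det_pos (h : IsRadialProfile R ζ) (y : Space n) : 0 < (radialDeriv ζ y).det := by
  rw [det_radialDeriv]
  exact mul_pos (Real.exp_pos _) (h.small _ (sq_nonneg _))

/-- The derivative is invertible everywhere, so the inverse function theorem gives smooth local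
inverses, and a global left inverse must agree with them. -/
theorem contDiff_inv (h : IsRadialProfile R ζ) : ContDiff ℝ ∞ (radialInv n ζ) := by
  rw [contDiff_iff_contDiffAt]
  intro x
  obtain ⟨y, rfl⟩ := h.surjective x
  set E := (radialDeriv ζ y).toContinuousLinearEquivOfDetNeZero (h.det_pos y).ne'
  have hE : HasFDerivAt (radialMap n ζ) (E : Space n →L[ℝ] Space n) y := h.hasFDerivAt y
  have h1 : ContDiffAt ℝ ∞ (radialMap n ζ) y := h.contDiff_map.contDiffAt
  refine (h1.to_localInverse hE (by simp)).congr_of_eventuallyEq ?_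
  exact (h1.hasStrictFDerivAt' hE (by simp)).localInverse_unique (.of_forall h.inv_map)

/-- Change of variables. -/
theorem lintegral_ball (h : IsRadialProfile R ζ) (F : Space n → ℝ≥0∞) :
    ∫⁻ x in Metric.ball 0 R, F x = ∫⁻ y in Metric.ball 0 R,
      ENNReal.ofReal (radialDeriv ζ y).det * F (radialMap n ζ y) := by
  conv_lhs => rw [← h.image_ball]
  rw [lintegral_image_eq_lintegral_abs_det_fderiv_mul volume measurableSet_ball
    (fun y _ => (h.hasFDerivAt y).hasFDerivWithinAt) h.injective.injOn]
  simp only [abs_of_pos (h.det_pos _)]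

theorem exists_det_le (h : IsRadialProfile R ζ) :
    ∃ C : ℝ, ∀ y ∈ Metric.ball (0 : Space n) R, (radialDeriv ζ y).det ≤ C := by
  have hc : Continuous fun y : Space n =>
      Real.exp (n * ζ (‖y‖ ^ 2)) * (1 + 2 * deriv ζ (‖y‖ ^ 2) * ‖y‖ ^ 2) := by
    have h1 := h.smooth.continuous
    have h2 := h.smooth.continuous_deriv (by simp)
    fun_prop
  obtain ⟨C, hC⟩ := (isCompact_closedBall (0 : Space n) R).exists_bound_of_continuousOn
    hc.continuousOn
  refine ⟨C, fun y hy => ?_⟩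
  rw [det_radialDeriv]
  exact (le_abs_self _).trans (hC y (Metric.ball_subset_closedBall hy))

variable {F : Type*} [NormedAddCommGroup F]

theorem tendsto_eLpNorm_comp_inv (h : IsRadialProfile R ζ) {f : ℕ → Space n → F}
    (hf : Tendsto (fun k => eLpNorm (f k) 2 (volume.restrict (Metric.ball 0 R))) atTop (𝓝 0)) :
    Tendsto (fun k => eLpNorm (fun x => f k (radialInv n ζ x)) 2
      (volume.restrict (Metric.ball 0 R))) atTop (𝓝 0) := by
  obtain ⟨C, hC⟩ := h.exists_det_le (n := n)
  rw [tendsto_eLpNorm_two_iff] at hf ⊢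
  have h1 : Tendsto (fun k => ENNReal.ofReal C * ∫⁻ x in Metric.ball 0 R, ‖f k x‖ₑ ^ 2) atTop
      (𝓝 0) := by
    simpa using ENNReal.Tendsto.const_mul hf (Or.inr (by simp))
  refine tendsto_of_tendsto_of_tendsto_of_le_of_le tendsto_const_nhds h1 (fun _ => zero_le)
    (fun k => ?_)
  simp only
  rw [h.lintegral_ball, ← lintegral_const_mul' _ _ (by simp)]
  refine setLIntegral_mono' measurableSet_ball fun y hy => ?_
  rw [h.inv_map]
  gcongr
  exact hC y hy

/-- Strong measurability is asked everywhere, not just almost everywhere, so that composition with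
the inverse map is plainly measurable. Minimizers are later replaced by such representatives. -/
theorem memLp_comp_inv (h : IsRadialProfile R ζ) {f : Space n → F}
    (hfm : StronglyMeasurable f) (hf : MemLp f 2 (volume.restrict (Metric.ball 0 R))) :
    MemLp (fun x => f (radialInv n ζ x)) 2 (volume.restrict (Metric.ball 0 R)) := by
  obtain ⟨C, hC⟩ := h.exists_det_le (n := n)
  refine ⟨(hfm.comp_measurable h.contDiff_inv.continuous.measurable).aestronglyMeasurable, ?_⟩
  have h1 : eLpNorm (fun x => f (radialInv n ζ x)) 2 (volume.restrict (Metric.ball 0 R)) ^ 2 ≤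
      ENNReal.ofReal C * eLpNorm f 2 (volume.restrict (Metric.ball 0 R)) ^ 2 := by
    rw [eLpNorm_two_sq, eLpNorm_two_sq, h.lintegral_ball, ← lintegral_const_mul' _ _ (by simp)]
    refine setLIntegral_mono' measurableSet_ball fun y hy => ?_
    rw [h.inv_map]
    gcongr
    exact hC y hy
  have h2 : ENNReal.ofReal C * eLpNorm f 2 (volume.restrict (Metric.ball 0 R)) ^ 2 < ⊤ :=
    ENNReal.mul_lt_top (by simp) (ENNReal.pow_lt_top hf.2)
  have h3 := h1.trans_lt h2
  by_contra h4
  rw [not_lt, top_le_iff] at h4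
  rw [h4] at h3
  simp at h3

end IsRadialProfile

end AltPhillips

namespace AltPhillips

variable {n : ℕ}

/-! ### Radial deformations of Sobolev functions -/

theorem MemH10.congr {Ω : Set (Space n)} (hΩ : IsOpen Ω) {w w' : Space n → ℝ} (h : MemH10 Ω w)
    (hw : w =ᵐ[volume.restrict Ω] w') : MemH10 Ω w' := by
  obtain ⟨h1, φ, hφ, h2, h3⟩ := h
  refine memH10_of_tendsto hΩ (h1.hasWeakGradient.congr hw (ae_eq_refl _)) hφ ?_ h3
  refine h2.congr fun k => eLpNorm_congr_ae ?_
  filter_upwards [hw] with x hx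
  rw [Pi.sub_apply, hx]

theorem IsMinimizer.congr {γ : ℝ} {Ω : Set (Space n)} (hΩ : IsOpen Ω) {u u' : Space n → ℝ}
    (h : IsMinimizer γ u Ω) (hu : u =ᵐ[volume.restrict Ω] u') : IsMinimizer γ u' Ω := by
  have h1 := h.memH1.hasWeakGradient
  have h2 := h1.congr hu (ae_eq_refl _)
  have h3 : energy γ u' Ω = energy γ u Ω := by
    rw [h1.energy_eq hΩ, h2.energy_eq hΩ]
    refine lintegral_congr_ae ?_
    filter_upwards [hu] with x hx
    rw [hx]
  refine ⟨h2.memH1, ?_, fun v hv hv0 hvu => ?_⟩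
  · filter_upwards [hu, h.nonneg] with x hx hx'
    rwa [← hx]
  · rw [h3]
    refine h.le_energy v hv hv0 (hvu.congr hΩ ?_)
    filter_upwards [hu] with x hx
    rw [hx]

/-- The function `v` with `v(Ψ(y)) = exp(a ζ(|y|²)) u(y)` for `Ψ = radialMap n ζ`. -/
noncomputable def stretch (a : ℝ) (ζ : ℝ → ℝ) (u : Space n → ℝ) (x : Space n) : ℝ :=
  Real.exp (a * ζ (‖radialInv n ζ x‖ ^ 2)) * u (radialInv n ζ x)

/-- The gradient at `Ψ(y)` of the stretched function, in terms of `s = u(y)` and `ξ = ∇u(y)`. -/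
noncomputable def stretchGradient (a : ℝ) (ζ : ℝ → ℝ) (y : Space n) (s : ℝ) (ξ : Space n) :
    Space n :=
  Real.exp ((a - 1) * ζ (‖y‖ ^ 2)) • (ξ + (2 * deriv ζ (‖y‖ ^ 2) /
    (1 + 2 * deriv ζ (‖y‖ ^ 2) * ‖y‖ ^ 2) * (a * s - inner ℝ ξ y)) • y)

/-- Linearity in (s, ξ): together with the linear bound below, it transfers H¹ convergence of
functions to H¹ convergence of their deformations. -/
theorem stretchGradient_sub (a : ℝ) (ζ : ℝ → ℝ) (y : Space n) (s s' : ℝ) (ξ ξ' : Space n) :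
    stretchGradient a ζ y s ξ - stretchGradient a ζ y s' ξ' =
      stretchGradient a ζ y (s - s') (ξ - ξ') := by
  simp only [stretchGradient, inner_sub_left]
  module

namespace IsRadialProfile

variable {R a : ℝ} {ζ : ℝ → ℝ}

theorem continuous_quotient (h : IsRadialProfile R ζ) : Continuous fun y : Space n =>
    2 * deriv ζ (‖y‖ ^ 2) / (1 + 2 * deriv ζ (‖y‖ ^ 2) * ‖y‖ ^ 2) := by
  have h1 := h.smooth.continuous_deriv (by simp)
  exact Continuous.div (by fun_prop) (by fun_prop) fun y => (h.small _ (sq_nonneg _)).ne'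

theorem exists_norm_stretchGradient_le (h : IsRadialProfile R ζ) (a : ℝ) :
    ∃ C, 0 ≤ C ∧ ∀ y ∈ Metric.ball (0 : Space n) R, ∀ s ξ,
      ‖stretchGradient a ζ y s ξ‖ ≤ C * ‖s‖ + C * ‖ξ‖ := by
  have hc := h.continuous_quotient (n := n)
  set q : Space n → ℝ := fun y =>
    2 * deriv ζ (‖y‖ ^ 2) / (1 + 2 * deriv ζ (‖y‖ ^ 2) * ‖y‖ ^ 2)
  have hc1 : Continuous fun y : Space n => Real.exp ((a - 1) * ζ (‖y‖ ^ 2)) *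
      (1 + |q y| * (|a| + ‖y‖) * ‖y‖) := by
    have := h.smooth.continuous
    fun_prop
  obtain ⟨C, hC⟩ := (isCompact_closedBall (0 : Space n) R).exists_bound_of_continuousOn
    hc1.continuousOn
  refine ⟨max C 0, le_max_right _ _, fun y hy s ξ => ?_⟩
  have h1 := (le_abs_self _).trans ((hC y (Metric.ball_subset_closedBall hy)).trans
    (le_max_left C 0))
  have h2 : ‖a * s - inner ℝ ξ y‖ ≤ |a| * ‖s‖ + ‖ξ‖ * ‖y‖ := by
    refine (norm_sub_le _ _).trans ?_
    rw [norm_mul, Real.norm_eq_abs a]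
    gcongr
    exact norm_inner_le_norm _ _
  rw [stretchGradient, norm_smul, Real.norm_eq_abs, abs_of_pos (Real.exp_pos _)]
  refine le_trans ?_ ((mul_le_mul_of_nonneg_right h1 (by positivity : 0 ≤ ‖s‖ + ‖ξ‖)).trans_eq
    (mul_add _ _ _))
  rw [mul_assoc (Real.exp _)]
  refine mul_le_mul_of_nonneg_left ?_ (Real.exp_pos _).le
  refine (norm_add_le _ _).trans ?_
  rw [norm_smul, norm_mul, Real.norm_eq_abs (2 * deriv ζ (‖y‖ ^ 2) / _)]
  change ‖ξ‖ + |q y| * ‖a * s - inner ℝ ξ y‖ * ‖y‖ ≤ _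
  have h3 : |q y| * ‖a * s - inner ℝ ξ y‖ * ‖y‖ ≤
      |q y| * (|a| * ‖s‖ + ‖ξ‖ * ‖y‖) * ‖y‖ := by gcongr
  have h4 : 0 ≤ |q y| * |a| * ‖y‖ * ‖ξ‖ := by positivity
  have h5 : 0 ≤ |q y| * ‖y‖ * ‖y‖ * ‖s‖ := by positivity
  nlinarith [norm_nonneg s]

theorem contDiff_stretch (h : IsRadialProfile R ζ) {f : Space n → ℝ} (hf : ContDiff ℝ ∞ f) :
    ContDiff ℝ ∞ (stretch a ζ f) :=
  ((contDiff_const.mul ((contDiff_comp_norm_sq h.smooth).comp h.contDiff_inv)).exp).mul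
    (hf.comp h.contDiff_inv)

theorem stretch_map (h : IsRadialProfile R ζ) (f : Space n → ℝ) (y : Space n) :
    stretch a ζ f (radialMap n ζ y) = Real.exp (a * ζ (‖y‖ ^ 2)) * f y := by
  rw [stretch, h.inv_map]

/-- Differentiate v(Ψ(y)) = exp(aζ) f(y) and solve for ∇v. The quotient in `stretchGradient` comes
from inverting the identity plus a rank-one map. Since the derivative of Ψ is onto, it suffices to
pair with vectors in its image. -/
theorem gradient_stretch_map (h : IsRadialProfile R ζ) {f : Space n → ℝ} (hf : ContDiff ℝ ∞ f)
    (y : Space n) : gradient (stretch a ζ f) (radialMap n ζ y) =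
      stretchGradient a ζ y (f y) (gradient f y) := by
  have h1 : HasFDerivAt (stretch a ζ f) (fderiv ℝ (stretch a ζ f) (radialMap n ζ y))
      (radialMap n ζ y) := ((h.contDiff_stretch hf).differentiable (by simp) _).hasFDerivAt
  have h2 : HasFDerivAt (fun y => stretch a ζ f (radialMap n ζ y)) _ y := h1.comp y (h.hasFDerivAt y)
  have h3 := (((hasFDerivAt_comp_norm_sq h.smooth y).const_mul a).exp).mul
    (hf.differentiable (by simp) y).hasFDerivAt
  simp only [h.stretch_map] at h2
  have h4 := h2.unique h3
  refine ext_inner_right ℝ fun w => ?_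
  have hs : ∀ w, ∃ v, radialDeriv ζ y v = w :=
    ((radialDeriv ζ y).toContinuousLinearEquivOfDetNeZero (h.det_pos y).ne').surjective
  obtain ⟨v, rfl⟩ := hs w
  have h5 := congrArg (fun L => L v) h4
  simp only [ContinuousLinearMap.comp_apply, ← inner_gradient_eq_fderiv] at h5
  have hy := (h.small (‖y‖ ^ 2) (sq_nonneg _)).ne'
  rw [h5]
  simp only [radialDeriv, stretchGradient, _root_.add_apply, _root_.smul_apply,
    ContinuousLinearMap.smulRight_apply, innerSL_apply_apply,
    ContinuousLinearMap.id_apply, smul_eq_mul, inner_smul_left, inner_smul_right, inner_add_left,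
    inner_add_right, ← inner_gradient_eq_fderiv, real_inner_self_eq_norm_sq, RCLike.conj_to_real]
  have e : Real.exp ((a - 1) * ζ (‖y‖ ^ 2)) * Real.exp (ζ (‖y‖ ^ 2)) =
      Real.exp (a * ζ (‖y‖ ^ 2)) := by
    rw [← Real.exp_add]; ring_nf
  rw [← e]
  have hq := div_mul_cancel₀ (2 * deriv ζ (‖y‖ ^ 2)) hy
  linear_combination (-(Real.exp ((a - 1) * ζ (‖y‖ ^ 2)) * Real.exp (ζ (‖y‖ ^ 2)) * inner ℝ y v *
    (a * f y - inner ℝ (gradient f y) y))) * hq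

theorem gradient_stretch (h : IsRadialProfile R ζ) {f : Space n → ℝ} (hf : ContDiff ℝ ∞ f)
    (x : Space n) : gradient (stretch a ζ f) x = stretchGradient a ζ (radialInv n ζ x)
      (f (radialInv n ζ x)) (gradient f (radialInv n ζ x)) := by
  rw [← h.gradient_stretch_map hf, h.map_inv]

theorem stronglyMeasurable_stretchGradient (h : IsRadialProfile R ζ) {u : Space n → ℝ}
    {G : Space n → Space n} (hu : StronglyMeasurable u) (hG : StronglyMeasurable G) :
    StronglyMeasurable fun y => stretchGradient a ζ y (u y) (G y) := by
  have h1 := (h.continuous_quotient (n := n)).stronglyMeasurable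
  have h2 := (contDiff_comp_norm_sq (n := n) h.smooth).continuous.stronglyMeasurable
  exact ((h2.const_mul (a - 1)).measurable.exp.stronglyMeasurable).smul
    (hG.add ((h1.mul ((hu.const_mul a).sub (hG.inner stronglyMeasurable_id))).smul
      stronglyMeasurable_id))

set_option maxHeartbeats 1000000 in
-- The chain rule is exact for smooth approximations f_k and passes to the limit. Since Ψ is the
-- identity near the boundary, the deformation minus f_k is a test function, and these differences
-- show that the boundary data are unchanged.
theorem hasWeakGradient_stretch (h : IsRadialProfile R ζ) (hR : 0 < R) (a : ℝ) {u : Space n → ℝ}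
    {G : Space n → Space n} (hu : HasWeakGradient (Metric.ball 0 R) u G)
    (hum : StronglyMeasurable u) (hGm : StronglyMeasurable G) :
    HasWeakGradient (Metric.ball 0 R) (stretch a ζ u) (fun x =>
      stretchGradient a ζ (radialInv n ζ x) (u (radialInv n ζ x)) (G (radialInv n ζ x))) ∧
    MemH10 (Metric.ball 0 R) fun x => stretch a ζ u x - u x := by
  set B := Metric.ball (0 : Space n) R
  obtain ⟨f, hf, hfu, hfG⟩ := hu.exists_smooth_approx hR
  have hfm : ∀ k, MemLp (f k) 2 (volume.restrict B) ∧ MemLp (gradient (f k)) 2 (volume.restrict B) :=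
    fun k => by
      have := hasWeakGradient_of_contDiff (hf k) (measurableSet_ball (x := (0 : Space n)) (ε := R))
        Metric.isBounded_ball
      exact ⟨this.memLp, this.memLp_grad⟩
  have hinv : ∀ x ∈ B, radialInv n ζ x ∈ B := fun x hx => by
    rw [← h.map_mem_ball, h.map_inv]; exact hx
  -- linear bounds
  obtain ⟨C, hC0, hC⟩ := h.exists_norm_stretchGradient_le (n := n) a
  have hce : Continuous fun y : Space n => Real.exp (a * ζ (‖y‖ ^ 2)) := by
    have := h.smooth.continuous
    fun_prop
  obtain ⟨K, hK⟩ := (isCompact_closedBall (0 : Space n) R).exists_bound_of_continuousOn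
    hce.continuousOn
  have hKs : ∀ w : Space n → ℝ, ∀ x ∈ B, ‖stretch a ζ w x‖ ≤ K * ‖w (radialInv n ζ x)‖ := by
    intro w x hx
    rw [stretch, norm_mul]
    gcongr
    exact hK _ (Metric.ball_subset_closedBall (hinv x hx))
  have hinvm : Measurable (radialInv n ζ) := h.contDiff_inv.continuous.measurable
  have hsm : StronglyMeasurable (stretch a ζ u) :=
    (hce.comp h.contDiff_inv.continuous).stronglyMeasurable.mul (hum.comp_measurable hinvm)
  have hVm : StronglyMeasurable fun x =>
      stretchGradient a ζ (radialInv n ζ x) (u (radialInv n ζ x)) (G (radialInv n ζ x)) :=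
    (h.stronglyMeasurable_stretchGradient hum hGm).comp_measurable hinvm
  have hui := h.memLp_comp_inv hum hu.memLp
  have hGi := h.memLp_comp_inv hGm hu.memLp_grad
  have hv2 : MemLp (stretch a ζ u) 2 (volume.restrict B) := by
    refine hui.of_le_mul (c := K) hsm.aestronglyMeasurable ?_
    filter_upwards [ae_restrict_mem measurableSet_ball] with x hx using hKs u x hx
  have hV2 : MemLp (fun x => stretchGradient a ζ (radialInv n ζ x) (u (radialInv n ζ x))
      (G (radialInv n ζ x))) 2 (volume.restrict B) := by
    refine (hui.norm.add hGi.norm).of_le_mul (c := C) hVm.aestronglyMeasurable ?_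
    filter_upwards [ae_restrict_mem measurableSet_ball] with x hx
    refine (hC _ (hinv x hx) _ _).trans ?_
    rw [Pi.add_apply, Real.norm_eq_abs (_ + _), abs_of_nonneg (by positivity), mul_add]
  -- convergence
  have c1 : Tendsto (fun k => eLpNorm (stretch a ζ (f k) - stretch a ζ u) 2 (volume.restrict B))
      atTop (𝓝 0) := by
    refine tendsto_eLpNorm_of_le_mul (C := K) (fun k => ?_) (h.tendsto_eLpNorm_comp_inv hfu)
    filter_upwards [ae_restrict_mem measurableSet_ball] with x hx
    refine le_of_eq_of_le ?_ (hKs (f k - u) x hx)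
    simp only [Pi.sub_apply, stretch, mul_sub]
  have cn : Tendsto (fun k => eLpNorm ((fun x => ‖(f k - u) x‖) + fun x => ‖(gradient (f k) - G) x‖) 2
      (volume.restrict B)) atTop (𝓝 0) := by
    refine tendsto_eLpNorm_add (fun k => ((hfm k).1.sub hu.memLp).1.norm)
      (fun k => ((hfm k).2.sub hu.memLp_grad).1.norm) ?_ ?_
    · simpa only [eLpNorm_norm] using hfu
    · simpa only [eLpNorm_norm] using hfG
  have c2 : Tendsto (fun k => eLpNorm (gradient (stretch a ζ (f k)) - fun x =>
      stretchGradient a ζ (radialInv n ζ x) (u (radialInv n ζ x)) (G (radialInv n ζ x))) 2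
        (volume.restrict B)) atTop (𝓝 0) := by
    refine tendsto_eLpNorm_of_le_mul (C := C) (fun k => ?_) (h.tendsto_eLpNorm_comp_inv cn)
    filter_upwards [ae_restrict_mem measurableSet_ball] with x hx
    rw [Pi.sub_apply, h.gradient_stretch (hf k), stretchGradient_sub]
    refine (hC _ (hinv x hx) _ _).trans ?_
    rw [Pi.add_apply, Real.norm_eq_abs (_ + _), abs_of_nonneg (by positivity), mul_add]
    rfl
  have hw := hasWeakGradient_of_tendsto (fun k => hasWeakGradient_of_contDiff
    (h.contDiff_stretch (a := a) (hf k)) (measurableSet_ball (x := (0 : Space n)) (ε := R))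
      Metric.isBounded_ball) hv2 hV2 c1 c2
  refine ⟨hw, ?_⟩
  have hd : ∀ k, ContDiff ℝ ∞ fun x => stretch a ζ (f k) x - f k x :=
    fun k => (h.contDiff_stretch (hf k)).sub (hf k)
  refine memH10_of_tendsto Metric.isOpen_ball (hw.sub hu)
    (φ := fun k x => stretch a ζ (f k) x - f k x) (fun k => ?_) ?_ ?_
  · obtain ⟨b, hb, h0⟩ := h.support
    have hcl : IsClosed {x : Space n | ‖x‖ ^ 2 ≤ b} :=
      isClosed_le (by fun_prop) continuous_const
    have hsub : tsupport (fun x : Space n => stretch a ζ (f k) x - f k x) ⊆ {x | ‖x‖ ^ 2 ≤ b} := by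
      refine closure_minimal (fun x hx => ?_) hcl
      by_contra hx'
      have hx2 : b ≤ ‖x‖ ^ 2 := le_of_not_ge hx'
      refine hx ?_
      change stretch a ζ (f k) x - f k x = 0
      rw [stretch, h.inv_eq_self h0 hx2, h0 _ hx2]
      simp
    have hball : {x : Space n | ‖x‖ ^ 2 ≤ b} ⊆ B := by
      intro x hx
      have : ‖x‖ ^ 2 < R ^ 2 := lt_of_le_of_lt hx hb
      simpa [B] using lt_of_pow_lt_pow_left₀ 2 hR.le this
    exact ⟨hd k, (isCompact_closedBall (0 : Space n) R).of_isClosed_subset (isClosed_tsupport _)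
      ((hsub.trans hball).trans Metric.ball_subset_closedBall), hsub.trans hball⟩
  · have hs : ∀ k, AEStronglyMeasurable (stretch a ζ (f k) - stretch a ζ u) (volume.restrict B) :=
      fun k => ((h.contDiff_stretch (hf k)).continuous.stronglyMeasurable.sub
        hsm).aestronglyMeasurable
    have hs' : ∀ k, AEStronglyMeasurable (u - f k) (volume.restrict B) :=
      fun k => (hu.memLp.sub (hfm k).1).1
    have c3 : Tendsto (fun k => eLpNorm (u - f k) 2 (volume.restrict B)) atTop (𝓝 0) := by
      refine hfu.congr fun k => ?_
      rw [← eLpNorm_neg, neg_sub]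
    refine (tendsto_eLpNorm_add hs hs' c1 c3).congr fun k => congrArg (eLpNorm · 2 _) ?_
    ext x
    simp only [Pi.add_apply, Pi.sub_apply]
    ring
  · have hs : ∀ k, AEStronglyMeasurable (gradient (stretch a ζ (f k)) - fun x =>
        stretchGradient a ζ (radialInv n ζ x) (u (radialInv n ζ x)) (G (radialInv n ζ x)))
        (volume.restrict B) :=
      fun k => ((continuous_gradient (h.contDiff_stretch (hf k))).stronglyMeasurable.sub
        hVm).aestronglyMeasurable
    have hs' : ∀ k, AEStronglyMeasurable (G - gradient (f k)) (volume.restrict B) :=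
      fun k => (hu.memLp_grad.sub (hfm k).2).1
    have c3 : Tendsto (fun k => eLpNorm (G - gradient (f k)) 2 (volume.restrict B)) atTop (𝓝 0) := by
      refine hfG.congr fun k => ?_
      rw [← eLpNorm_neg, neg_sub]
    refine (tendsto_eLpNorm_add hs hs' c2 c3).congr fun k => congrArg (eLpNorm · 2 _) ?_
    ext1 x
    have hg : gradient (fun x => stretch a ζ (f k) x - f k x) x =
        gradient (stretch a ζ (f k)) x - gradient (f k) x := by
      rw [gradient, fderiv_fun_sub ((h.contDiff_stretch (hf k)).differentiable (by simp) x)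
        ((hf k).differentiable (by simp) x), map_sub]
      rfl
    simp only [Pi.add_apply, Pi.sub_apply, hg]
    abel

/-- The exceptional null set is transported by changing variables in the integral of the negative
part. -/
theorem stretch_nonneg (h : IsRadialProfile R ζ) (a : ℝ) {u : Space n → ℝ}
    (hum : StronglyMeasurable u) (hu : ∀ᵐ x ∂(volume.restrict (Metric.ball (0 : Space n) R)), 0 ≤ u x) :
    ∀ᵐ x ∂(volume.restrict (Metric.ball (0 : Space n) R)), 0 ≤ stretch a ζ u x := by
  have hce : Continuous fun y : Space n => Real.exp (a * ζ (‖y‖ ^ 2)) := by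
    have := h.smooth.continuous
    fun_prop
  have hsm : StronglyMeasurable (stretch a ζ u) :=
    (hce.comp h.contDiff_inv.continuous).stronglyMeasurable.mul
      (hum.comp_measurable h.contDiff_inv.continuous.measurable)
  have h1 : ∫⁻ x in Metric.ball (0 : Space n) R, ENNReal.ofReal (-stretch a ζ u x) = 0 := by
    rw [h.lintegral_ball, ← lintegral_zero]
    refine lintegral_congr_ae ?_
    filter_upwards [hu] with y hy
    have : -(Real.exp (a * ζ (‖y‖ ^ 2)) * u y) ≤ 0 := by
      rw [neg_nonpos]
      positivity
    rw [h.stretch_map, ENNReal.ofReal_eq_zero.2 this, mul_zero]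
  have hm : Measurable fun x => ENNReal.ofReal (-stretch a ζ u x) :=
    hsm.measurable.neg.ennreal_ofReal
  rw [lintegral_eq_zero_iff hm] at h1
  filter_upwards [h1] with x hx
  simpa using hx

end IsRadialProfile

end AltPhillips

namespace AltPhillips

variable {n : ℕ}

/-! ### The domain variation identity of minimizers -/

/-- The relation that singles out α: under u ↦ λ^α u(x/λ), |∇u|² scales by λ^(2α-2) and the
potential by λ^(-γα), and the two factors coincide. -/
theorem homExponent_mul {γ : ℝ} (hγ : 0 < γ) : γ * homExponent γ = 2 - 2 * homExponent γ := by
  rw [homExponent]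
  field_simp
  ring

/-- The energy density transforms under a radial deformation. -/
theorem det_mul_density {γ : ℝ} (hγ : 0 < γ) {ζ : ℝ → ℝ} {y : Space n}
    (hy : 0 < 1 + 2 * deriv ζ (‖y‖ ^ 2) * ‖y‖ ^ 2) (s : ℝ) (ξ : Space n) :
    (radialDeriv ζ y).det * ((1 / 2) * ‖stretchGradient (homExponent γ) ζ y s ξ‖ ^ 2 +
      potential γ (Real.exp (homExponent γ * ζ (‖y‖ ^ 2)) * s)) =
    Real.exp ((n + 2 * homExponent γ - 2) * ζ (‖y‖ ^ 2)) *
      ((1 + 2 * deriv ζ (‖y‖ ^ 2) * ‖y‖ ^ 2) * ((1 / 2) * ‖ξ‖ ^ 2 + potential γ s) +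
        2 * deriv ζ (‖y‖ ^ 2) * ((homExponent γ * s - inner ℝ ξ y) * inner ℝ ξ y) +
        (1 / 2) * (2 * deriv ζ (‖y‖ ^ 2)) ^ 2 * ‖y‖ ^ 2 * (homExponent γ * s - inner ℝ ξ y) ^ 2 /
          (1 + 2 * deriv ζ (‖y‖ ^ 2) * ‖y‖ ^ 2)) := by
  have hα := homExponent_mul hγ
  rw [IsRadialProfile.det_radialDeriv, potential_mul (Real.exp_pos _), ← Real.exp_mul, stretchGradient, norm_smul,
    mul_pow, ← real_inner_self_eq_norm_sq (ξ + _), Real.norm_eq_abs, abs_of_pos (Real.exp_pos _),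
    ← Real.exp_nat_mul]
  simp only [inner_add_left, inner_add_right, inner_smul_left, inner_smul_right,
    real_inner_self_eq_norm_sq, RCLike.conj_to_real, real_inner_comm ξ y]
  set α := homExponent γ
  set z := ζ (‖y‖ ^ 2)
  set c := 2 * deriv ζ (‖y‖ ^ 2)
  set p := inner ℝ y ξ
  -- The only use of the value of α: both terms of the energy density carry the same exponential
  -- factor.
  have e1 : Real.exp (α * z * -γ) = Real.exp (((2 : ℕ) : ℝ) * ((α - 1) * z)) := by
    congr 1
    push_cast
    linear_combination (-z) * hα
  have e2 : Real.exp (n * z) * Real.exp (((2 : ℕ) : ℝ) * ((α - 1) * z)) =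
      Real.exp ((n + 2 * α - 2) * z) := by
    rw [← Real.exp_add]
    congr 1
    push_cast
    ring
  rw [e1, ← e2]
  generalize Real.exp (n * z) = E1
  generalize Real.exp (((2 : ℕ) : ℝ) * ((α - 1) * z)) = E2
  have hy' := hy.ne'
  field_simp
  ring

theorem IsRadialProfile.energy_stretch {R : ℝ} {ζ : ℝ → ℝ} (h : IsRadialProfile R ζ) (hR : 0 < R)
    {γ : ℝ} (hγ : 0 < γ) {u : Space n → ℝ} {G : Space n → Space n}
    (hu : HasWeakGradient (Metric.ball 0 R) u G) (hum : StronglyMeasurable u)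
    (hGm : StronglyMeasurable G) :
    energy γ (stretch (homExponent γ) ζ u) (Metric.ball 0 R) = ∫⁻ y in Metric.ball (0 : Space n) R,
      ENNReal.ofReal (Real.exp ((n + 2 * homExponent γ - 2) * ζ (‖y‖ ^ 2)) *
      ((1 + 2 * deriv ζ (‖y‖ ^ 2) * ‖y‖ ^ 2) * ((1 / 2) * ‖G y‖ ^ 2 + potential γ (u y)) +
        2 * deriv ζ (‖y‖ ^ 2) * ((homExponent γ * u y - inner ℝ (G y) y) * inner ℝ (G y) y) +
        (1 / 2) * (2 * deriv ζ (‖y‖ ^ 2)) ^ 2 * ‖y‖ ^ 2 *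
          (homExponent γ * u y - inner ℝ (G y) y) ^ 2 /
          (1 + 2 * deriv ζ (‖y‖ ^ 2) * ‖y‖ ^ 2))) := by
  rw [(h.hasWeakGradient_stretch hR _ hu hum hGm).1.energy_eq Metric.isOpen_ball,
    h.lintegral_ball]
  refine lintegral_congr fun y => ?_
  rw [← ENNReal.ofReal_mul (h.det_pos y).le, h.inv_map, h.stretch_map,
    det_mul_density hγ (h.small _ (sq_nonneg _))]

/-- Differentiation under the integral over a ball with smooth coefficients. -/
theorem hasDerivAt_integral_ball_mul {R : ℝ} {A A' : ℝ → Space n → ℝ}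
    (hA : Continuous fun q : ℝ × Space n => A q.1 q.2)
    (hA' : Continuous fun q : ℝ × Space n => A' q.1 q.2)
    (hd : ∀ ε x, HasDerivAt (fun ε => A ε x) (A' ε x) ε) {h : Space n → ℝ}
    (hh : IntegrableOn h (Metric.ball 0 R)) (ε₀ : ℝ) :
    (∀ ε, IntegrableOn (fun x => A ε x * h x) (Metric.ball 0 R)) ∧
    HasDerivAt (fun ε => ∫ x in Metric.ball 0 R, A ε x * h x)
      (∫ x in Metric.ball 0 R, A' ε₀ x * h x) ε₀ := by
  have hc : ∀ ε, Continuous (A ε) := fun ε => hA.comp (by fun_prop : Continuous fun x => (ε, x))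
  have hi : ∀ ε, IntegrableOn (fun x => A ε x * h x) (Metric.ball 0 R) := by
    intro ε
    obtain ⟨C, hC⟩ := (isCompact_closedBall (0 : Space n) R).exists_bound_of_continuousOn
      (hc ε).continuousOn
    refine Integrable.bdd_mul (c := C) hh (hc ε).aestronglyMeasurable ?_
    filter_upwards [ae_restrict_mem measurableSet_ball] with x hx using
      hC x (Metric.ball_subset_closedBall hx)
  refine ⟨hi, ?_⟩
  obtain ⟨C, hC⟩ := ((isCompact_Icc (a := ε₀ - 1) (b := ε₀ + 1)).prod
    (isCompact_closedBall (0 : Space n) R)).exists_bound_of_continuousOn hA'.continuousOn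
  have hc' : Continuous (A' ε₀) := hA'.comp (by fun_prop : Continuous fun x => (ε₀, x))
  refine (hasDerivAt_integral_of_dominated_loc_of_deriv_le (F := fun ε x => A ε x * h x)
    (F' := fun ε x => A' ε x * h x) (s := Ioo (ε₀ - 1) (ε₀ + 1)) (bound := fun x => C * ‖h x‖)
    (Ioo_mem_nhds (by linarith) (by linarith)) (.of_forall fun ε => (hi ε).1) (hi ε₀) ?_ ?_ ?_ ?_).2
  · exact hc'.aestronglyMeasurable.mul hh.1
  · filter_upwards [ae_restrict_mem measurableSet_ball] with x hx ε hε
    rw [norm_mul]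
    gcongr
    exact hC (ε, x) ⟨Ioo_subset_Icc_self hε, Metric.ball_subset_closedBall hx⟩
  · exact hh.norm.const_mul C
  · exact .of_forall fun x ε _ => (hd ε x).mul_const _

/-- Since ζ vanishes beyond b, 2 ζ'(t) t is bounded on t ≥ 0 and small multiples of ζ are
admissible. The explicit bound 1/2, rather than mere positivity, controls the quotient in the
deformed energy. -/
theorem exists_isRadialProfile_mul {R : ℝ} {ζ : ℝ → ℝ} (hζ : ContDiff ℝ ∞ ζ)
    (hb : ∃ b < R ^ 2, ∀ t, b ≤ t → ζ t = 0) : ∃ δ > 0, ∀ ε, |ε| < δ →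
      IsRadialProfile R (fun t => ε * ζ t) ∧ ∀ t, 0 ≤ t → 1 / 2 ≤ 1 + 2 * (ε * deriv ζ t) * t := by
  obtain ⟨b, hb, h0⟩ := hb
  have hc : Continuous fun t => 2 * deriv ζ t * t := by
    have := hζ.continuous_deriv (by simp)
    fun_prop
  obtain ⟨K, hK⟩ := (isCompact_Icc (a := (0 : ℝ)) (b := b)).exists_bound_of_continuousOn
    hc.continuousOn
  have hK' : ∀ t, 0 ≤ t → |2 * deriv ζ t * t| ≤ max K 0 := by
    intro t ht
    rcases le_or_gt t b with htb | htb
    · exact (hK t ⟨ht, htb⟩).trans (le_max_left _ _)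
    · have : ζ =ᶠ[𝓝 t] fun _ => 0 := by
        filter_upwards [lt_mem_nhds htb] with s hs using h0 s hs.le
      rw [this.deriv_eq]
      simp
  have hhalf : ∀ ε, |ε| < 1 / (2 * (max K 0 + 1)) →
      ∀ t, 0 ≤ t → 1 / 2 ≤ 1 + 2 * (ε * deriv ζ t) * t := by
    intro ε hε t ht
    have h1 : |ε * (2 * deriv ζ t * t)| ≤ 1 / 2 := by
      rw [abs_mul]
      calc |ε| * |2 * deriv ζ t * t| ≤ 1 / (2 * (max K 0 + 1)) * (max K 0 + 1) := by
            gcongr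
            exact (hK' t ht).trans (by linarith)
        _ = 1 / 2 := by
            have : 0 < max K 0 + 1 := by positivity
            field_simp
    have h2 := neg_abs_le (ε * (2 * deriv ζ t * t))
    linarith [show 2 * (ε * deriv ζ t) * t = ε * (2 * deriv ζ t * t) by ring]
  refine ⟨1 / (2 * (max K 0 + 1)), by positivity, fun ε hε => ⟨⟨contDiff_const.mul hζ,
    ⟨b, hb, fun t ht => by rw [h0 t ht, mul_zero]⟩, fun t ht => ?_⟩, hhalf ε hε⟩⟩
  rw [deriv_const_mul_field]
  linarith [hhalf ε hε t ht]

set_option maxHeartbeats 1000000 in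
-- The first variation along ε ↦ deformation by εζ. The deformed energy is not differentiated: it is
-- bounded above by a simpler function of ε with the same value at ε = 0. By minimality that
-- majorant has a local minimum at 0, so its derivative vanishes there.
theorem IsMinimizer.radialIdentity_of_stronglyMeasurable {γ : ℝ} (hγ : 0 < γ) {R : ℝ} (hR : 0 < R)
    {u : Space n → ℝ} {G : Space n → Space n} (hm : IsMinimizer γ u (Metric.ball 0 R))
    (hu : HasWeakGradient (Metric.ball 0 R) u G) (hum : StronglyMeasurable u)
    (hGm : StronglyMeasurable G)
    (he : IntegrableOn (fun x => (1 / 2) * ‖G x‖ ^ 2 + potential γ (u x)) (Metric.ball 0 R)) :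
    RadialIdentity R
      (fun x => (n + 2 * homExponent γ - 2) * ((1 / 2) * ‖G x‖ ^ 2 + potential γ (u x)))
      (fun x => ‖x‖ ^ 2 * ((1 / 2) * ‖G x‖ ^ 2 + potential γ (u x)) +
        (homExponent γ * u x - inner ℝ (G x) x) * inner ℝ (G x) x) := by
  intro ζ hζ hb
  set B := Metric.ball (0 : Space n) R
  set N : ℝ := n + 2 * homExponent γ - 2
  set e : Space n → ℝ := fun x => (1 / 2) * ‖G x‖ ^ 2 + potential γ (u x)
  set p : Space n → ℝ := fun x => inner ℝ (G x) x
  set τ : Space n → ℝ := fun x => homExponent γ * u x - p x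
  have he0 : ∀ x, 0 ≤ e x := fun x => add_nonneg (by positivity) (potential_nonneg hγ.le _)
  have hp : MemLp p 2 (volume.restrict B) := by
    refine hu.memLp_grad.of_le_mul (c := R) (hGm.inner stronglyMeasurable_id).aestronglyMeasurable ?_
    filter_upwards [ae_restrict_mem measurableSet_ball] with x hx
    rw [mul_comm]
    refine (norm_inner_le_norm _ _).trans ?_
    gcongr
    simpa using (mem_ball_zero_iff.1 hx).le
  have hτ : MemLp τ 2 (volume.restrict B) := (hu.memLp.const_mul _).sub hp
  have iτp : IntegrableOn (fun x => τ x * p x) B := integrable_mul_of_memLp hτ hp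
  have iττ : IntegrableOn (fun x => τ x ^ 2) B := hτ.integrable_sq
  have hcζ := hζ.continuous
  have hcζ' := hζ.continuous_deriv (by simp)
  set η : Space n → ℝ := fun x => ζ (‖x‖ ^ 2)
  set c : Space n → ℝ := fun x => 2 * deriv ζ (‖x‖ ^ 2)
  have hη : Continuous η := by fun_prop
  have hc : Continuous c := by fun_prop
  have hexp : ∀ ε x, HasDerivAt (fun ε => Real.exp (N * (ε * η x)))
      (Real.exp (N * (ε * η x)) * (N * η x)) ε := fun ε x => by
    have := (((hasDerivAt_id ε).mul_const (η x)).const_mul N).exp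
    simpa using this
  obtain ⟨i1, d1⟩ := hasDerivAt_integral_ball_mul (R := R)
    (A := fun ε x => Real.exp (N * (ε * η x)) * (1 + ε * c x * ‖x‖ ^ 2))
    (A' := fun ε x => Real.exp (N * (ε * η x)) * (N * η x) * (1 + ε * c x * ‖x‖ ^ 2) +
      Real.exp (N * (ε * η x)) * (c x * ‖x‖ ^ 2)) (by fun_prop) (by fun_prop)
    (fun ε x => by
      refine (hexp ε x).mul ?_
      have := (((hasDerivAt_id ε).mul_const (c x)).mul_const (‖x‖ ^ 2)).const_add 1
      simpa using this) he 0
  obtain ⟨i2, d2⟩ := hasDerivAt_integral_ball_mul (R := R)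
    (A := fun ε x => Real.exp (N * (ε * η x)) * (ε * c x))
    (A' := fun ε x => Real.exp (N * (ε * η x)) * (N * η x) * (ε * c x) +
      Real.exp (N * (ε * η x)) * c x) (by fun_prop) (by fun_prop)
    (fun ε x => by
      refine (hexp ε x).mul ?_
      simpa using (hasDerivAt_id ε).mul_const (c x)) iτp 0
  -- The quadratic remainder, with the factor (1/2)/(1 + ε c |x|²) replaced by its bound 1. It
  -- contributes nothing to the derivative at 0.
  obtain ⟨i3, d3⟩ := hasDerivAt_integral_ball_mul (R := R)
    (A := fun ε x => Real.exp (N * (ε * η x)) * (ε ^ 2 * (c x ^ 2 * ‖x‖ ^ 2)))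
    (A' := fun ε x => Real.exp (N * (ε * η x)) * (N * η x) * (ε ^ 2 * (c x ^ 2 * ‖x‖ ^ 2)) +
      Real.exp (N * (ε * η x)) * (2 * ε * (c x ^ 2 * ‖x‖ ^ 2))) (by fun_prop) (by fun_prop)
    (fun ε x => by
      refine (hexp ε x).mul ?_
      have h0 : HasDerivAt (fun ε : ℝ => ε ^ 2) (2 * ε) ε := by simpa using hasDerivAt_pow 2 ε
      exact h0.mul_const _) iττ 0
  have hder := (d1.fun_add d2).fun_add d3
  obtain ⟨δ, hδ, hprof⟩ := exists_isRadialProfile_mul hζ hb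
  have hmin : IsLocalMin (fun ε : ℝ =>
      ((∫ x in B, Real.exp (N * (ε * η x)) * (1 + ε * c x * ‖x‖ ^ 2) * e x) +
      ∫ x in B, Real.exp (N * (ε * η x)) * (ε * c x) * (τ x * p x)) +
      ∫ x in B, Real.exp (N * (ε * η x)) * (ε ^ 2 * (c x ^ 2 * ‖x‖ ^ 2)) * τ x ^ 2) 0 := by
    have hnear : ∀ᶠ ε in 𝓝 (0 : ℝ), |ε| < δ := by
      have := (continuous_abs.tendsto (0 : ℝ)).eventually_lt_const (by simpa using hδ)
      exact this
    filter_upwards [hnear] with ε hε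
    obtain ⟨hpr, hhalf⟩ := hprof ε hε
    have i12 : IntegrableOn (fun x => Real.exp (N * (ε * η x)) * (1 + ε * c x * ‖x‖ ^ 2) * e x +
        Real.exp (N * (ε * η x)) * (ε * c x) * (τ x * p x)) B := (i1 ε).add (i2 ε)
    have iD : IntegrableOn (fun x => Real.exp (N * (ε * η x)) * (1 + ε * c x * ‖x‖ ^ 2) * e x +
        Real.exp (N * (ε * η x)) * (ε * c x) * (τ x * p x) +
        Real.exp (N * (ε * η x)) * (ε ^ 2 * (c x ^ 2 * ‖x‖ ^ 2)) * τ x ^ 2) B := i12.add (i3 ε)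
    rw [← integral_add (i1 ε) (i2 ε), ← integral_add i12 (i3 ε)]
    simp only [zero_mul, mul_zero, Real.exp_zero, one_mul, add_zero, integral_zero, ne_eq,
      OfNat.ofNat_ne_zero, not_false_eq_true, zero_pow]
    have hle := hm.le_energy _ (hpr.hasWeakGradient_stretch hR (homExponent γ) hu hum hGm).1.memH1
      (hpr.stretch_nonneg _ hum hm.nonneg)
      (hpr.hasWeakGradient_stretch hR (homExponent γ) hu hum hGm).2
    rw [hu.energy_eq Metric.isOpen_ball, hpr.energy_stretch hR hγ hu hum hGm] at hle
    -- Nonnegativity is needed to pass between real integrals and `ℝ≥0∞`. It is not evident term by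
    -- term, but follows because the true deformed density is a positive Jacobian times a
    -- nonnegative energy density, and the majorant is larger.
    have hpt : ∀ x : Space n, 0 ≤ Real.exp (N * (ε * η x)) * (1 + ε * c x * ‖x‖ ^ 2) * e x +
        Real.exp (N * (ε * η x)) * (ε * c x) * (τ x * p x) +
        Real.exp (N * (ε * η x)) * (ε ^ 2 * (c x ^ 2 * ‖x‖ ^ 2)) * τ x ^ 2 ∧ 
        Real.exp (N * (ε * η x)) * ((1 + 2 * (ε * deriv ζ (‖x‖ ^ 2)) * ‖x‖ ^ 2) * e x +
        2 * (ε * deriv ζ (‖x‖ ^ 2)) * (τ x * p x) +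
        (1 / 2) * (2 * (ε * deriv ζ (‖x‖ ^ 2))) ^ 2 * ‖x‖ ^ 2 * τ x ^ 2 /
          (1 + 2 * (ε * deriv ζ (‖x‖ ^ 2)) * ‖x‖ ^ 2)) ≤
        Real.exp (N * (ε * η x)) * (1 + ε * c x * ‖x‖ ^ 2) * e x +
        Real.exp (N * (ε * η x)) * (ε * c x) * (τ x * p x) +
        Real.exp (N * (ε * η x)) * (ε ^ 2 * (c x ^ 2 * ‖x‖ ^ 2)) * τ x ^ 2 := by
      intro x
      have ha := hhalf (‖x‖ ^ 2) (sq_nonneg _)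
      have ha0 : 0 < 1 + 2 * (ε * deriv ζ (‖x‖ ^ 2)) * ‖x‖ ^ 2 := by linarith
      have hq : (1 / 2) * (2 * (ε * deriv ζ (‖x‖ ^ 2))) ^ 2 * ‖x‖ ^ 2 * τ x ^ 2 /
          (1 + 2 * (ε * deriv ζ (‖x‖ ^ 2)) * ‖x‖ ^ 2) ≤
          (2 * (ε * deriv ζ (‖x‖ ^ 2))) ^ 2 * ‖x‖ ^ 2 * τ x ^ 2 := by
        rw [div_le_iff₀ ha0]
        have : 0 ≤ (2 * (ε * deriv ζ (‖x‖ ^ 2))) ^ 2 * ‖x‖ ^ 2 * τ x ^ 2 := by positivity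
        nlinarith
      have hrhs : Real.exp (N * (ε * η x)) * (1 + ε * c x * ‖x‖ ^ 2) * e x +
        Real.exp (N * (ε * η x)) * (ε * c x) * (τ x * p x) +
        Real.exp (N * (ε * η x)) * (ε ^ 2 * (c x ^ 2 * ‖x‖ ^ 2)) * τ x ^ 2 =
        Real.exp (N * (ε * η x)) * ((1 + 2 * (ε * deriv ζ (‖x‖ ^ 2)) * ‖x‖ ^ 2) * e x +
        2 * (ε * deriv ζ (‖x‖ ^ 2)) * (τ x * p x) +
        (2 * (ε * deriv ζ (‖x‖ ^ 2))) ^ 2 * ‖x‖ ^ 2 * τ x ^ 2) := by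
        simp only [c]; ring
      have hle2 := mul_le_mul_of_nonneg_left (add_le_add_right hq
        ((1 + 2 * (ε * deriv ζ (‖x‖ ^ 2)) * ‖x‖ ^ 2) * e x +
        2 * (ε * deriv ζ (‖x‖ ^ 2)) * (τ x * p x))) (Real.exp_pos (N * (ε * η x))).le
      rw [hrhs]
      refine ⟨le_trans ?_ hle2, hle2⟩
      have hd := det_mul_density hγ (hpr.small (‖x‖ ^ 2) (sq_nonneg _)) (u x) (G x)
      rw [deriv_const_mul_field] at hd
      refine le_of_le_of_eq (mul_nonneg (hpr.det_pos x).le ?_) hd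
      exact add_nonneg (by positivity) (potential_nonneg hγ.le _)
    rw [← ENNReal.ofReal_le_ofReal_iff (integral_nonneg fun x => (hpt x).1),
      ofReal_integral_eq_lintegral_ofReal he (.of_forall he0),
      ofReal_integral_eq_lintegral_ofReal iD (.of_forall fun x => (hpt x).1)]
    refine hle.trans (lintegral_mono fun x => ENNReal.ofReal_le_ofReal ?_)
    rw [deriv_const_mul_field]
    exact (hpt x).2
  have hzero := hmin.hasDerivAt_eq_zero hder
  simp only [zero_mul, mul_zero, Real.exp_zero, one_mul, add_zero, zero_add, integral_zero, ne_eq,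
      OfNat.ofNat_ne_zero, not_false_eq_true, zero_pow, mul_one] at hzero
  -- The parameter is idle here: only the integrability half of the differentiation lemma is wanted.
  have j1 : IntegrableOn (fun x => (N * η x + c x * ‖x‖ ^ 2) * e x) B :=
    (hasDerivAt_integral_ball_mul (R := R) (A := fun _ x => N * η x + c x * ‖x‖ ^ 2)
      (A' := fun _ _ => 0) (by fun_prop) (by fun_prop) (fun ε x => hasDerivAt_const _ _) he 0).1 0
  have j2 : IntegrableOn (fun x => c x * (τ x * p x)) B :=
    (hasDerivAt_integral_ball_mul (R := R) (A := fun _ x => c x)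
      (A' := fun _ _ => 0) (by fun_prop) (by fun_prop) (fun ε x => hasDerivAt_const _ _) iτp 0).1 0
  rw [← integral_add j1 j2] at hzero
  rw [← hzero]
  refine integral_congr_ae (.of_forall fun x => ?_)
  simp only [c, η]
  ring

theorem HasWeakGradient.integrableOn_density {γ : ℝ} (hγ : 0 < γ) {Ω : Set (Space n)}
    (hΩ : IsOpen Ω) {u : Space n → ℝ} {G : Space n → Space n} (hu : HasWeakGradient Ω u G)
    (h : energy γ u Ω ≠ ⊤) :
    IntegrableOn (fun x => (1 / 2) * ‖G x‖ ^ 2 + potential γ (u x)) Ω := by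
  refine ⟨((hu.memLp_grad.1.norm.pow 2).const_mul _).add
    ((measurable_potential γ).comp_aemeasurable hu.memLp.1.aemeasurable).aestronglyMeasurable, ?_⟩
  rw [hasFiniteIntegral_iff_ofReal (.of_forall fun x =>
    add_nonneg (by positivity) (potential_nonneg hγ.le _)), ← hu.energy_eq hΩ]
  exact h.lt_top

theorem IsMinimizer.radialIdentity {γ : ℝ} (hγ : 0 < γ) {R : ℝ} (hR : 0 < R)
    {u : Space n → ℝ} {G : Space n → Space n} (hm : IsMinimizer γ u (Metric.ball 0 R))
    (hu : HasWeakGradient (Metric.ball 0 R) u G) (h : energy γ u (Metric.ball 0 R) ≠ ⊤) :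
    RadialIdentity R
      (fun x => (n + 2 * homExponent γ - 2) * ((1 / 2) * ‖G x‖ ^ 2 + potential γ (u x)))
      (fun x => ‖x‖ ^ 2 * ((1 / 2) * ‖G x‖ ^ 2 + potential γ (u x)) +
        (homExponent γ * u x - inner ℝ (G x) x) * inner ℝ (G x) x) := by
  obtain ⟨u', hu'm, huu⟩ := hu.memLp.1
  obtain ⟨G', hG'm, hGG⟩ := hu.memLp_grad.1
  have he := hu.integrableOn_density hγ Metric.isOpen_ball h
  have hid := (hm.congr Metric.isOpen_ball huu).radialIdentity_of_stronglyMeasurable hγ hR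
    (hu.congr huu hGG) hu'm hG'm (he.congr (by
      filter_upwards [huu, hGG] with x h1 h2
      rw [h1, h2]))
  intro ζ hζ hb
  rw [← hid ζ hζ hb]
  refine integral_congr_ae ?_
  filter_upwards [huu, hGG] with x h1 h2
  rw [h1, h2]

end AltPhillips

namespace AltPhillips

variable {n : ℕ}

/-! ### The derivative of the Weiss energy -/

theorem memLp_continuous_smul {R : ℝ} {F : Type*} [NormedAddCommGroup F] [NormedSpace ℝ F]
    {c : Space n → ℝ} (hc : Continuous c) {f : Space n → F}
    (hf : MemLp f 2 (volume.restrict (Metric.ball 0 R))) :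
    MemLp (fun x => c x • f x) 2 (volume.restrict (Metric.ball 0 R)) := by
  obtain ⟨C, hC⟩ := (isCompact_closedBall (0 : Space n) R).exists_bound_of_continuousOn
    hc.continuousOn
  refine hf.of_le_mul (c := C) (hc.aestronglyMeasurable.smul hf.1) ?_
  filter_upwards [ae_restrict_mem measurableSet_ball] with x hx
  rw [norm_smul]
  gcongr
  exact hC x (Metric.ball_subset_closedBall hx)

theorem memLp_inner_id {R : ℝ} {G : Space n → Space n}
    (hG : MemLp G 2 (volume.restrict (Metric.ball 0 R))) :
    MemLp (fun x => inner ℝ (G x) x) 2 (volume.restrict (Metric.ball 0 R)) := by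
  refine hG.of_le_mul (c := R) (hG.1.inner aestronglyMeasurable_id) ?_
  filter_upwards [ae_restrict_mem measurableSet_ball] with x hx
  rw [mul_comm]
  refine (norm_inner_le_norm _ _).trans ?_
  gcongr
  simpa using (mem_ball_zero_iff.1 hx).le

/-- This is div(x u²). The function u² need not be in L², so the weak form of div(x u) is tested
with ζ(|x|²) f_k instead, where the f_k are smooth and tend to u in H¹. -/
theorem HasWeakGradient.radialIdentity_sq {R : ℝ} (hR : 0 < R) {u : Space n → ℝ}
    {G : Space n → Space n} (hu : HasWeakGradient (Metric.ball 0 R) u G) :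
    RadialIdentity R (fun x => n * u x ^ 2 + 2 * (u x * inner ℝ (G x) x))
      (fun x => ‖x‖ ^ 2 * u x ^ 2) := by
  intro ζ hζ hb
  set B := Metric.ball (0 : Space n) R
  obtain ⟨f, hf, hfu, hfG⟩ := hu.exists_smooth_approx hR
  have hw := fun k => hasWeakGradient_of_contDiff (hf k)
    (measurableSet_ball (x := (0 : Space n)) (ε := R)) Metric.isBounded_ball
  have ht := isTestFunction_comp_norm_sq (n := n) hR hζ hb
  have hcζ := hζ.continuous
  have hcζ' := hζ.continuous_deriv (by simp)
  have hp := memLp_inner_id hu.memLp_grad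
  have m1 : MemLp (fun x => (n * ζ (‖x‖ ^ 2) + 2 * deriv ζ (‖x‖ ^ 2) * ‖x‖ ^ 2) * u x +
      ζ (‖x‖ ^ 2) * inner ℝ (G x) x) 2 (volume.restrict B) :=
    (memLp_continuous_smul (by fun_prop) hu.memLp).add (memLp_continuous_smul (by fun_prop) hp)
  have m2 : MemLp (fun x => ζ (‖x‖ ^ 2) * u x) 2 (volume.restrict B) :=
    memLp_continuous_smul (by fun_prop) hu.memLp
  have hfp : Tendsto (fun k => eLpNorm ((fun x => inner ℝ (gradient (f k) x) x) -
      fun x => inner ℝ (G x) x) 2 (volume.restrict B)) atTop (𝓝 0) := by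
    refine tendsto_eLpNorm_of_le_mul (C := R) (fun k => ?_) hfG
    filter_upwards [ae_restrict_mem measurableSet_ball] with x hx
    rw [Pi.sub_apply, Pi.sub_apply, ← inner_sub_left, mul_comm]
    refine (norm_inner_le_norm _ _).trans ?_
    gcongr
    exact (mem_ball_zero_iff.1 hx).le
  have hconst : ∀ ψ : Space n → ℝ,
      Tendsto (fun _ : ℕ => eLpNorm (ψ - ψ) 2 (volume.restrict B)) atTop (𝓝 0) := by
    intro ψ; simp
  have t1 := tendsto_integral_mul_of_eLpNorm (fun _ => m1) m1 (fun k => (hw k).memLp) hu.memLp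
    (hconst _) hfu
  have t2 := tendsto_integral_mul_of_eLpNorm (fun _ => m2) m2
    (fun k => memLp_inner_id (hw k).memLp_grad) hp (hconst _) hfp
  have hz : ∀ k, (∫ x in B, ((n * ζ (‖x‖ ^ 2) + 2 * deriv ζ (‖x‖ ^ 2) * ‖x‖ ^ 2) * u x +
      ζ (‖x‖ ^ 2) * inner ℝ (G x) x) * f k x) +
      ∫ x in B, (ζ (‖x‖ ^ 2) * u x) * inner ℝ (gradient (f k) x) x = 0 := by
    intro k
    have h1 := hu.weak_radial (ht.mul_smooth (hf k))
    have i3 : IntegrableOn (fun x => inner ℝ (G x) x * (ζ (‖x‖ ^ 2) * f k x)) B := by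
      have := integrable_mul_of_memLp (memLp_continuous_smul (by fun_prop : Continuous
        fun x : Space n => ζ (‖x‖ ^ 2)) hp) (hw k).memLp
      refine this.congr (.of_forall fun x => ?_)
      simp only [smul_eq_mul]
      ring
    have i1 := integrable_mul_of_memLp m1 (hw k).memLp
    have i2 := integrable_mul_of_memLp m2 (memLp_inner_id (hw k).memLp_grad)
    rw [← integral_add i1 i2, ← neg_add_cancel (∫ x in B, inner ℝ (G x) x * (ζ (‖x‖ ^ 2) * f k x)),
      ← h1, ← sub_eq_iff_eq_add, ← integral_sub (i1.fun_add i2) i3]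
    refine integral_congr_ae (.of_forall fun x => ?_)
    have hd : fderiv ℝ (fun x => ζ (‖x‖ ^ 2) * f k x) x x =
        ζ (‖x‖ ^ 2) * inner ℝ (gradient (f k) x) x + f k x * (2 * deriv ζ (‖x‖ ^ 2) * ‖x‖ ^ 2) := by
      have h3 : HasFDerivAt (fun x => ζ (‖x‖ ^ 2) * f k x) _ x := (hasFDerivAt_comp_norm_sq hζ x).mul
        ((hf k).differentiable (by simp) x).hasFDerivAt
      rw [h3.fderiv, inner_gradient_eq_fderiv]
      simp
    simp only [hd]
    ring
  have h0 := tendsto_nhds_unique (t1.add t2) (by simp only [hz]; exact tendsto_const_nhds)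
  rw [← integral_add (integrable_mul_of_memLp m1 hu.memLp) (integrable_mul_of_memLp m2 hp)] at h0
  rw [← h0]
  refine integral_congr_ae (.of_forall fun x => ?_)
  simp only
  ring

theorem integrableOn_annulus {a b R : ℝ} (ha : 0 < a) (hbR : b ≤ R) (M : ℝ) {h : Space n → ℝ}
    (hh : IntegrableOn h (Metric.ball 0 R)) :
    IntegrableOn (fun x => ‖x‖ ^ (-M) * h x) (Metric.ball 0 b \ Metric.ball 0 a) := by
  have hsub : Metric.ball (0 : Space n) b \ Metric.ball 0 a ⊆ Metric.ball 0 R :=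
    sdiff_subset.trans (Metric.ball_subset_ball hbR)
  have hc : ContinuousOn (fun ρ : ℝ => ρ ^ (-M)) (Icc a b) := fun ρ hρ =>
    (Real.continuousAt_rpow_const _ _ (Or.inl (ha.trans_le hρ.1).ne')).continuousWithinAt
  obtain ⟨C, hC⟩ := isCompact_Icc.exists_bound_of_continuousOn hc
  refine Integrable.bdd_mul (c := C) (hh.mono_set hsub)
    (Measurable.aestronglyMeasurable (by fun_prop)) ?_
  filter_upwards [ae_restrict_mem (measurableSet_ball.diff measurableSet_ball)] with x hx
  refine hC _ ⟨?_, ?_⟩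
  · simpa using hx.2
  · exact (mem_ball_zero_iff.1 hx.1).le

/-- The Weiss energy in terms of volume integrals. -/
theorem weissEnergy_eq (hn : 1 ≤ n) {γ : ℝ} (hγ : 0 < γ) {R : ℝ} {u : Space n → ℝ}
    {G : Space n → Space n} (hu : HasWeakGradient (Metric.ball 0 R) u G) {r : ℝ}
    (hr : r ∈ Ioc 0 R) : weissEnergy γ u r =
      r ^ (-(n + 2 * homExponent γ - 2)) *
        (∫ x in Metric.ball (0 : Space n) r, ((1 / 2) * ‖G x‖ ^ 2 + potential γ (u x))) -
      homExponent γ / 2 * (r ^ (-(n + 2 * homExponent γ)) *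
        ∫ x in Metric.ball (0 : Space n) r, (n * u x ^ 2 + 2 * (u x * inner ℝ (G x) x))) := by
  have hur := hu.mono (Metric.ball_subset_ball hr.2) measurableSet_ball
  rw [weissEnergy, ← mul_sphereIntegral_sphereTrace_sq hn hr.1 hur, hur.energy_eq Metric.isOpen_ball,
    integral_eq_lintegral_of_nonneg_ae]
  · have e1 : r ^ (-((n : ℝ) - 1) - 2 * homExponent γ) =
        r ^ (-(n + 2 * homExponent γ)) * r := by
      rw [← Real.rpow_add_one hr.1.ne']
      congr 1
      ring
    rw [e1, show -(n : ℝ) - 2 * (homExponent γ - 1) = -(n + 2 * homExponent γ - 2) by ring]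
    ring
  · exact .of_forall fun x => add_nonneg (by positivity) (potential_nonneg hγ.le _)
  · exact ((hur.memLp_grad.1.norm.pow 2).const_mul _).add
      ((measurable_potential γ).comp_aemeasurable hur.memLp.1.aemeasurable).aestronglyMeasurable

theorem homExponent_mem {γ : ℝ} (hγ : γ ∈ Ioo (0 : ℝ) 2) : homExponent γ ∈ Ioo (1 / 2 : ℝ) 1 := by
  have h1 : 0 < γ + 2 := by linarith [hγ.1]
  rw [homExponent]
  constructor
  · rw [lt_div_iff₀ h1]; linarith [hγ.2]
  · rw [div_lt_one h1]; linarith [hγ.1]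

/-- The increment of the Weiss energy of a minimizer. -/
theorem IsMinimizer.weissEnergy_sub (hn : 1 ≤ n) {γ : ℝ} (hγ : γ ∈ Ioo (0 : ℝ) 2) {R : ℝ}
    (hR : 0 < R) {u : Space n → ℝ} {G : Space n → Space n}
    (hm : IsMinimizer γ u (Metric.ball 0 R)) (hu : HasWeakGradient (Metric.ball 0 R) u G)
    {a b : ℝ} (ha : 0 < a) (hab : a < b) (hbR : b ≤ R) :
    weissEnergy γ u b - weissEnergy γ u a = ∫ x in Metric.ball (0 : Space n) b \ Metric.ball 0 a,
      ‖x‖ ^ (-(n + 2 * homExponent γ)) * (homExponent γ * u x - inner ℝ (G x) x) ^ 2 := by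
  have hfin := hm.energy_ne_top hn hγ hR
  have he := hu.integrableOn_density hγ.1 Metric.isOpen_ball hfin
  have id1 := hm.radialIdentity hγ.1 hR hu hfin
  have id2 := hu.radialIdentity_sq hR
  have hp := memLp_inner_id hu.memLp_grad
  have hα := homExponent_mem hγ
  rw [weissEnergy_eq hn hγ.1 hu ⟨ha, hab.le.trans hbR⟩,
    weissEnergy_eq hn hγ.1 hu ⟨ha.trans hab, hbR⟩]
  set α := homExponent γ
  set e : Space n → ℝ := fun x => (1 / 2) * ‖G x‖ ^ 2 + potential γ (u x)
  set p : Space n → ℝ := fun x => inner ℝ (G x) x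
  have hτ : MemLp (fun x => α * u x - p x) 2 (volume.restrict (Metric.ball 0 R)) :=
    (hu.memLp.const_mul _).sub hp
  have iτp := integrable_mul_of_memLp hτ hp
  have iuτ := integrable_mul_of_memLp hu.memLp hτ
  have iup := integrable_mul_of_memLp hu.memLp hp
  have iuu : IntegrableOn (fun x => u x ^ 2) (Metric.ball 0 R) := hu.memLp.integrable_sq
  have ibe : ∀ {h : Space n → ℝ}, IntegrableOn h (Metric.ball 0 R) →
      IntegrableOn (fun x => ‖x‖ ^ 2 * h x) (Metric.ball 0 R) := by
    intro h hh
    exact (hasDerivAt_integral_ball_mul (R := R) (A := fun _ x => ‖x‖ ^ 2)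
      (A' := fun _ _ => 0) (by fun_prop) (by fun_prop) (fun ε x => hasDerivAt_const _ _) hh 0).1 0
  -- Holds because n ≥ 1 and α > 1/2, the latter being γ < 2. The energy identity carries this
  -- factor and must be divided by it.
  have hN : 0 < (n : ℝ) + 2 * α - 2 := by
    have : (1 : ℝ) ≤ n := by exact_mod_cast hn
    linarith [hα.1]
  have g1 := id1.integral_annulus (he.const_mul _) ((ibe he).add iτp) ha hab hbR (n + 2 * α - 2)
  have g2 := id2.integral_annulus ((iuu.const_mul _).add (iup.const_mul 2)) (ibe iuu) ha hab hbR
    (n + 2 * α)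
  have hann : ∀ x ∈ Metric.ball (0 : Space n) b \ Metric.ball 0 a, 0 < ‖x‖ := fun x hx =>
    ha.trans_le (by simpa using hx.2)
  have hpow : ∀ M : ℝ, ∀ x ∈ Metric.ball (0 : Space n) b \ Metric.ball 0 a,
      ‖x‖ ^ (-M - 2) * ‖x‖ ^ 2 = ‖x‖ ^ (-M) := by
    intro M x hx
    rw [← Real.rpow_natCast, ← Real.rpow_add (hann x hx)]
    congr 1
    push_cast
    ring
  have hms : MeasurableSet (Metric.ball (0 : Space n) b \ Metric.ball 0 a) :=
    measurableSet_ball.diff measurableSet_ball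
  -- The exponent M = n + 2α - 2 equals the coefficient in the divergence, so the energy density e
  -- cancels and only τp with τ = αu - p survives.
  have s1 : ∫ x in Metric.ball (0 : Space n) b \ Metric.ball 0 a,
      (‖x‖ ^ (-(n + 2 * α - 2)) * ((n + 2 * α - 2) * e x) - (n + 2 * α - 2) *
        ‖x‖ ^ (-(n + 2 * α - 2) - 2) * (‖x‖ ^ 2 * e x + (α * u x - p x) * p x)) =
      -((n + 2 * α - 2) * ∫ x in Metric.ball (0 : Space n) b \ Metric.ball 0 a,
        ‖x‖ ^ (-(n + 2 * α)) * ((α * u x - p x) * p x)) := by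
    rw [← integral_const_mul, ← integral_neg]
    refine setIntegral_congr_fun hms fun x hx => ?_
    have h1 := hpow (n + 2 * α - 2) x hx
    rw [← h1, show -(n + 2 * α - 2) - 2 = -(n + 2 * α) by ring]
    ring
  -- With M = n + 2α the terms n u² cancel and 2u p - 2α u² = -2uτ is left. Weighted by α/2 and
  -- combined with the τp term, this gives τ(αu - p) = τ².
  have s2 : ∫ x in Metric.ball (0 : Space n) b \ Metric.ball 0 a,
      (‖x‖ ^ (-(n + 2 * α)) * (n * u x ^ 2 + 2 * (u x * p x)) - (n + 2 * α) *
        ‖x‖ ^ (-(n + 2 * α) - 2) * (‖x‖ ^ 2 * u x ^ 2)) =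
      -(2 * ∫ x in Metric.ball (0 : Space n) b \ Metric.ball 0 a,
        ‖x‖ ^ (-(n + 2 * α)) * (u x * (α * u x - p x))) := by
    rw [← integral_const_mul, ← integral_neg]
    refine setIntegral_congr_fun hms fun x hx => ?_
    have h1 := hpow (n + 2 * α) x hx
    linear_combination (-(n + 2 * α) * u x ^ 2) * h1
  have s3 : ∫ x in Metric.ball (0 : Space n) b \ Metric.ball 0 a,
      ‖x‖ ^ (-(n + 2 * α)) * (α * u x - p x) ^ 2 =
      α * (∫ x in Metric.ball (0 : Space n) b \ Metric.ball 0 a,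
        ‖x‖ ^ (-(n + 2 * α)) * (u x * (α * u x - p x))) -
      ∫ x in Metric.ball (0 : Space n) b \ Metric.ball 0 a,
        ‖x‖ ^ (-(n + 2 * α)) * ((α * u x - p x) * p x) := by
    rw [← integral_const_mul, ← integral_sub ((integrableOn_annulus ha hbR _ iuτ).const_mul _)
      (integrableOn_annulus ha hbR _ iτp)]
    refine setIntegral_congr_fun hms fun x hx => ?_
    ring
  have g1' := g1.trans (congrArg _ s1)
  have g2' := g2.trans (congrArg _ s2)
  simp only [integral_const_mul] at g1'
  rw [s3]
  have g1'' : b ^ (-(n + 2 * α - 2)) * (∫ x in Metric.ball (0 : Space n) b, e x) =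
      a ^ (-(n + 2 * α - 2)) * (∫ x in Metric.ball (0 : Space n) a, e x) -
      ∫ x in Metric.ball (0 : Space n) b \ Metric.ball 0 a,
        ‖x‖ ^ (-(n + 2 * α)) * ((α * u x - p x) * p x) := by
    refine mul_left_cancel₀ hN.ne' ?_
    linear_combination g1'
  linear_combination g1'' - α / 2 * g2'

end AltPhillips

namespace AltPhillips

variable {n : ℕ}

/-! ### Homogeneous functions -/

theorem ae_eq_zero_of_forall_isTestFunction {Ω : Set (Space n)} (hΩ : IsOpen Ω)
    {f : Space n → ℝ} (hf : IntegrableOn f Ω)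
    (h : ∀ φ, IsTestFunction Ω φ → ∫ x in Ω, φ x * f x = 0) :
    ∀ᵐ x ∂(volume.restrict Ω), f x = 0 := by
  rw [ae_restrict_iff' hΩ.measurableSet]
  refine hΩ.ae_eq_zero_of_integral_contDiff_smul_eq_zero hf.locallyIntegrableOn
    fun g hg hgc hgs => ?_
  have hφ : IsTestFunction Ω g := ⟨hg, hgc, hgs⟩
  rw [← h g hφ]
  refine (setIntegral_eq_integral_of_forall_compl_eq_zero fun x hx => ?_).symm
  rw [hφ.zero_of_notMem hx, zero_smul]

theorem IsTestFunction.comp_smul {R : ℝ} {φ : Space n → ℝ}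
    (hφ : IsTestFunction (Metric.ball 0 R) φ) {s : ℝ} (hs : 1 ≤ s) :
    IsTestFunction (Metric.ball 0 R) fun x => φ (s • x) := by
  have hs0 : s ≠ 0 := by positivity
  refine ⟨hφ.smooth.comp (contDiff_const_smul s), hφ.compact.comp_smul hs0, ?_⟩
  refine (tsupport_comp_subset_preimage φ (continuous_const_smul s)).trans fun x hx => ?_
  have h1 := mem_ball_zero_iff.1 (hφ.support hx)
  rw [norm_smul, Real.norm_eq_abs, abs_of_pos (by positivity)] at h1
  rw [mem_ball_zero_iff]
  nlinarith [norm_nonneg x]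

theorem integral_comp_smul_ball {R : ℝ} {u φ : Space n → ℝ}
    (hφ : IsTestFunction (Metric.ball 0 R) φ) {t : ℝ} (ht : t ∈ Ioc (0 : ℝ) 1) :
    ∫ x in Metric.ball 0 R, φ x * u (t • x) =
      (t ^ n)⁻¹ * ∫ x in Metric.ball 0 R, φ (t⁻¹ • x) * u x := by
  have h1 : ∫ x in Metric.ball 0 R, φ x * u (t • x) = ∫ x, φ x * u (t • x) :=
    setIntegral_eq_integral_of_forall_compl_eq_zero fun x hx => by
      rw [hφ.zero_of_notMem hx, zero_mul]
  have h2 : ∫ x in Metric.ball 0 R, φ (t⁻¹ • x) * u x = ∫ x, φ (t⁻¹ • x) * u x :=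
    setIntegral_eq_integral_of_forall_compl_eq_zero fun x hx => by
      rw [(hφ.comp_smul ((one_le_inv₀ ht.1).2 ht.2)).zero_of_notMem hx, zero_mul]
  have h3 := Measure.integral_comp_smul (volume : Measure (Space n))
    (fun x => φ (t⁻¹ • x) * u x) t
  simp only [smul_smul, inv_mul_cancel₀ ht.1.ne', one_smul, finrank_euclideanSpace,
    Fintype.card_fin, smul_eq_mul] at h3
  rw [h1, h2, h3, abs_of_nonneg (by have := ht.1; positivity)]

/-- Homogeneity in the sense of distributions. -/
theorem isHomogeneousInBall_iff {R a : ℝ} {u : Space n → ℝ}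
    (hu : IntegrableOn u (Metric.ball 0 R)) :
    IsHomogeneousInBall a u R ↔ ∀ φ, IsTestFunction (Metric.ball 0 R) φ → ∀ s : ℝ, 1 ≤ s →
      s ^ (n + a) * ∫ x in Metric.ball 0 R, φ (s • x) * u x = ∫ x in Metric.ball 0 R, φ x * u x := by
  -- Contracting u by t amounts to dilating the argument of φ by s = 1/t ≥ 1. This shrinks the
  -- support of φ, so it stays in the ball.
  have key : ∀ φ, IsTestFunction (Metric.ball (0 : Space n) R) φ → ∀ t ∈ Ioc (0 : ℝ) 1,
      ∫ x in Metric.ball 0 R, φ x * u (t • x) =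
        t ^ a * (t⁻¹ ^ (n + a) * ∫ x in Metric.ball 0 R, φ (t⁻¹ • x) * u x) := by
    intro φ hφ t ht
    rw [integral_comp_smul_ball hφ ht, ← mul_assoc, Real.inv_rpow ht.1.le, Real.rpow_add ht.1,
      Real.rpow_natCast, mul_inv, mul_left_comm, mul_inv_cancel₀ (Real.rpow_pos_of_pos ht.1 a).ne',
      mul_one]
  have hmul : ∀ φ, IsTestFunction (Metric.ball (0 : Space n) R) φ → ∀ f : Space n → ℝ,
      IntegrableOn f (Metric.ball 0 R) → IntegrableOn (fun x => φ x * f x) (Metric.ball 0 R) :=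
    fun φ hφ f hf => (hasDerivAt_integral_ball_mul (R := R) (A := fun _ x => φ x)
      (A' := fun _ _ => 0) (hφ.smooth.continuous.comp continuous_snd) (by fun_prop)
      (fun ε x => hasDerivAt_const _ _) hf 0).1 0
  constructor
  · intro h φ hφ s hs
    have hs0 : 0 < s := by positivity
    have ht : s⁻¹ ∈ Ioc (0 : ℝ) 1 := ⟨by positivity, inv_le_one_of_one_le₀ hs⟩
    have h1 := key φ hφ _ ht
    have h2 : ∫ x in Metric.ball 0 R, φ x * u (s⁻¹ • x) =
        s⁻¹ ^ a * ∫ x in Metric.ball 0 R, φ x * u x := by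
      rw [← integral_const_mul]
      refine integral_congr_ae ?_
      filter_upwards [h _ ht] with x hx
      rw [hx]
      ring
    rw [h2, inv_inv] at h1
    exact (mul_left_cancel₀ (Real.rpow_pos_of_pos ht.1 a).ne' h1).symm
  · intro h t ht
    have hut : IntegrableOn (fun x => u (t • x)) (Metric.ball 0 R) := by
      have h1 := (integrable_comp_smul_iff volume
        ((Metric.ball (0 : Space n) R).indicator u) ht.1.ne').2
          ((integrable_indicator_iff measurableSet_ball).2 hu)
      refine (h1.integrableOn (s := Metric.ball 0 R)).congr_fun (fun x hx => ?_) measurableSet_ball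
      refine indicator_of_mem ?_ _
      rw [mem_ball_zero_iff, norm_smul, Real.norm_eq_abs, abs_of_pos ht.1]
      nlinarith [mem_ball_zero_iff.1 hx, norm_nonneg x, ht.2]
    have h0 : ∀ᵐ x ∂(volume.restrict (Metric.ball (0 : Space n) R)),
        u (t • x) - t ^ a * u x = 0 := by
      refine ae_eq_zero_of_forall_isTestFunction Metric.isOpen_ball
        (Integrable.sub hut (hu.const_mul _)) fun φ hφ => ?_
      simp only [mul_sub, mul_left_comm (φ _)]
      rw [integral_sub (hmul φ hφ _ hut) ((hmul φ hφ _ hu).const_mul _), integral_const_mul,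
        key φ hφ t ht, h φ hφ _ ((one_le_inv₀ ht.1).2 ht.2), sub_self]
    filter_upwards [h0] with x hx using sub_eq_zero.1 hx

/-- Euler's theorem on homogeneous functions. -/
theorem HasWeakGradient.isHomogeneousInBall_iff {R a : ℝ} {u : Space n → ℝ}
    {G : Space n → Space n} (hu : HasWeakGradient (Metric.ball 0 R) u G) :
    IsHomogeneousInBall a u R ↔
      ∀ᵐ x ∂(volume.restrict (Metric.ball (0 : Space n) R)), a * u x - inner ℝ (G x) x = 0 := by
  have hfm : IsFiniteMeasure (volume.restrict (Metric.ball (0 : Space n) R)) :=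
    ⟨by simpa using measure_ball_lt_top⟩
  have iu : IntegrableOn u (Metric.ball 0 R) := hu.memLp.integrable (by norm_num)
  have ip : IntegrableOn (fun x => inner ℝ (G x) x) (Metric.ball 0 R) :=
    (memLp_inner_id hu.memLp_grad).integrable (by norm_num)
  have iτ : IntegrableOn (fun x => a * u x - inner ℝ (G x) x) (Metric.ball 0 R) :=
    (iu.const_mul a).sub ip
  have hmul : ∀ φ, IsTestFunction (Metric.ball (0 : Space n) R) φ → ∀ f : Space n → ℝ,
      IntegrableOn f (Metric.ball 0 R) → IntegrableOn (fun x => φ x * f x) (Metric.ball 0 R) :=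
    fun φ hφ f hf => (hasDerivAt_integral_ball_mul (R := R) (A := fun _ x => φ x)
      (A' := fun _ _ => 0) (hφ.smooth.continuous.comp continuous_snd) (by fun_prop)
      (fun ε x => hasDerivAt_const _ _) hf 0).1 0
  -- The derivative in s falls on φ, and the weak form of div(x u) moves it onto u, producing
  -- Euler's expression a u - x·∇u.
  have key : ∀ φ, IsTestFunction (Metric.ball (0 : Space n) R) φ → ∀ s : ℝ, 1 ≤ s →
      HasDerivAt (fun s : ℝ => s ^ (n + a) * ∫ x in Metric.ball 0 R, φ (s • x) * u x)
        (s ^ (n + a - 1) * ∫ x in Metric.ball 0 R, φ (s • x) * (a * u x - inner ℝ (G x) x)) s := by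
    intro φ hφ s hs
    have hs0 : 0 < s := by positivity
    have hφs := hφ.comp_smul hs
    have hfd : ∀ (ε : ℝ) (x : Space n), HasDerivAt (fun ε : ℝ => φ (ε • x)) (fderiv ℝ φ (ε • x) x) ε := by
      intro ε x
      have h1 : HasDerivAt (fun ε : ℝ => ε • x) x ε := by
        simpa using (hasDerivAt_id ε).smul_const x
      exact (hφ.smooth.differentiable (by simp) (ε • x)).hasFDerivAt.comp_hasDerivAt ε h1
    have hc := hφ.smooth.continuous
    have hc' := hφ.smooth.continuous_fderiv (by simp)
    obtain ⟨-, hd⟩ := hasDerivAt_integral_ball_mul (R := R) (A := fun ε x => φ (ε • x))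
      (A' := fun ε x => fderiv ℝ φ (ε • x) x) (by fun_prop) (by fun_prop) hfd iu s
    refine ((Real.hasDerivAt_rpow_const (p := n + a) (Or.inl hs0.ne')).mul hd).congr_deriv ?_
    have hw := hu.weak_radial hφs
    have hfs : ∀ x, fderiv ℝ (fun x => φ (s • x)) x x = s * fderiv ℝ φ (s • x) x := by
      intro x
      have h1 : HasFDerivAt (fun x : Space n => φ (s • x)) _ x :=
        (hφ.smooth.differentiable (by simp) (s • x)).hasFDerivAt.comp x
          ((hasFDerivAt_id x).const_smul s)
      rw [h1.fderiv]
      simp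
    have iD : IntegrableOn (fun x => fderiv ℝ φ (s • x) x * u x) (Metric.ball 0 R) :=
      (hasDerivAt_integral_ball_mul (R := R) (A := fun _ x => fderiv ℝ φ (s • x) x)
        (A' := fun _ _ => 0) (by fun_prop) (by fun_prop) (fun ε x => hasDerivAt_const _ _) iu 0).1 0
    have e1 : ∫ x in Metric.ball 0 R, u x * (n * φ (s • x) + fderiv ℝ (fun x => φ (s • x)) x x) =
        n * (∫ x in Metric.ball 0 R, φ (s • x) * u x) +
          s * ∫ x in Metric.ball 0 R, fderiv ℝ φ (s • x) x * u x := by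
      rw [← integral_const_mul, ← integral_const_mul,
        ← integral_add ((hmul _ hφs _ iu).const_mul _) (iD.const_mul _)]
      refine integral_congr_ae (.of_forall fun x => ?_)
      simp only [hfs]
      ring
    have e2 : ∫ x in Metric.ball 0 R, φ (s • x) * (a * u x - inner ℝ (G x) x) =
        a * (∫ x in Metric.ball 0 R, φ (s • x) * u x) -
          ∫ x in Metric.ball 0 R, inner ℝ (G x) x * φ (s • x) := by
      have i2 : IntegrableOn (fun x => inner ℝ (G x) x * φ (s • x)) (Metric.ball 0 R) := by
        refine (hmul _ hφs _ ip).congr (.of_forall fun x => ?_)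
        simp only
        ring
      rw [← integral_const_mul, ← integral_sub ((hmul _ hφs _ iu).const_mul _) i2]
      refine integral_congr_ae (.of_forall fun x => ?_)
      simp only
      ring
    have e3 : s ^ ((n : ℝ) + a) = s ^ ((n : ℝ) + a - 1) * s := by
      rw [← Real.rpow_add_one hs0.ne', sub_add_cancel]
    rw [e1] at hw
    rw [e2, e3]
    linear_combination (s ^ ((n : ℝ) + a - 1)) * hw
  rw [AltPhillips.isHomogeneousInBall_iff iu]
  constructor
  · intro h
    refine ae_eq_zero_of_forall_isTestFunction Metric.isOpen_ball iτ fun φ hφ => ?_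
    -- Homogeneity controls only s ≥ 1, so the derivative at 1 is identified from the right.
    have h1 := (key φ hφ 1 le_rfl).hasDerivWithinAt (s := Ici 1)
    have h2 : HasDerivWithinAt (fun s : ℝ => s ^ (n + a) * ∫ x in Metric.ball 0 R, φ (s • x) * u x)
        0 (Ici 1) 1 :=
      (hasDerivWithinAt_const 1 (Ici 1) (∫ x in Metric.ball 0 R, φ x * u x)).congr
        (fun s hs => h φ hφ s hs) (h φ hφ 1 le_rfl)
    have h3 := (uniqueDiffWithinAt_Ici (1 : ℝ)).eq_deriv _ h1 h2
    simpa using h3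
  · intro h φ hφ s hs
    have h1 : ∀ s : ℝ, 1 ≤ s →
        HasDerivAt (fun s : ℝ => s ^ (n + a) * ∫ x in Metric.ball 0 R, φ (s • x) * u x) 0 s := by
      intro s hs
      refine (key φ hφ s hs).congr_deriv ?_
      rw [integral_eq_zero_of_ae, mul_zero]
      filter_upwards [h] with x hx
      simp [hx]
    have h2 := constant_of_has_deriv_right_zero (a := 1) (b := s)
      (fun x hx => (h1 x hx.1).continuousAt.continuousWithinAt)
      (fun x hx => (h1 x hx.1).hasDerivWithinAt) s ⟨hs, le_rfl⟩
    simpa using h2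

/-- The Weiss energy is constant precisely where Euler's equation holds. -/
theorem IsMinimizer.weissEnergy_const_iff (hn : 1 ≤ n) {γ : ℝ} (hγ : γ ∈ Ioo (0 : ℝ) 2) {R : ℝ}
    (hR : 0 < R) {u : Space n → ℝ} {G : Space n → Space n}
    (hm : IsMinimizer γ u (Metric.ball 0 R)) (hu : HasWeakGradient (Metric.ball 0 R) u G) :
    (∃ c, ∀ r ∈ Ioc 0 R, weissEnergy γ u r = c) ↔
      ∀ᵐ x ∂(volume.restrict (Metric.ball (0 : Space n) R)),
        homExponent γ * u x - inner ℝ (G x) x = 0 := by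
  have hτ : MemLp (fun x => homExponent γ * u x - inner ℝ (G x) x) 2
      (volume.restrict (Metric.ball 0 R)) := (hu.memLp.const_mul _).sub (memLp_inner_id hu.memLp_grad)
  have iττ : IntegrableOn (fun x => (homExponent γ * u x - inner ℝ (G x) x) ^ 2)
      (Metric.ball 0 R) := hτ.integrable_sq
  constructor
  · rintro ⟨c, hc⟩
    -- The increment formula needs a positive inner radius. The radii R/(k+2) are all below R, and
    -- these annuli exhaust the ball minus the origin, a null set since n ≥ 1.
    have h1 : ∀ k : ℕ, ∀ᵐ x : Space n, x ∈ Metric.ball (0 : Space n) R \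
        Metric.ball 0 (R / (k + 2)) → homExponent γ * u x - inner ℝ (G x) x = 0 := by
      intro k
      have ha : 0 < R / ((k : ℝ) + 2) := by positivity
      have haR : R / ((k : ℝ) + 2) < R := div_lt_self hR (by linarith [(k.cast_nonneg : (0:ℝ) ≤ k)])
      have hms : MeasurableSet (Metric.ball (0 : Space n) R \ Metric.ball 0 (R / (k + 2))) :=
        measurableSet_ball.diff measurableSet_ball
      have h2 := hm.weissEnergy_sub hn hγ hR hu ha haR le_rfl
      rw [hc R ⟨hR, le_rfl⟩, hc _ ⟨ha, haR.le⟩, sub_self, eq_comm, integral_eq_zero_iff_of_nonneg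
        (fun x => by positivity) (integrableOn_annulus ha le_rfl _ iττ)] at h2
      rw [← ae_restrict_iff' hms]
      filter_upwards [h2, ae_restrict_mem hms] with x hx hxm
      have hx0 : 0 < ‖x‖ := ha.trans_le (by simpa using hxm.2)
      simpa [(Real.rpow_pos_of_pos hx0 _).ne'] using hx
    have : Nonempty (Fin n) := ⟨⟨0, hn⟩⟩
    have h0 : ∀ᵐ x : Space n, x ≠ 0 := by
      simp [ae_iff]
    rw [ae_restrict_iff' measurableSet_ball]
    filter_upwards [ae_all_iff.2 h1, h0] with x hx hx0 hxR
    have hpos : 0 < ‖x‖ := norm_pos_iff.2 hx0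
    obtain ⟨k, hk⟩ := exists_nat_gt (R / ‖x‖)
    refine hx k ⟨hxR, ?_⟩
    rw [mem_ball_zero_iff, not_lt, div_le_iff₀ (by positivity)]
    rw [div_lt_iff₀ hpos] at hk
    nlinarith
  · intro h
    refine ⟨weissEnergy γ u R, fun r hr => ?_⟩
    rcases hr.2.eq_or_lt with rfl | hrR
    · rfl
    have h2 := hm.weissEnergy_sub hn hγ hR hu hr.1 hrR le_rfl
    rw [integral_eq_zero_of_ae, sub_eq_zero] at h2
    · exact h2.symm
    · filter_upwards [ae_restrict_of_ae_restrict_of_subset sdiff_subset h] with x hx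
      simp [hx]

end AltPhillips
-- Monotonicity and rigidity of the Weiss energy.
theorem mainTheorem7 (n : ℕ) (hn : 1 ≤ n) (γ : ℝ) (hγ : γ ∈ Set.Ioo (0 : ℝ) 2)
    (R : ℝ) (hR : 0 < R) (u : AltPhillips.Space n → ℝ)
    (hu : AltPhillips.IsMinimizer γ u (Metric.ball 0 R)) :
    (∀ r ∈ Set.Ioc 0 R, AltPhillips.energy γ u (Metric.ball 0 r) ≠ ⊤ ∧
      ∃ g : AltPhillips.Space n → ℝ, AltPhillips.IsSphereTrace u r g) ∧
    MonotoneOn (AltPhillips.weissEnergy γ u) (Set.Ioc 0 R) ∧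
    ((∃ c : ℝ, ∀ r ∈ Set.Ioc 0 R, AltPhillips.weissEnergy γ u r = c) ↔
      AltPhillips.IsHomogeneousInBall (AltPhillips.homExponent γ) u R) := by
  have hw := hu.memH1.hasWeakGradient
  refine ⟨fun r hr => ⟨?_, ?_⟩, fun a ha b hb hab => ?_, ?_⟩
  · have hwr := hw.mono (Metric.ball_subset_ball hr.2) measurableSet_ball
    refine ne_top_of_le_ne_top (hu.energy_ne_top hn hγ hR) ?_
    rw [hwr.energy_eq Metric.isOpen_ball, hw.energy_eq Metric.isOpen_ball]
    exact lintegral_mono_set (Metric.ball_subset_ball hr.2)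
  · obtain ⟨g, hg, -⟩ := AltPhillips.exists_sphereTrace hn hr.1
      (hw.mono (Metric.ball_subset_ball hr.2) measurableSet_ball)
    exact ⟨g, hg⟩
  · rcases hab.eq_or_lt with rfl | hab
    · exact le_rfl
    rw [← sub_nonneg, hu.weissEnergy_sub hn hγ hR hw ha.1 hab hb.2]
    exact integral_nonneg fun x => by positivity
  · rw [hu.weissEnergy_const_iff hn hγ hR hw, hw.isHomogeneousInBall_iff]
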